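/- **Theorem (Existence).** Let $N\ge 1$ be an integer, $\delta>0$, $\kappa>0$, $0<\alpha<1$ and $p\ge 2$, let $B_\delta(0)\subset\mathbb R^N$ be the open ball of radius $\delta$ around the origin, and let $\Omega:=(\mathbb R^N\setminus\{0\})\times\mathbb R^N$. Let $f\in C^1(\Omega;\mathbb R^N)$ satisfy $f(-y,-u)=-f(y,u)$ on $\Omega$, and suppose that $f=\nabla_u\Phi$ for some $\Phi\in C^2(\Omega)$ of the form $$\Phi(y,u)=\kappa\,\frac{|u|^p}{|y|^{N+\alpha p}}+\Psi(y,u),\qquad \Psi(y,0)=0\le \Psi(y,u),\qquad |\nabla_u\Psi(y,u)|\le g(y),\quad |D^2_u\Psi(y,u)|\le g(y)$$ for all $(y,u)\in\Omega$, where $g\in L^2_{\rm loc}(\mathbb R^N)$ is a nonnegative function. Consider the Cauchy problem $$\partial_{tt}u(x,t)=(Ku(\cdot,t))(x)\quad(x\in\mathbb R^N,\ t>0),\qquad u(x,0)=u_0(x),\quad \partial_tu(x,0)=v_0(x),$$ where $(Ku)(x)=\int_{B_\delta(x)}f(x'-x,u(x')-u(x))\,dx'=-\int_{B_\delta(0)}f(y,u(x)-u(x-y))\,dy$.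 Let $\mathcal W$ be the space of functions $u:\mathbb R^N\to\mathbb R^N$ with finite norm $$\|u\|_{\mathcal W}=\|u\|_{L^2}+\Big(\int_{\mathbb R^N}\int_{B_\delta(0)}\frac{|u(x)-u(x-y)|^p}{|y|^{N+\alpha p}}\,dy\,dx\Big)^{1/p}.$$ For $u\in\mathcal W$ the integral defining $(Ku)(x)$ need not converge absolutely, and $Ku$ is understood through the pairing $$\langle Ku,v\rangle:=-\frac12\int_{\mathbb R^N}\int_{B_\delta(0)}f(y,u(x)-u(x-y))\cdot(v(x)-v(x-y))\,dy\,dx,$$ which, since $f$ is odd, equals $\int_{\mathbb R^N}(Ku)(x)\cdot v(x)\,dx$ whenever the integrals in the latter converge absolutely. A *weak solution* is a function $u:\mathbb R^N\times[0,\infty)\to\mathbb R^N$ such that $u\in L^\infty(0,T;\mathcal W)$ for every $T>0$, its distributional derivative satisfies $\partial_tu\in L^\infty(0,\infty;L^2(\mathbb R^N;\mathbb R^N))$, and for every $v\in C^\infty(\mathbb R^{N+1};\mathbb R^N)$ with compact support the function $(t,x,y)\mapsto f(y,u(x,t)-u(x-y,t))\cdot(v(x,t)-v(x-y,t))$ is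 integrable on $(0,\infty)\times\mathbb R^N\times B_\delta(0)$ and $$\int_0^\infty\Big(\int_{\mathbb R^N}u(x,t)\cdot\partial_{tt}v(x,t)\,dx-\langle Ku(\cdot,t),v(\cdot,t)\rangle\Big)dt-\int_{\mathbb R^N}v_0(x)\cdot v(x,0)\,dx+\int_{\mathbb R^N}u_0(x)\cdot\partial_tv(x,0)\,dx=0 .$$ Then for all $u_0,v_0\in L^2(\mathbb R^N;\mathbb R^N)$ with $$\int_{\mathbb R^N}\int_{B_\delta(0)}\Phi(y,u_0(x)-u_0(x-y))\,dy\,dx<\infty$$ the Cauchy problem has at least one weak solution $u$ such that, for a.e. $t\ge 0$, $$E[u](t):=\frac12\|\partial_tu(\cdot,t)\|_{L^2}^2+\frac12\int_{\mathbb R^N}\int_{B_\delta(0)}\Phi(y,u(x,t)-u(x-y,t))\,dy\,dx\ \le\ E[u](0),$$ where $E[u](0):=\frac12\|v_0\|_{L^2}^2+\frac12\int_{\mathbb R^N}\int_{B_\delta(0)}\Phi(y,u_0(x)-u_0(x-y))\,dy\,dx$ is the energy of the initial datum. -/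

import Mathlib

open MeasureTheory Set Metric Filter Topology
open scoped ENNReal NNReal ContDiff InnerProductSpace

namespace Peridynamics

/-- Euclidean space `ℝ^N`. -/
abbrev Vec (N : ℕ) : Type := EuclideanSpace ℝ (Fin N)

/-- The set `(ℝ^N \ {0}) × ℝ^N` of pairs (bond `y`, relative displacement `u`) on which the
pairwise force is defined. Forces and potentials are total functions `Vec N → Vec N → _` in Lean;
nothing is assumed about their values at `y = 0`. -/
def forceDomain (N : ℕ) : Set (Vec N × Vec N) := {0}ᶜ ×ˢ univ

/-- The constitutive assumptions: `f` is `C¹` and odd, and the material is hyperelastic,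
`f = ∇_u Φ` with `Φ ∈ C²` and `Φ(y,u) = κ |u|^p / |y|^(N + α p) + Ψ(y,u)`, where
`Ψ(y,0) = 0 ≤ Ψ(y,u)` and `|∇_u Ψ|, |D²_u Ψ| ≤ g(y)` for some nonnegative `g ∈ L²_loc`. -/
structure IsHyperelastic {N : ℕ} (κ p α : ℝ) (f : Vec N → Vec N → Vec N)
    (Φ Ψ : Vec N → Vec N → ℝ) : Prop where
  f_contDiff : ContDiffOn ℝ 1 (fun z : Vec N × Vec N => f z.1 z.2) (forceDomain N)
  f_odd : ∀ y u : Vec N, y ≠ 0 → f (-y) (-u) = -f y u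
  Φ_contDiff : ContDiffOn ℝ 2 (fun z : Vec N × Vec N => Φ z.1 z.2) (forceDomain N)
  f_eq_gradient : ∀ y u : Vec N, y ≠ 0 → HasGradientAt (Φ y) (f y u) u
  κ_pos : 0 < κ
  α_pos : 0 < α
  α_lt_one : α < 1
  two_le_p : 2 ≤ p
  Φ_eq : ∀ y u : Vec N, y ≠ 0 → Φ y u = κ * (‖u‖ ^ p / ‖y‖ ^ ((N : ℝ) + α * p)) + Ψ y u
  Ψ_zero : ∀ y : Vec N, y ≠ 0 → Ψ y 0 = 0
  Ψ_nonneg : ∀ y u : Vec N, y ≠ 0 → 0 ≤ Ψ y u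
  Ψ_bound : ∃ g : Vec N → ℝ, (∀ y, 0 ≤ g y) ∧
    (∀ S : Set (Vec N), IsCompact S → MemLp g 2 (volume.restrict S)) ∧
    ∀ y u : Vec N, y ≠ 0 →
      ‖gradient (Ψ y) u‖ ≤ g y ∧ ‖fderiv ℝ (gradient (Ψ y)) u‖ ≤ g y

/-- The peridynamic operator `(K u)(x) = ∫_{B_δ(x)} f(x' - x, u(x') - u(x)) dx'`, for those `u`
for which the integral converges absolutely. -/
noncomputable def operator {N : ℕ} (δ : ℝ) (f : Vec N → Vec N → Vec N) (u : Vec N → Vec N)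
    (x : Vec N) : Vec N :=
  ∫ x' in ball x δ, f (x' - x) (u x' - u x)

/-- The integrand `f(y, u(x) - u(x-y)) · (v(x) - v(x-y))` of the energetic form. -/
noncomputable def formIntegrand {N : ℕ} (f : Vec N → Vec N → Vec N) (u v : Vec N → Vec N)
    (z : Vec N × Vec N) : ℝ :=
  ⟪f z.2 (u z.1 - u (z.1 - z.2)), v z.1 - v (z.1 - z.2)⟫_ℝ

/-- The pairing `⟨K u, v⟩ = ∫ (K u)(x) · v(x) dx` for a `u` of the energy space, in the form
`-(1/2) ∫_{ℝ^N} ∫_{B_δ(0)} f(y, u(x) - u(x-y)) · (v(x) - v(x-y)) dy dx`. The singularity of `f` is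
such that the integral defining `(K u)(x)` need not converge for a `u` in the energy space,
while this one does. By `integral_operator_eq_pairing` below the two agree when the former
converges. -/
noncomputable def pairing {N : ℕ} (δ : ℝ) (f : Vec N → Vec N → Vec N) (u v : Vec N → Vec N) : ℝ :=
  -(1 / 2) * ∫ z, formIntegrand f u v z ∂((volume : Measure (Vec N)).prod
    (volume.restrict (ball 0 δ)))

/-- The map `(x, y) ↦ (x - y, -y)` preserves the measure of `ℝ^N × B_δ(0)`. -/
theorem measurePreserving_flip (N : ℕ) (δ : ℝ) :
    MeasurePreserving (fun z : Vec N × Vec N => (z.1 - z.2, -z.2))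
      ((volume : Measure (Vec N)).prod (volume.restrict (ball 0 δ)))
      ((volume : Measure (Vec N)).prod (volume.restrict (ball 0 δ))) := by
  have hneg : MeasurePreserving (fun y : Vec N => -y) (volume.restrict (ball 0 δ))
      (volume.restrict (ball 0 δ)) := by
    have h := (Measure.measurePreserving_neg (volume : Measure (Vec N))).restrict_preimage
      (measurableSet_ball (x := (0 : Vec N)) (ε := δ))
    have hs : (Neg.neg ⁻¹' ball (0 : Vec N) δ) = ball 0 δ := by
      ext y; simp
    rw [hs] at h
    exact h
  have hskew : MeasurePreserving (fun z : Vec N × Vec N => (-z.1, z.2 - z.1))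
      ((volume.restrict (ball 0 δ)).prod (volume : Measure (Vec N)))
      ((volume.restrict (ball 0 δ)).prod (volume : Measure (Vec N))) :=
    hneg.skew_product (g := fun y x => x - y) (by fun_prop)
      (Eventually.of_forall fun y => (measurePreserving_sub_right volume y).map_eq)
  exact (Measure.measurePreserving_swap.comp hskew).comp Measure.measurePreserving_swap

/-- If the integral defining `K u` and the integral of `(K u) · v` converge absolutely, then
`∫ (K u)(x) · v(x) dx` is the pairing `⟨K u, v⟩`. -/
theorem integral_operator_eq_pairing {N : ℕ} (hN : 1 ≤ N) (δ : ℝ)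
    (f : Vec N → Vec N → Vec N) (hf : ∀ y u : Vec N, y ≠ 0 → f (-y) (-u) = -f y u)
    (u v : Vec N → Vec N)
    (h1 : ∀ᵐ x : Vec N, IntegrableOn (fun y => f y (u x - u (x - y))) (ball 0 δ))
    (h2 : Integrable (fun z : Vec N × Vec N => ⟪f z.2 (u z.1 - u (z.1 - z.2)), v z.1⟫_ℝ)
      ((volume : Measure (Vec N)).prod (volume.restrict (ball 0 δ)))) :
    ∫ x, ⟪operator δ f u x, v x⟫_ℝ = pairing δ f u v := by
  have : Nonempty (Fin N) := ⟨⟨0, hN⟩⟩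
  set μ := (volume : Measure (Vec N)).prod (volume.restrict (ball (0 : Vec N) δ)) with hμ
  set A : Vec N × Vec N → ℝ := fun z => ⟪f z.2 (u z.1 - u (z.1 - z.2)), v z.1⟫_ℝ with hA
  have hne : ∀ᵐ y : Vec N, y ≠ 0 := by
    simp [ae_iff]
  -- the operator after the substitution `x' = x - y`
  have hop : ∀ x, operator δ f u x = -∫ y in ball (0 : Vec N) δ, f y (u x - u (x - y)) := by
    intro x
    have hmp := (Measure.measurePreserving_sub_left (volume : Measure (Vec N)) x).restrict_preimage
      (measurableSet_ball (x := x) (ε := δ))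
    have hs : ((fun y : Vec N => x - y) ⁻¹' ball x δ) = ball 0 δ := by
      ext y; simp
    rw [hs] at hmp
    have hemb : MeasurableEmbedding (fun y : Vec N => x - y) :=
      (Homeomorph.subLeft x).measurableEmbedding
    rw [operator, ← hmp.integral_comp hemb, ← integral_neg]
    apply integral_congr_ae
    filter_upwards [ae_restrict_of_ae hne] with y hy
    have := hf y (u x - u (x - y)) hy
    rw [← this]
    congr 1 <;> abel
  have hL : ∫ x, ⟪operator δ f u x, v x⟫_ℝ = -∫ z, A z ∂μ := by
    rw [hμ, integral_prod _ h2, ← integral_neg]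
    apply integral_congr_ae
    filter_upwards [h1] with x hx
    rw [hop, inner_neg_left, real_inner_comm, ← integral_inner hx]
    simp only [hA, real_inner_comm]
  have hflip := measurePreserving_flip N δ
  have hne2 : ∀ᵐ z ∂μ, z.2 ≠ 0 :=
    Measure.quasiMeasurePreserving_snd.ae (ae_restrict_of_ae hne)
  have hcomp : ∀ᵐ z ∂μ, A (z.1 - z.2, -z.2)
      = -⟪f z.2 (u z.1 - u (z.1 - z.2)), v (z.1 - z.2)⟫_ℝ := by
    filter_upwards [hne2] with z hz
    simp only [hA]
    rw [← inner_neg_left, ← hf _ _ hz]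
    congr 2
    rw [neg_sub, sub_neg_eq_add, sub_add_cancel]
  have hint : Integrable (fun z : Vec N × Vec N => A (z.1 - z.2, -z.2)) μ :=
    hflip.integrable_comp_of_integrable h2
  have hinv : ∫ z, A (z.1 - z.2, -z.2) ∂μ = ∫ z, A z ∂μ := by
    have hm := integral_map (φ := fun z : Vec N × Vec N => (z.1 - z.2, -z.2))
      hflip.measurable.aemeasurable (f := A) (by rw [hflip.map_eq]; exact h2.1)
    rw [hflip.map_eq] at hm
    exact hm.symm
  have hform : ∫ z, formIntegrand f u v z ∂μ
      = ∫ z, A z ∂μ + ∫ z, A (z.1 - z.2, -z.2) ∂μ := by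
    rw [← integral_add h2 hint]
    apply integral_congr_ae
    filter_upwards [hcomp] with z hz
    rw [hz, formIntegrand, inner_sub_right]
    ring
  rw [hL, pairing, hform, hinv]
  ring

/-- The `p`-th power `∫_{ℝ^N} ∫_{B_δ(0)} |u(x) - u(x-y)|^p / |y|^(N + α p) dy dx` of the nonlocal
seminorm. -/
noncomputable def seminormPow {N : ℕ} (δ p α : ℝ) (u : Vec N → Vec N) : ℝ≥0∞ :=
  ∫⁻ x, ∫⁻ y in ball (0 : Vec N) δ,
    ENNReal.ofReal (‖u x - u (x - y)‖ ^ p / ‖y‖ ^ ((N : ℝ) + α * p))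

/-- The norm `‖u‖_W = ‖u‖_{L²} + (∫∫ |u(x) - u(x-y)|^p / |y|^(N + α p) dy dx)^(1/p)`. -/
noncomputable def wNorm {N : ℕ} (δ p α : ℝ) (u : Vec N → Vec N) : ℝ≥0∞ :=
  eLpNorm u 2 volume + seminormPow δ p α u ^ (1 / p)

/-- The energy `‖w‖²_{L²} / 2 + (1/2) ∫_{ℝ^N} ∫_{B_δ(0)} Φ(y, u(x) - u(x-y)) dy dx` of the state
with displacement `u` and velocity `w`, for `Φ ≥ 0`, as an element of `[0, ∞]`. -/
noncomputable def energy {N : ℕ} (δ : ℝ) (Φ : Vec N → Vec N → ℝ) (u w : Vec N → Vec N) : ℝ≥0∞ :=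
  eLpNorm w 2 volume ^ 2 / 2 +
    (∫⁻ x, ∫⁻ y in ball (0 : Vec N) δ, ENNReal.ofReal (Φ y (u x - u (x - y)))) / 2

/-- Test functions: smooth, compactly supported `v : ℝ × ℝ^N → ℝ^N` (time first). -/
structure IsTestFunction {N : ℕ} (v : ℝ → Vec N → Vec N) : Prop where
  smooth : ContDiff ℝ ∞ (fun q : ℝ × Vec N => v q.1 q.2)
  compact : HasCompactSupport (fun q : ℝ × Vec N => v q.1 q.2)

/-- `w = ∂_t u` in the sense of distributions on `(0, ∞) × ℝ^N`. -/
def IsWeakTimeDeriv {N : ℕ} (u w : ℝ → Vec N → Vec N) : Prop :=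
  ∀ v : ℝ → Vec N → Vec N, IsTestFunction v →
    tsupport (fun q : ℝ × Vec N => v q.1 q.2) ⊆ Ioi 0 ×ˢ univ →
    ∫ t in Ioi (0 : ℝ), ∫ x, ⟪u t x, deriv (fun s => v s x) t⟫_ℝ =
      -∫ t in Ioi (0 : ℝ), ∫ x, ⟪w t x, v t x⟫_ℝ

/-- `u` lies in `L^∞(0,T; W)` for every `T > 0`, and `∂_t u = w` lies in `L^∞(0, ∞; L²)`.
As `W` and `L²` are separable, measurability in `(t, x)` is the right measurability. -/
structure MemX {N : ℕ} (δ p α : ℝ) (u w : ℝ → Vec N → Vec N) : Prop where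
  u_meas : AEStronglyMeasurable (fun q : ℝ × Vec N => u q.1 q.2)
    ((volume.restrict (Ioi 0)).prod volume)
  w_meas : AEStronglyMeasurable (fun q : ℝ × Vec N => w q.1 q.2)
    ((volume.restrict (Ioi 0)).prod volume)
  u_bound : ∀ T : ℝ, 0 < T → ∃ C : ℝ≥0, ∀ᵐ t ∂(volume.restrict (Ioo 0 T)),
    wNorm δ p α (u t) ≤ C
  w_bound : ∃ C : ℝ≥0, ∀ᵐ t ∂(volume.restrict (Ioi (0 : ℝ))), eLpNorm (w t) 2 volume ≤ C
  timeDeriv : IsWeakTimeDeriv u w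

/-- `u`, with time derivative `w = ∂_t u`, is a weak solution of `∂_tt u = K u` on
`ℝ^N × (0, ∞)` with `u(0) = u₀`, `∂_t u(0) = v₀`. -/
structure IsWeakSolution {N : ℕ} (δ p α : ℝ) (f : Vec N → Vec N → Vec N) (u₀ v₀ : Vec N → Vec N)
    (u w : ℝ → Vec N → Vec N) : Prop where
  memX : MemX δ p α u w
  integrable : ∀ v : ℝ → Vec N → Vec N, IsTestFunction v →
    Integrable (fun q : ℝ × Vec N × Vec N => formIntegrand f (u q.1) (v q.1) q.2)
      ((volume.restrict (Ioi 0)).prod (volume.prod (volume.restrict (ball 0 δ))))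
  weak_eq : ∀ v : ℝ → Vec N → Vec N, IsTestFunction v →
    (∫ t in Ioi (0 : ℝ),
        ((∫ x, ⟪u t x, deriv (deriv fun s => v s x) t⟫_ℝ) - pairing δ f (u t) (v t)))
      - (∫ x, ⟪v₀ x, v 0 x⟫_ℝ) + (∫ x, ⟪u₀ x, deriv (fun s => v s x) 0⟫_ℝ) = 0

end Peridynamics

namespace Peridynamics

/-! ### Truncated powers -/

/-! The singular force is approximated by forces that are globally Lipschitz in the displacement:
only bonds in sets `S n` that stay away from `y = 0` and on which `g ≤ n` are kept, and the power
`|u| ^ p` is continued linearly beyond `n`. The approximate operator is then a Lipschitz gradient on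
`L²`, so that `u'' = -A u` is an ordinary differential equation with a global, energy conserving
solution (`exists_force`, `exists_wave_solution`). As the approximate potentials lie below `Φ`, all
these energies are at most the initial energy `E`.

Bounded energy means velocities bounded in `L²`, and accelerations bounded when tested with
Lipschitz functions of bounded support. Hence displacements and velocities converge weakly in `L²`,
at every time, along one subsequence (`exists_subseq_weak_limit`).

A nonlinear force needs more than weak convergence, and the singular weight supplies it. The mean
oscillation of `u` over bonds shorter than `ε` is at most an arbitrarily small constant plus a
multiple of `ε ^ (α p)` times the energy. States of bounded energy are therefore uniformly close, in
`L¹` of a finite measure, to their local averages, and averaging turns weak convergence into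
pointwise convergence (`exists_average`, `exists_subseq_ae`). The truncated potentials do not
control a `p`-th power, but their growth is superlinear uniformly in the truncation
(`rpow_mul_le_truncPow`), which suffices.

Along almost everywhere convergent subsequences the integrands of the energetic form converge
pointwise. By Young's inequality they are at most `ε` times the energy density plus a fixed
function, integrable because `α < 1`; so their integrals converge
(`tendsto_integral_of_almost_dominated`, `tendsto_form`). The energy inequality combines Fatou's
lemma for the potential with weak lower semicontinuity for the velocity. -/

theorem rpow_sub_rpow_le {x y s : ℝ} (hy : 0 ≤ y) (hyx : y ≤ x) (hs : 1 ≤ s) :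
    x ^ s - y ^ s ≤ s * x ^ (s - 1) * (x - y) := by
  rcases hy.trans hyx |>.eq_or_lt with hx | hx
  · have : y = 0 := by linarith
    subst this; subst hx; simp
  have h1 : -1 ≤ y / x - 1 := by
    have := div_nonneg hy hx.le
    linarith
  -- Bernoulli's inequality for `y / x = 1 + (y / x - 1)`. Multiplied by `x ^ s`, it says that the
  -- power lies above its tangent at `x`.
  have h := one_add_mul_self_le_rpow_one_add h1 hs
  rw [add_sub_cancel, Real.div_rpow hy hx.le, le_div_iff₀ (by positivity)] at h
  have e : x ^ s = x ^ (s - 1) * x := by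
    rw [← Real.rpow_add_one hx.ne']; congr 1; ring
  have e2 : (1 + s * (y / x - 1)) * x ^ s = x ^ s + s * x ^ (s - 1) * (y - x) := by
    rw [e]; field_simp
  rw [e2] at h
  linarith

/-- The derivative `p r ^ (p - 1)` of `r ^ p`, made constant for `r ≥ a`. -/
noncomputable def truncSlope (p a r : ℝ) : ℝ := p * (min (max r 0) a) ^ (p - 1)

/-- The power `r ^ p`, continued linearly for `r ≥ a`. -/
noncomputable def truncPow (p a r : ℝ) : ℝ := ∫ s in (0 : ℝ)..r, truncSlope p a s

variable {p a : ℝ}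

theorem truncSlope_zero (hp : 2 ≤ p) (ha : 0 ≤ a) : truncSlope p a 0 = 0 := by
  rw [truncSlope, max_self, min_eq_left ha, Real.zero_rpow (by linarith), mul_zero]

theorem truncSlope_of_le {r : ℝ} (hr : 0 ≤ r) (hra : r ≤ a) :
    truncSlope p a r = p * r ^ (p - 1) := by
  rw [truncSlope, max_eq_left hr, min_eq_left hra]

theorem truncSlope_nonneg (hp : 2 ≤ p) (ha : 0 ≤ a) (r : ℝ) : 0 ≤ truncSlope p a r := by
  have : 0 ≤ min (max r 0) a := le_min (le_max_right _ _) ha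
  unfold truncSlope; positivity

theorem truncSlope_mono (hp : 2 ≤ p) (ha : 0 ≤ a) : Monotone (truncSlope p a) := by
  intro r s hrs
  have h0 : 0 ≤ min (max r 0) a := le_min (le_max_right _ _) ha
  exact mul_le_mul_of_nonneg_left (Real.rpow_le_rpow h0
    (min_le_min_right _ (max_le_max_right _ hrs)) (by linarith)) (by linarith)

theorem truncSlope_le (hp : 2 ≤ p) (ha : 0 ≤ a) {r : ℝ} (hr : 0 ≤ r) :
    truncSlope p a r ≤ p * r ^ (p - 1) := by
  have h0 : 0 ≤ min (max r 0) a := le_min (le_max_right _ _) ha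
  refine mul_le_mul_of_nonneg_left (Real.rpow_le_rpow h0 ?_ (by linarith)) (by linarith)
  rw [max_eq_left hr]; exact min_le_left _ _

/-- Clamping to `[0, a]` does not increase distances, and on `[0, a]` the derivative of `r ^ (p -
1)` is largest at `a` because `p ≥ 2`. -/
theorem truncSlope_lipschitz (hp : 2 ≤ p) (ha : 0 ≤ a) (r s : ℝ) :
    |truncSlope p a r - truncSlope p a s| ≤ p * ((p - 1) * a ^ (p - 2)) * |r - s| := by
  wlog h : s ≤ r generalizing r s
  · rw [abs_sub_comm, abs_sub_comm r]; exact this s r (le_of_not_ge h)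
  rw [abs_of_nonneg (sub_nonneg.2 (truncSlope_mono hp ha h)), abs_of_nonneg (sub_nonneg.2 h)]
  set x := min (max r 0) a with hx
  set y := min (max s 0) a with hy
  have hy0 : 0 ≤ y := le_min (le_max_right _ _) ha
  have hyx : y ≤ x := min_le_min_right _ (max_le_max_right _ h)
  have hxa : x ≤ a := min_le_right _ _
  have h1 := rpow_sub_rpow_le hy0 hyx (s := p - 1) (by linarith)
  have h2 : x - y ≤ r - s := by
    have h3 : |x - y| ≤ |r - s| :=
      (abs_min_sub_min_le_max (max r 0) a (max s 0) a).trans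
        (max_le ((abs_max_sub_max_le_max r 0 s 0).trans (by simp)) (by simp))
    rwa [abs_of_nonneg (sub_nonneg.2 hyx), abs_of_nonneg (sub_nonneg.2 h)] at h3
  have h4 : x ^ (p - 1 - 1) ≤ a ^ (p - 2) := by
    rw [show p - 1 - 1 = p - 2 by ring]
    exact Real.rpow_le_rpow (hy0.trans hyx) hxa (by linarith)
  have h5 : (p - 1) * x ^ (p - 1 - 1) * (x - y) ≤ (p - 1) * a ^ (p - 2) * (r - s) := by
    have := sub_nonneg.2 hyx
    gcongr
    · have : 0 ≤ a ^ (p - 2) := by positivity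
      nlinarith
    · linarith
  calc truncSlope p a r - truncSlope p a s = p * (x ^ (p - 1) - y ^ (p - 1)) := by
        simp only [truncSlope, hx, hy]; ring
    _ ≤ p * ((p - 1) * a ^ (p - 2) * (r - s)) :=
        mul_le_mul_of_nonneg_left (h1.trans h5) (by linarith)
    _ = _ := by ring

theorem continuous_truncSlope (hp : 2 ≤ p) : Continuous (truncSlope p a) := by
  unfold truncSlope
  exact continuous_const.mul (Continuous.rpow_const (by fun_prop) fun _ => Or.inr (by linarith))

theorem truncPow_sub (hp : 2 ≤ p) (r s : ℝ) :
    truncPow p a r - truncPow p a s = ∫ t in s..r, truncSlope p a t :=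
  intervalIntegral.integral_interval_sub_left
    ((continuous_truncSlope hp).intervalIntegrable _ _)
    ((continuous_truncSlope hp).intervalIntegrable _ _)

theorem truncPow_mono (hp : 2 ≤ p) (ha : 0 ≤ a) : Monotone (truncPow p a) := by
  intro r s h
  rw [← sub_nonneg, truncPow_sub hp]
  exact intervalIntegral.integral_nonneg h fun _ _ => truncSlope_nonneg hp ha _

theorem truncPow_zero : truncPow p a 0 = 0 := by simp [truncPow]

theorem truncPow_nonneg (hp : 2 ≤ p) (ha : 0 ≤ a) {r : ℝ} (hr : 0 ≤ r) : 0 ≤ truncPow p a r := by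
  simpa [truncPow_zero] using truncPow_mono hp ha hr

theorem integral_slope (hp : 2 ≤ p) (r : ℝ) :
    ∫ s in (0 : ℝ)..r, p * s ^ (p - 1) = r ^ p := by
  rw [intervalIntegral.integral_const_mul, integral_rpow (Or.inl (by linarith)),
    sub_add_cancel, Real.zero_rpow (by linarith)]
  field_simp
  ring

theorem truncPow_of_le (hp : 2 ≤ p) {r : ℝ} (hr : 0 ≤ r) (hra : r ≤ a) :
    truncPow p a r = r ^ p := by
  rw [← integral_slope hp r, truncPow]
  refine intervalIntegral.integral_congr fun s hs => ?_
  rw [uIcc_of_le hr] at hs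
  exact truncSlope_of_le hs.1 (hs.2.trans hra)

theorem truncPow_le (hp : 2 ≤ p) (ha : 0 ≤ a) {r : ℝ} (hr : 0 ≤ r) : truncPow p a r ≤ r ^ p := by
  rw [← integral_slope hp r, truncPow]
  refine intervalIntegral.integral_mono_on hr ((continuous_truncSlope hp).intervalIntegrable _ _)
    (Continuous.intervalIntegrable ?_ _ _) fun s hs => truncSlope_le hp ha hs.1
  exact continuous_const.mul (Continuous.rpow_const (by fun_prop) fun _ => Or.inr (by linarith))

/-- The slope depends on `r` only through `min r a`, so Young's inequality produces the `p`-th power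
of this minimum, which has to be absorbed in the potential. -/
theorem min_rpow_le_truncPow (hp : 2 ≤ p) (ha : 0 ≤ a) {r : ℝ} (hr : 0 ≤ r) :
    (min r a) ^ p ≤ truncPow p a r := by
  rw [← truncPow_of_le hp (le_min hr ha) (min_le_right r a)]
  exact truncPow_mono hp ha (min_le_left _ _)

/-- Superlinearity of the truncated power, uniform in the truncation. -/
theorem rpow_mul_le_truncPow (hp : 2 ≤ p) {l r : ℝ} (hl : 0 ≤ l) (hla : l ≤ a) (hr : 0 ≤ r) :
    l ^ (p - 1) * r ≤ l ^ (p - 1) * l + truncPow p a r := by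
  have ha := hl.trans hla
  rcases le_total r l with h | h
  · have := truncPow_nonneg hp ha hr
    have : l ^ (p - 1) * r ≤ l ^ (p - 1) * l := by gcongr
    linarith
  · have h1 := truncPow_sub (a := a) hp r l
    -- On `[l, r]` the slope is at least its value `p l ^ (p - 1)` at `l`. The factor `p` is given
    -- away at the end.
    have h2 : ∫ t in l..r, (truncSlope p a l) ≤ ∫ t in l..r, truncSlope p a t :=
      intervalIntegral.integral_mono_on h (by simp)
        ((continuous_truncSlope hp).intervalIntegrable _ _)
        fun s hs => truncSlope_mono hp ha hs.1
    rw [intervalIntegral.integral_const, truncSlope_of_le hl hla, smul_eq_mul] at h2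
    have h3 := truncPow_nonneg hp ha hl
    have h4 : 0 ≤ l ^ (p - 1) * (r - l) := mul_nonneg (by positivity) (by linarith)
    nlinarith

/-- Young's inequality for the truncated power and its slope. -/
theorem exists_truncSlope_mul_le (hp : 2 ≤ p) {ε : ℝ} (hε : 0 < ε) :
    ∃ C, 0 ≤ C ∧ ∀ a r b : ℝ, 0 ≤ a → 0 ≤ r → 0 ≤ b →
      truncSlope p a r * b ≤ ε * truncPow p a r + C * b ^ p := by
  have hp1 : 1 < p := by linarith
  have hpq := (Real.HolderConjugate.conjExponent hp1).symm
  set q := p.conjExponent with hq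
  have hq1 : 1 < q := hpq.lt
  have hq0 : 0 < q := by linarith
  have hqe : (p - 1) * q = p := by
    have := hpq.sub_one_mul_conj
    have h2 := hpq.symm.sub_one_mul_conj
    linarith
  -- Chosen so that the first term of Young's inequality, `(c m ^ (p - 1)) ^ q / q`, equals `(ε / p)
  -- m ^ p`.
  set c : ℝ := (ε * q / p) ^ (q⁻¹) with hc
  have hc0 : 0 < c := by positivity
  have hcq : c ^ q = ε * q / p := by
    rw [hc, ← Real.rpow_mul (by positivity), inv_mul_cancel₀ hq0.ne', Real.rpow_one]
  have hpp : 0 < p := by linarith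
  -- `p m^(p-1) b = (c p^{1/q} m^(p-1)) (b p^{1/p} / c)`, up to constants
  refine ⟨(p / c) ^ p, by positivity, fun a r b ha hr hb => ?_⟩
  set m := min r a with hm
  have hm0 : 0 ≤ m := le_min hr ha
  have hy := Real.young_inequality_of_nonneg (a := c * m ^ (p - 1)) (b := p / c * b)
    (by positivity) (by positivity) hpq
  rw [Real.mul_rpow hc0.le (by positivity), hcq, ← Real.rpow_mul hm0, hqe,
    Real.mul_rpow (by positivity) hb] at hy
  have h1 : c * m ^ (p - 1) * (p / c * b) = truncSlope p a r * b := by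
    rw [truncSlope, max_eq_left hr, ← hm]
    field_simp
  have h2 : ε * q / p * m ^ p / q ≤ ε * truncPow p a r := by
    have h3 := min_rpow_le_truncPow hp ha hr
    have h4 : ε * q / p * m ^ p / q = ε * m ^ p / p := by field_simp
    rw [h4, div_le_iff₀ hpp]
    have h5 : 0 ≤ truncPow p a r := truncPow_nonneg hp ha hr
    have h6 : ε * m ^ p ≤ ε * truncPow p a r := by gcongr
    nlinarith [mul_nonneg hε.le h5]
  have h3 : (p / c) ^ p * b ^ p / p ≤ (p / c) ^ p * b ^ p :=
    div_le_self (by positivity) (by linarith)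
  linarith

/-! ### Radial vector fields -/

section Radial

variable {E : Type*} [NormedAddCommGroup E] [InnerProductSpace ℝ E]

/-- The radial vector field with profile `ψ`. -/
noncomputable def radial (ψ : ℝ → ℝ) (U : E) : E := (ψ ‖U‖ / ‖U‖) • U

variable {ψ : ℝ → ℝ}

theorem norm_radial (h0 : ψ 0 = 0) (U : E) : ‖radial ψ U‖ = |ψ ‖U‖| := by
  rcases eq_or_ne U 0 with rfl | hU
  · simp [radial, h0]
  · have : ‖U‖ ≠ 0 := norm_ne_zero_iff.2 hU
    rw [radial, norm_smul, norm_div, norm_norm, div_mul_cancel₀ _ this, Real.norm_eq_abs]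

theorem radial_zero : radial ψ (0 : E) = 0 := by simp [radial]

/-- With `c(U) = ψ ‖U‖ / ‖U‖`, write the difference as `c(U) (U - V) + (c(U) - c(V)) V`. The first
term costs `K`; in the second the factor `‖V‖` cancels a denominator, and `2 K` remains. -/
theorem norm_radial_sub_le {K : ℝ} (hK : 0 ≤ K) (h0 : ψ 0 = 0)
    (hψ : ∀ r s, |ψ r - ψ s| ≤ K * |r - s|) (U V : E) :
    ‖radial ψ U - radial ψ V‖ ≤ 3 * K * ‖U - V‖ := by
  have hb : ∀ r, |ψ r| ≤ K * |r| := fun r => by simpa [h0] using hψ r 0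
  have hnn := norm_nonneg (U - V)
  rcases eq_or_ne U 0 with rfl | hU
  · rw [radial_zero, zero_sub, norm_neg, norm_radial h0, zero_sub, norm_neg]
    have := hb ‖V‖
    rw [abs_norm] at this
    nlinarith [norm_nonneg V, mul_nonneg hK (norm_nonneg V)]
  rcases eq_or_ne V 0 with rfl | hV
  · rw [radial_zero, sub_zero, norm_radial h0, sub_zero]
    have := hb ‖U‖
    rw [abs_norm] at this
    nlinarith [norm_nonneg U, mul_nonneg hK (norm_nonneg U)]
  have hu : 0 < ‖U‖ := norm_pos_iff.2 hU
  have hv : 0 < ‖V‖ := norm_pos_iff.2 hV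
  have e : radial ψ U - radial ψ V
      = (ψ ‖U‖ / ‖U‖) • (U - V) + (ψ ‖U‖ / ‖U‖ - ψ ‖V‖ / ‖V‖) • V := by
    simp only [radial]; module
  have hc : |ψ ‖U‖ / ‖U‖| ≤ K := by
    rw [abs_div, abs_norm, div_le_iff₀ hu]
    simpa using hb ‖U‖
  have habs : |‖U‖ - ‖V‖| ≤ ‖U - V‖ := abs_norm_sub_norm_le U V
  have h2 : |ψ ‖U‖ / ‖U‖ - ψ ‖V‖ / ‖V‖| * ‖V‖ ≤ 2 * K * ‖U - V‖ := by
    have e2 : (ψ ‖U‖ / ‖U‖ - ψ ‖V‖ / ‖V‖) * ‖V‖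
        = (ψ ‖U‖ / ‖U‖) * (‖V‖ - ‖U‖) + (ψ ‖U‖ - ψ ‖V‖) := by
      field_simp; ring
    have e3 : |ψ ‖U‖ / ‖U‖ - ψ ‖V‖ / ‖V‖| * ‖V‖ = |(ψ ‖U‖ / ‖U‖ - ψ ‖V‖ / ‖V‖) * ‖V‖| := by
      rw [abs_mul, abs_norm]
    rw [e3, e2]
    refine (abs_add_le _ _).trans ?_
    rw [abs_mul, abs_sub_comm ‖V‖]
    have h3 := hψ ‖U‖ ‖V‖
    have h4 : |ψ ‖U‖ / ‖U‖| * |‖U‖ - ‖V‖| ≤ K * ‖U - V‖ := by gcongr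
    have h5 : K * |‖U‖ - ‖V‖| ≤ K * ‖U - V‖ := by gcongr
    linarith
  rw [e]
  refine (norm_add_le _ _).trans ?_
  rw [norm_smul, norm_smul, Real.norm_eq_abs, Real.norm_eq_abs]
  have h6 : |ψ ‖U‖ / ‖U‖| * ‖U - V‖ ≤ K * ‖U - V‖ := by gcongr
  linarith

/-- A radial vector field is the gradient of the radial function whose derivative is its
profile. -/
theorem hasGradientAt_radial [CompleteSpace E] {K : ℝ} (hK : 0 ≤ K) (h0 : ψ 0 = 0)
    (hψ : ∀ r s, |ψ r - ψ s| ≤ K * |r - s|) (U : E) :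
    HasGradientAt (fun U : E => ∫ s in (0 : ℝ)..‖U‖, ψ s) (radial ψ U) U := by
  have hcont : Continuous ψ := by
    have : LipschitzWith ⟨K, hK⟩ ψ := LipschitzWith.of_dist_le_mul fun r s => by
      exact hψ r s
    exact this.continuous
  have hb : ∀ r, |ψ r| ≤ K * |r| := fun r => by simpa [h0] using hψ r 0
  rcases eq_or_ne U 0 with rfl | hU
  · rw [radial_zero, hasGradientAt_iff_hasFDerivAt, map_zero,
      hasFDerivAt_iff_isLittleO_nhds_zero]
    simp only [zero_add, norm_zero, intervalIntegral.integral_same, sub_zero,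
      zero_apply]
    -- The norm is not differentiable at the origin, but the profile vanishes there, so the function
    -- is `O(‖h‖ ^ 2)` and has derivative zero.
    have hO : (fun h : E => ∫ s in (0 : ℝ)..‖h‖, ψ s) =O[𝓝 0] fun h => ‖h‖ ^ 2 := by
      refine Asymptotics.IsBigO.of_bound K (Eventually.of_forall fun h => ?_)
      have := intervalIntegral.norm_integral_le_of_norm_le_const (a := 0) (b := ‖h‖) (f := ψ)
        (C := K * ‖h‖) fun s hs => by
          rw [uIoc_of_le (norm_nonneg h)] at hs
          refine (hb s).trans ?_
          rw [abs_of_pos hs.1]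
          gcongr
          exact hs.2
      refine this.trans (le_of_eq ?_)
      rw [sub_zero, abs_norm, norm_pow, norm_norm]; ring
    refine hO.trans_isLittleO ?_
    refine (Asymptotics.isLittleO_norm_right).1 ?_
    have : (fun h : E => ‖h‖ ^ 2) = fun h => ‖h‖ * ‖h‖ := by ext; ring
    rw [this]
    have h1 : (fun h : E => ‖h‖) =o[𝓝 0] fun _ => (1 : ℝ) := by
      rw [Asymptotics.isLittleO_one_iff]
      simpa using (continuous_norm (E := E)).tendsto 0
    simpa using h1.mul_isBigO (Asymptotics.isBigO_refl (fun h : E => ‖h‖) (𝓝 0))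
  · have hu : 0 < ‖U‖ := norm_pos_iff.2 hU
    have h1 : HasFDerivAt (fun V : E => ‖V‖ ^ 2) (2 • innerSL ℝ U) U :=
      (hasStrictFDerivAt_norm_sq U).hasFDerivAt
    have h2 : HasFDerivAt (fun V : E => ‖V‖) ((1 / (2 * ‖U‖)) • ((2 : ℕ) • innerSL ℝ U)) U := by
      have h3 := (Real.hasDerivAt_sqrt (x := ‖U‖ ^ 2) (by positivity)).comp_hasFDerivAt U h1
      rw [Real.sqrt_sq hu.le] at h3
      refine h3.congr_of_eventuallyEq (Eventually.of_forall fun V => ?_)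
      simp [Real.sqrt_sq (norm_nonneg V)]
    have h3 : HasDerivAt (fun r : ℝ => ∫ s in (0 : ℝ)..r, ψ s) (ψ ‖U‖) ‖U‖ :=
      intervalIntegral.integral_hasDerivAt_right (hcont.intervalIntegrable _ _)
        (hcont.stronglyMeasurableAtFilter _ _) hcont.continuousAt
    have h4 := h3.comp_hasFDerivAt U h2
    rw [hasGradientAt_iff_hasFDerivAt]
    refine h4.congr_fderiv ?_
    ext V
    simp only [radial, map_smul, _root_.smul_apply, InnerProductSpace.toDual_apply_apply,
      innerSL_apply_apply, smul_eq_mul, nsmul_eq_mul, Nat.cast_ofNat]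
    field_simp

end Radial

/-! ### Consequences of the constitutive assumptions -/

/-- Used with `s = p - 2`, for the leading part of the force. At the origin the factor `‖U‖ ^ s`
tends to zero if `s > 0`; for `s = 0` the map is the identity. -/
theorem differentiable_norm_rpow_smul {E : Type*} [NormedAddCommGroup E] [InnerProductSpace ℝ E]
    {s : ℝ} (hs : 0 ≤ s) : Differentiable ℝ fun U : E => ‖U‖ ^ s • U := by
  intro U
  rcases hs.eq_or_lt with rfl | hs
  · simp
  rcases eq_or_ne U 0 with rfl | hU
  · refine HasFDerivAt.differentiableAt (f' := 0) ?_
    rw [hasFDerivAt_iff_isLittleO_nhds_zero]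
    simp only [zero_add, smul_zero, sub_zero, _root_.zero_apply]
    have h1 : (fun h : E => ‖h‖ ^ s) =o[𝓝 0] fun _ => (1 : ℝ) := by
      rw [Asymptotics.isLittleO_one_iff]
      have : Continuous fun h : E => ‖h‖ ^ s :=
        continuous_norm.rpow_const fun _ => Or.inr hs.le
      simpa [Real.zero_rpow hs.ne'] using this.tendsto 0
    simpa using h1.smul_isBigO (Asymptotics.isBigO_refl (fun h : E => h) (𝓝 0))
  · exact ((differentiableAt_id.norm ℝ hU).rpow_const (Or.inl (norm_ne_zero_iff.2 hU))).smul
      differentiableAt_id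

section Force

variable {N : ℕ} {κ p α : ℝ} {f : Vec N → Vec N → Vec N} {Φ Ψ : Vec N → Vec N → ℝ}

/-- The weight `|y| ^ -(N + α p)`. -/
noncomputable def kernel (N : ℕ) (p α : ℝ) (y : Vec N) : ℝ := (‖y‖ ^ ((N : ℝ) + α * p))⁻¹

theorem kernel_nonneg (y : Vec N) : 0 ≤ kernel N p α y := by unfold kernel; positivity

theorem continuousOn_kernel : ContinuousOn (kernel N p α) {0}ᶜ := by
  unfold kernel
  refine ContinuousOn.inv₀ ?_ fun y hy => ?_
  · exact continuous_norm.continuousOn.rpow_const fun y hy => Or.inl (norm_ne_zero_iff.2 hy)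
  · have := norm_pos_iff.2 (show y ≠ 0 from hy)
    positivity

/-- The lower order part of the force. -/
noncomputable def lowerForce (κ p α : ℝ) (f : Vec N → Vec N → Vec N) (y U : Vec N) : Vec N :=
  f y U - (κ * kernel N p α y * (p * ‖U‖ ^ (p - 2))) • U

theorem isOpen_forceDomain : IsOpen (forceDomain N) :=
  isOpen_compl_singleton.prod isOpen_univ

variable (hf : IsHyperelastic κ p α f Φ Ψ)
include hf

namespace IsHyperelastic

/-- Removing the gradient of the explicit power from `f` leaves the gradient of `Ψ`. In this way the
hypotheses on the derivatives of `Ψ` become bounds on a part of the force. -/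
theorem hasGradientAt_Ψ {y : Vec N} (hy : y ≠ 0) (U : Vec N) :
    HasGradientAt (Ψ y) (lowerForce κ p α f y U) U := by
  have h1 := (hf.f_eq_gradient y U hy).hasFDerivAt
  have h2 := (hasFDerivAt_norm_rpow U (lt_of_lt_of_le one_lt_two hf.two_le_p)).const_mul
    (κ * kernel N p α y)
  have h3 := h1.sub h2
  rw [hasGradientAt_iff_hasFDerivAt]
  refine (h3.congr_fderiv ?_).congr_of_eventuallyEq (Eventually.of_forall fun V => ?_)
  · ext V
    simp [lowerForce]
    ring
  · simp [hf.Φ_eq y V hy, kernel]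
    ring

theorem differentiable_f {y : Vec N} (hy : y ≠ 0) : Differentiable ℝ (f y) := by
  intro U
  have h : DifferentiableAt ℝ (fun z : Vec N × Vec N => f z.1 z.2) (y, U) :=
    (hf.f_contDiff.differentiableOn one_ne_zero).differentiableAt
      (isOpen_forceDomain.mem_nhds ⟨hy, trivial⟩)
  exact h.comp U (f := fun U => (y, U)) (by fun_prop)

theorem lipschitzWith_lowerForce {g : Vec N → ℝ} {y : Vec N} (hy : y ≠ 0) (hg0 : 0 ≤ g y)
    (hg : ∀ U, ‖fderiv ℝ (gradient (Ψ y)) U‖ ≤ g y) :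
    LipschitzWith (NNReal.mk (g y) hg0) (lowerForce κ p α f y) := by
  have he : gradient (Ψ y) = lowerForce κ p α f y :=
    gradient_eq fun U => hf.hasGradientAt_Ψ hy U
  rw [he] at hg
  refine lipschitzWith_of_nnnorm_fderiv_le ?_ fun U => hg U
  -- A bound on `fderiv` says nothing at points where the derivative does not exist.
  -- Differentiability comes from `f ∈ C¹` and from the explicit power.
  have h1 := differentiable_norm_rpow_smul (E := Vec N) (s := p - 2) (by linarith [hf.two_le_p])
  have h2 := (hf.differentiable_f hy).sub (h1.const_smul (κ * kernel N p α y * p))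
  convert h2 using 1
  ext1 U
  simp only [lowerForce, Pi.sub_apply, Pi.smul_apply, smul_smul, mul_assoc]

/-- The origin is a minimum of `Ψ y`, as `Ψ y 0 = 0 ≤ Ψ y U`. -/
theorem lowerForce_zero {y : Vec N} (hy : y ≠ 0) : lowerForce κ p α f y 0 = 0 := by
  have h : IsLocalMin (Ψ y) 0 := Eventually.of_forall fun U => by
    rw [hf.Ψ_zero y hy]; exact hf.Ψ_nonneg y U hy
  have h1 := h.hasFDerivAt_eq_zero (hf.hasGradientAt_Ψ hy 0).hasFDerivAt
  simpa using h1

theorem κ_mul_le_Φ {y : Vec N} (hy : y ≠ 0) (U : Vec N) :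
    κ * (‖U‖ ^ p / ‖y‖ ^ ((N : ℝ) + α * p)) ≤ Φ y U := by
  rw [hf.Φ_eq y U hy]
  linarith [hf.Ψ_nonneg y U hy]

theorem Φ_nonneg {y : Vec N} (hy : y ≠ 0) (U : Vec N) : 0 ≤ Φ y U := by
  refine le_trans ?_ (hf.κ_mul_le_Φ hy U)
  have := hf.κ_pos
  positivity

theorem continuousOn_lowerForce :
    ContinuousOn (fun z : Vec N × Vec N => lowerForce κ p α f z.1 z.2) (forceDomain N) := by
  unfold lowerForce
  refine hf.f_contDiff.continuousOn.sub (ContinuousOn.fun_smul (ContinuousOn.fun_mul ?_ ?_) ?_)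
  · refine continuousOn_const.mul (continuousOn_kernel.comp continuousOn_fst fun z hz => hz.1)
  · refine Continuous.continuousOn (continuous_const.mul (Continuous.rpow_const (by fun_prop) ?_))
    exact fun _ => Or.inr (by linarith [hf.two_le_p])
  · fun_prop

theorem continuousOn_Ψ :
    ContinuousOn (fun z : Vec N × Vec N => Ψ z.1 z.2) (forceDomain N) := by
  have h : ContinuousOn (fun z : Vec N × Vec N => Φ z.1 z.2 - κ * (‖z.2‖ ^ p * kernel N p α z.1))
      (forceDomain N) := by
    refine hf.Φ_contDiff.continuousOn.sub (continuousOn_const.mul (ContinuousOn.mul ?_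
      (continuousOn_kernel.comp continuousOn_fst fun z hz => hz.1)))
    exact (Continuous.rpow_const (by fun_prop)
      fun _ => Or.inr (by linarith [hf.two_le_p])).continuousOn
  refine h.congr fun z hz => ?_
  simp only [hf.Φ_eq z.1 z.2 hz.1, kernel]
  ring

end IsHyperelastic

omit hf

/-- The force, with the singularity cut off outside `S` and the power made linear beyond `a`. -/
noncomputable def cutForce (κ p α : ℝ) (f : Vec N → Vec N → Vec N) (a : ℝ) (S : Set (Vec N))
    (y U : Vec N) : Vec N :=
  S.indicator (fun y => (κ * kernel N p α y) • radial (truncSlope p a) U + lowerForce κ p α f y U) y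

/-- The potential of `cutForce`. -/
noncomputable def cutPotential (κ p α : ℝ) (Ψ : Vec N → Vec N → ℝ) (a : ℝ) (S : Set (Vec N))
    (y U : Vec N) : ℝ :=
  S.indicator (fun y => κ * kernel N p α y * truncPow p a ‖U‖ + Ψ y U) y

end Force

/-- The force `f` with potential `Φ` is approximated by the forces `F n`, which have the potentials
`φ n` and are Lipschitz in the displacement, uniformly in the bond. The bonds in `S n` are those
that the approximation resolves. -/
structure IsRegularization {N : ℕ} (δ κ p α : ℝ) (f : Vec N → Vec N → Vec N)
    (Φ : Vec N → Vec N → ℝ) (g : Vec N → ℝ) (S : ℕ → Set (Vec N))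
    (F : ℕ → Vec N → Vec N → Vec N) (φ : ℕ → Vec N → Vec N → ℝ) : Prop where
  grad : ∀ n y U, HasGradientAt (φ n y) (F n y U) U
  lip : ∀ n, ∃ L : ℝ≥0, ∀ y, LipschitzWith L (F n y)
  F_zero : ∀ n y, F n y 0 = 0
  φ_zero : ∀ n y, φ n y 0 = 0
  φ_nonneg : ∀ n y U, 0 ≤ φ n y U
  φ_le : ∀ n y U, y ≠ 0 → φ n y U ≤ Φ y U
  F_meas : ∀ n, Measurable fun z : Vec N × Vec N => F n z.1 z.2
  φ_meas : ∀ n, Measurable fun z : Vec N × Vec N => φ n z.1 z.2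
  -- The constant `C` does not depend on `n`. Thus the forces, tested with a fixed Lipschitz
  -- function of bounded support, are uniformly integrable along sequences of bounded energy.
  young : ∀ ε, 0 < ε → ∃ C, 0 ≤ C ∧ ∀ n y U b, y ≠ 0 →
    |⟪F n y U, b⟫_ℝ| ≤ ε * φ n y U + (C * (‖b‖ ^ p * kernel N p α y) + g y * ‖b‖)
  -- For almost every bond the approximation is eventually exact on bounded sets of displacements,
  -- so limits can be taken at moving arguments.
  eventually_eq : ∀ᵐ y ∂(volume.restrict (ball (0 : Vec N) δ)), ∀ R, ∀ᶠ n in atTop, ∀ U,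
    ‖U‖ ≤ R → F n y U = f y U ∧ φ n y U = Φ y U
  S_meas : ∀ n, MeasurableSet (S n)
  S_mono : Monotone S
  S_ae : ∀ᵐ y ∂(volume.restrict (ball (0 : Vec N) δ)), ∃ n, y ∈ S n
  -- Growth of arbitrarily large slope `l ^ (p - 1)`, uniform in `n ≥ l`. The linearly continued
  -- potentials allow no uniform bound of a `p`-th power.
  coercive : ∀ (l : ℝ) (n : ℕ) (y U : Vec N), 0 ≤ l → l ≤ n → y ∈ S n →
    κ * (l ^ (p - 1) * ‖U‖) ≤ κ * (l ^ (p - 1) * l) + ‖y‖ ^ ((N : ℝ) + α * p) * φ n y U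

/-! ### Construction of the regularization. -/

section

variable {N : ℕ} {κ p α : ℝ} {f : Vec N → Vec N → Vec N} {Φ Ψ : Vec N → Vec N → ℝ}

/-- Bonds of length at least `1 / (n + 1)` on which a given function is at most `n` exhaust the
ball, up to a null set. -/
theorem exists_good_bonds (hN : 1 ≤ N) (δ : ℝ) {g : Vec N → ℝ}
    (hg : AEMeasurable g (volume.restrict (ball 0 δ))) :
    ∃ S : ℕ → Set (Vec N), (∀ n, MeasurableSet (S n)) ∧ Monotone S ∧
      (∀ᵐ y ∂(volume.restrict (ball (0 : Vec N) δ)), ∃ n, y ∈ S n) ∧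
      ∀ n, ∀ y ∈ S n, 1 / ((n : ℝ) + 1) ≤ ‖y‖ ∧ g y ≤ n := by
  have : Nonempty (Fin N) := ⟨⟨0, hN⟩⟩
  -- As `g` is only almost everywhere measurable, it is replaced by a measurable version, and a
  -- measurable null set `Z` containing the points of disagreement is discarded.
  set Z := toMeasurable (volume.restrict (ball (0 : Vec N) δ)) {y | g y ≠ hg.mk g y} with hZ
  have hZ0 : volume.restrict (ball (0 : Vec N) δ) Z = 0 := by
    rw [hZ, measure_toMeasurable]; exact hg.ae_eq_mk
  refine ⟨fun n => (Zᶜ ∩ {y | hg.mk g y ≤ n}) ∩ {y | 1 / ((n : ℝ) + 1) ≤ ‖y‖}, fun n => ?_, ?_,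
    ?_, ?_⟩
  · exact (((measurableSet_toMeasurable _ _).compl).inter
      (measurableSet_le hg.measurable_mk measurable_const)).inter
      (measurableSet_le measurable_const measurable_norm)
  · rintro m n hmn y ⟨⟨h1, h2⟩, h3⟩
    have hmn' : (m : ℝ) ≤ n := by exact_mod_cast hmn
    refine ⟨⟨h1, le_trans h2 hmn'⟩, le_trans (b := 1 / ((m : ℝ) + 1)) ?_ h3⟩
    exact one_div_le_one_div_of_le (by positivity) (by linarith)
  · have h1 : ∀ᵐ y ∂(volume.restrict (ball (0 : Vec N) δ)), y ∉ Z := by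
      rw [ae_iff]; simpa using hZ0
    have h2 : ∀ᵐ y ∂(volume.restrict (ball (0 : Vec N) δ)), y ≠ 0 :=
      ae_restrict_of_ae (by simp [ae_iff])
    filter_upwards [h1, h2] with y hy1 hy2
    obtain ⟨a, ha⟩ := exists_nat_ge (hg.mk g y)
    obtain ⟨b, hb⟩ := exists_nat_one_div_lt (norm_pos_iff.2 hy2)
    refine ⟨max a b, ⟨hy1, ha.trans (by exact_mod_cast le_max_left a b)⟩, le_trans ?_ hb.le⟩
    refine one_div_le_one_div_of_le (by positivity) ?_
    have : (b : ℝ) ≤ (max a b : ℕ) := by exact_mod_cast le_max_right a b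
    linarith
  · rintro n y ⟨⟨h1, h2⟩, h3⟩
    refine ⟨h3, le_trans (le_of_eq ?_) h2⟩
    by_contra h
    exact h1 (subset_toMeasurable _ _ h)

theorem radial_truncSlope (hp : 2 ≤ p) {a : ℝ} {U : Vec N} (hU : ‖U‖ ≤ a) :
    radial (truncSlope p a) U = (p * ‖U‖ ^ (p - 2)) • U := by
  rcases eq_or_ne U 0 with rfl | h
  · simp [radial_zero]
  have hu := norm_pos_iff.2 h
  rw [radial, truncSlope_of_le hu.le hU, show p - 1 = p - 2 + 1 by ring,
    Real.rpow_add_one hu.ne']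
  congr 1
  field_simp

theorem continuous_radial_truncSlope (hp : 2 ≤ p) {a : ℝ} (ha : 0 ≤ a) :
    Continuous (radial (truncSlope p a) : Vec N → Vec N) := by
  have h : 0 ≤ p * ((p - 1) * a ^ (p - 2)) := by
    have : 0 ≤ p - 1 := by linarith
    positivity
  have : LipschitzWith (NNReal.mk (3 * (p * ((p - 1) * a ^ (p - 2)))) (by linarith))
      (radial (truncSlope p a) : Vec N → Vec N) :=
    LipschitzWith.of_dist_le_mul fun U V => by
      rw [dist_eq_norm, dist_eq_norm]
      exact norm_radial_sub_le h (truncSlope_zero hp ha) (truncSlope_lipschitz hp ha) U V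
  exact this.continuous

theorem IsHyperelastic.measurable_cutForce (hf : IsHyperelastic κ p α f Φ Ψ) {a : ℝ} (ha : 0 ≤ a)
    {S : Set (Vec N)} (hS : MeasurableSet S) (hS0 : ∀ y ∈ S, y ≠ 0) :
    Measurable fun z : Vec N × Vec N => cutForce κ p α f a S z.1 z.2 := by
  classical
  have hsub : S ×ˢ univ ⊆ forceDomain N := fun z hz => ⟨hS0 _ hz.1, trivial⟩
  have hc : ContinuousOn (fun z : Vec N × Vec N => (κ * kernel N p α z.1) •
      radial (truncSlope p a) z.2 + lowerForce κ p α f z.1 z.2) (S ×ˢ univ) := by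
    refine (ContinuousOn.fun_smul ?_ ?_).add (hf.continuousOn_lowerForce.mono hsub)
    · exact continuousOn_const.mul (continuousOn_kernel.comp continuousOn_fst
        fun z hz => (hsub hz).1)
    · exact ((continuous_radial_truncSlope hf.two_le_p ha).comp continuous_snd).continuousOn
  have h := hc.measurable_piecewise (g := fun _ => 0) continuousOn_const
    (hS.prod MeasurableSet.univ)
  refine (congrArg Measurable (funext fun z => ?_)).mp h
  by_cases hz : z.1 ∈ S <;> simp [cutForce, hz, piecewise]

theorem IsHyperelastic.measurable_cutPotential (hf : IsHyperelastic κ p α f Φ Ψ) {a : ℝ}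
    {S : Set (Vec N)} (hS : MeasurableSet S) (hS0 : ∀ y ∈ S, y ≠ 0) :
    Measurable fun z : Vec N × Vec N => cutPotential κ p α Ψ a S z.1 z.2 := by
  classical
  have hsub : S ×ˢ univ ⊆ forceDomain N := fun z hz => ⟨hS0 _ hz.1, trivial⟩
  have hc : ContinuousOn (fun z : Vec N × Vec N => κ * kernel N p α z.1 *
      truncPow p a ‖z.2‖ + Ψ z.1 z.2) (S ×ˢ univ) := by
    refine (ContinuousOn.fun_mul ?_ ?_).add (hf.continuousOn_Ψ.mono hsub)
    · exact continuousOn_const.mul (continuousOn_kernel.comp continuousOn_fst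
        fun z hz => (hsub hz).1)
    · have : Continuous (truncPow p a) :=
        intervalIntegral.continuous_primitive
          (fun a b => (continuous_truncSlope hf.two_le_p).intervalIntegrable a b) 0
      exact (this.comp (by fun_prop)).continuousOn
  have h := hc.measurable_piecewise (g := fun _ => 0) continuousOn_const
    (hS.prod MeasurableSet.univ)
  refine (congrArg Measurable (funext fun z => ?_)).mp h
  by_cases hz : z.1 ∈ S <;> simp [cutPotential, hz, piecewise]

-- On `S n` the kernel is at most `(n + 1) ^ (N + α p)`, the truncated radial field has a Lipschitz
-- constant depending on `n` and `p` only, and the lower order force has constant `g y ≤ n`; so the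
-- Lipschitz bound is uniform in the bond. It blows up with `n`. The estimates that must survive the
-- limit are uniform: the potentials lie below `Φ`, and the truncated power satisfies Young's
-- inequality and the superlinear bound with constants independent of the truncation.
set_option maxHeartbeats 800000 in
theorem IsHyperelastic.isRegularization (hN : 1 ≤ N) (δ : ℝ) (hf : IsHyperelastic κ p α f Φ Ψ)
    {g : Vec N → ℝ} (hg0 : ∀ y, 0 ≤ g y) (hgm : AEMeasurable g (volume.restrict (ball 0 δ)))
    (hg : ∀ y u : Vec N, y ≠ 0 →
      ‖gradient (Ψ y) u‖ ≤ g y ∧ ‖fderiv ℝ (gradient (Ψ y)) u‖ ≤ g y) :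
    ∃ S : ℕ → Set (Vec N), IsRegularization δ κ p α f Φ g S
      (fun n => cutForce κ p α f n (S n)) (fun n => cutPotential κ p α Ψ n (S n)) := by
  obtain ⟨S, hSm, hSmono, hSae, hS⟩ := exists_good_bonds hN δ hgm
  have hp := hf.two_le_p
  have hκ := hf.κ_pos
  have hS0 : ∀ n, ∀ y ∈ S n, y ≠ 0 := by
    rintro n y hy rfl
    have h1 := (hS n 0 hy).1
    rw [norm_zero] at h1
    have : (0 : ℝ) < 1 / ((n : ℝ) + 1) := by positivity
    linarith
  have hK : ∀ n : ℕ, 0 ≤ p * ((p - 1) * (n : ℝ) ^ (p - 2)) := fun n => by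
    have : 0 ≤ p - 1 := by linarith
    positivity
  have hgrad : ∀ (n : ℕ) (y U : Vec N), HasGradientAt (cutPotential κ p α Ψ n (S n) y)
      (cutForce κ p α f n (S n) y U) U := by
    intro n y U
    by_cases hy : y ∈ S n
    · have h1 := (hasGradientAt_radial (hK n) (truncSlope_zero hp n.cast_nonneg)
        (truncSlope_lipschitz hp n.cast_nonneg) U).hasFDerivAt.const_mul (κ * kernel N p α y)
      have h2 := h1.add (hf.hasGradientAt_Ψ (hS0 n y hy) U).hasFDerivAt
      rw [hasGradientAt_iff_hasFDerivAt]
      refine (h2.congr_fderiv ?_).congr_of_eventuallyEq (Eventually.of_forall fun V => ?_)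
      · simp [cutForce, hy]
      · simp [cutPotential, hy, truncPow]
    · have h1 : cutPotential κ p α Ψ n (S n) y = fun _ => 0 := by
        ext V; simp [cutPotential, hy]
      rw [h1]
      simpa [cutForce, hy] using hasGradientAt_const U (0 : ℝ)
  have hlow : ∀ y U : Vec N, y ≠ 0 → ‖lowerForce κ p α f y U‖ ≤ g y := fun y U hy => by
    rw [← (hf.hasGradientAt_Ψ hy U).gradient]; exact (hg y U hy).1
  have hφle : ∀ (n : ℕ) (y U : Vec N), y ≠ 0 → cutPotential κ p α Ψ n (S n) y U ≤ Φ y U := by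
    intro n y U hy
    by_cases hyS : y ∈ S n
    · rw [hf.Φ_eq y U hy, cutPotential, indicator_of_mem hyS, mul_assoc]
      have h1 := truncPow_le hp n.cast_nonneg (a := n) (norm_nonneg U)
      have h2 := kernel_nonneg (p := p) (α := α) y
      have : kernel N p α y * truncPow p n ‖U‖ ≤ ‖U‖ ^ p / ‖y‖ ^ ((N : ℝ) + α * p) := by
        rw [div_eq_mul_inv, mul_comm]
        exact mul_le_mul_of_nonneg_right h1 h2
      gcongr
    · simpa [cutPotential, hyS] using hf.Φ_nonneg hy U
  refine ⟨S, hgrad, fun n => ?_, fun n y => ?_, fun n y => ?_, fun n y U => ?_, hφle, fun n => ?_,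
    fun n => ?_, fun ε hε => ?_, ?_, hSm, hSmono, hSae, fun l n y U hl hln hy => ?_⟩
  · set s := (N : ℝ) + α * p with hs
    have hs0 : 0 ≤ s := by
      have := hf.α_pos
      positivity
    set k : ℝ := ((n : ℝ) + 1) ^ s with hk
    have hL : 0 ≤ κ * k * (3 * (p * ((p - 1) * (n : ℝ) ^ (p - 2)))) + n := by
      have := hK n
      positivity
    refine ⟨NNReal.mk _ hL, fun y => LipschitzWith.of_dist_le_mul fun U V => ?_⟩
    rw [NNReal.coe_mk, dist_eq_norm, dist_eq_norm]
    by_cases hy : y ∈ S n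
    · have hy0 := hS0 n y hy
      have hyp := norm_pos_iff.2 hy0
      simp only [cutForce, indicator_of_mem hy]
      have h1 := norm_radial_sub_le (hK n) (truncSlope_zero hp n.cast_nonneg)
        (truncSlope_lipschitz hp n.cast_nonneg) U V
      have h2 := (hf.lipschitzWith_lowerForce hy0 (hg0 y) fun U => (hg y U hy0).2).dist_le_mul U V
      rw [dist_eq_norm, dist_eq_norm, NNReal.coe_mk] at h2
      have h3 : kernel N p α y ≤ k := by
        rw [kernel, ← hs, hk, ← Real.inv_rpow hyp.le]
        refine Real.rpow_le_rpow (by positivity) ?_ hs0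
        rw [inv_le_comm₀ hyp (by positivity)]
        simpa using (hS n y hy).1
      have h4 := kernel_nonneg (p := p) (α := α) y
      rw [add_sub_add_comm, ← smul_sub]
      refine (norm_add_le _ _).trans ?_
      rw [norm_smul, Real.norm_of_nonneg (by positivity), add_mul]
      refine add_le_add ?_ (h2.trans ?_)
      · calc κ * kernel N p α y * ‖radial (truncSlope p ↑n) U - radial (truncSlope p ↑n) V‖
            ≤ κ * k * (3 * (p * ((p - 1) * (n : ℝ) ^ (p - 2))) * ‖U - V‖) := by
              gcongr
          _ = _ := by ring
      · gcongr
        exact (hS n y hy).2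
    · simp only [cutForce, indicator_of_notMem hy, sub_self, norm_zero]
      positivity
  · by_cases hy : y ∈ S n
    · simp [cutForce, hy, radial_zero, hf.lowerForce_zero (hS0 n y hy)]
    · simp [cutForce, hy]
  · by_cases hy : y ∈ S n
    · simp [cutPotential, hy, truncPow_zero, hf.Ψ_zero y (hS0 n y hy)]
    · simp [cutPotential, hy]
  · by_cases hy : y ∈ S n
    · rw [cutPotential, indicator_of_mem hy]
      have h1 := truncPow_nonneg hp n.cast_nonneg (a := n) (norm_nonneg U)
      have h2 := kernel_nonneg (p := p) (α := α) y
      have h3 := hf.Ψ_nonneg y U (hS0 n y hy)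
      positivity
    · simp [cutPotential, hy]
  · exact hf.measurable_cutForce n.cast_nonneg (hSm n) (hS0 n)
  · exact hf.measurable_cutPotential (hSm n) (hS0 n)
  · obtain ⟨C, hC0, hC⟩ := exists_truncSlope_mul_le hp hε
    refine ⟨κ * C, by positivity, fun n y U b hy0 => ?_⟩
    have hk := kernel_nonneg (p := p) (α := α) y
    have hgy := hg0 y
    by_cases hy : y ∈ S n
    · simp only [cutForce, cutPotential, indicator_of_mem hy]
      rw [inner_add_left, inner_smul_left]
      have h1 : |⟪radial (truncSlope p ↑n) U, b⟫_ℝ| ≤ truncSlope p n ‖U‖ * ‖b‖ := by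
        refine (abs_real_inner_le_norm _ _).trans ?_
        rw [norm_radial (truncSlope_zero hp n.cast_nonneg),
          abs_of_nonneg (truncSlope_nonneg hp n.cast_nonneg _)]
      have h2 : |⟪lowerForce κ p α f y U, b⟫_ℝ| ≤ g y * ‖b‖ :=
        (abs_real_inner_le_norm _ _).trans
          (mul_le_mul_of_nonneg_right (hlow y U hy0) (norm_nonneg _))
      have h3 := hC n ‖U‖ ‖b‖ n.cast_nonneg (norm_nonneg _) (norm_nonneg _)
      have h4 := hf.Ψ_nonneg y U hy0
      refine (abs_add_le _ _).trans ?_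
      rw [abs_mul]
      simp only [conj_trivial]
      rw [abs_of_nonneg (by positivity : 0 ≤ κ * kernel N p α y)]
      have h5 : κ * kernel N p α y * |⟪radial (truncSlope p ↑n) U, b⟫_ℝ| ≤
          κ * kernel N p α y * (ε * truncPow p n ‖U‖ + C * ‖b‖ ^ p) :=
        mul_le_mul_of_nonneg_left (h1.trans h3) (by positivity)
      have h6 : 0 ≤ ε * Ψ y U := by positivity
      linarith
    · simp only [cutForce, cutPotential, indicator_of_notMem hy, inner_zero_left, abs_zero]
      positivity
  -- Nothing is cut off once the bond has entered `S n` and `n` exceeds `R`.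
  · filter_upwards [hSae] with y ⟨m, hm⟩ R
    obtain ⟨k, hk⟩ := exists_nat_ge R
    filter_upwards [eventually_ge_atTop m, eventually_ge_atTop k] with n hn1 hn2 U hU
    have hy := hSmono hn1 hm
    have hUn : ‖U‖ ≤ n := hU.trans (hk.trans (by exact_mod_cast hn2))
    constructor
    · rw [cutForce, indicator_of_mem hy, radial_truncSlope hp hUn, lowerForce, smul_smul]
      abel
    · rw [cutPotential, indicator_of_mem hy, truncPow_of_le hp (norm_nonneg U) hUn,
        hf.Φ_eq y U (hS0 n y hy), kernel]
      ring
  · have hy0 := hS0 n y hy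
    have hyp := norm_pos_iff.2 hy0
    have h1 := rpow_mul_le_truncPow hp hl hln (norm_nonneg U)
    have h2 := hf.Ψ_nonneg y U hy0
    have h3 : ‖y‖ ^ ((N : ℝ) + α * p) * cutPotential κ p α Ψ n (S n) y U
        = κ * truncPow p n ‖U‖ + ‖y‖ ^ ((N : ℝ) + α * p) * Ψ y U := by
      rw [cutPotential, indicator_of_mem hy, kernel]
      field_simp
    rw [h3]
    have h4 : 0 ≤ ‖y‖ ^ ((N : ℝ) + α * p) * Ψ y U := by positivity
    nlinarith [mul_le_mul_of_nonneg_left h1 hκ.le]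

end

/-! ### Global solutions of Lipschitz differential equations -/

section ODE

theorem continuous_exp_mul_abs (l : ℝ) : Continuous fun s : ℝ => Real.exp (l * |s|) := by fun_prop

/-- Integrating the weight gains the factor `1 / l`. This makes the Picard map a contraction on the
whole line when `l` is large. -/
theorem abs_integral_exp_mul_abs_le {l : ℝ} (hl : 0 < l) (t : ℝ) :
    |∫ s in (0 : ℝ)..t, Real.exp (l * |s|)| ≤ Real.exp (l * |t|) / l := by
  have key : ∀ t : ℝ, 0 ≤ t → |∫ s in (0 : ℝ)..t, Real.exp (l * |s|)| ≤ Real.exp (l * t) / l := by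
    intro t ht
    have h1 : ∫ s in (0 : ℝ)..t, Real.exp (l * |s|) = ∫ s in (0 : ℝ)..t, Real.exp (l * s) :=
      intervalIntegral.integral_congr fun s hs => by
        rw [uIcc_of_le ht] at hs
        simp only [abs_of_nonneg hs.1]
    have h2 : ∫ s in (0 : ℝ)..t, Real.exp (l * s) = Real.exp (l * t) / l - 1 / l := by
      rw [intervalIntegral.integral_eq_sub_of_hasDerivAt (f := fun s => Real.exp (l * s) / l)]
      · simp
      · intro s _
        have := ((hasDerivAt_id s).const_mul l).exp.div_const l
        simpa [hl.ne'] using this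
      · exact Continuous.intervalIntegrable (by fun_prop) _ _
    rw [h1, h2, abs_of_nonneg]
    · have : 0 < 1 / l := by positivity
      linarith
    · rw [← sub_div]
      have : (1 : ℝ) ≤ Real.exp (l * t) := Real.one_le_exp (by positivity)
      exact div_nonneg (by linarith) hl.le
  rcases le_total 0 t with ht | ht
  · rw [abs_of_nonneg ht]; exact key t ht
  · have h1 := intervalIntegral.integral_comp_neg (a := 0) (b := t)
      (fun s : ℝ => Real.exp (l * |s|))
    simp only [abs_neg, neg_zero] at h1
    rw [h1, intervalIntegral.integral_symm, abs_neg, abs_of_nonpos ht]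
    exact key (-t) (by linarith)

variable {E : Type*} [NormedAddCommGroup E] [NormedSpace ℝ E] [CompleteSpace E]

/-- A Lipschitz vector field has global integral curves. -/
theorem exists_global_solution {K : ℝ≥0} {X : E → E} (hX : LipschitzWith K X) (x₀ : E) :
    ∃ x : ℝ → E, x 0 = x₀ ∧ ∀ t, HasDerivAt x (X (x t)) t := by
  -- Ensures `K / l ≤ 1 / 2`, and `l > 0` even if `K = 0`.
  set l : ℝ := 2 * K + 1 with hl
  have hl0 : 0 < l := by positivity
  have hlin : ∀ y, ‖X y‖ ≤ ‖X 0‖ + K * ‖y‖ := fun y => by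
    have h1 := hX.dist_le_mul y 0
    rw [dist_eq_norm, dist_zero_right] at h1
    calc ‖X y‖ = ‖X 0 + (X y - X 0)‖ := by rw [add_sub_cancel]
      _ ≤ _ := (norm_add_le _ _).trans (by gcongr)
  have hexp := continuous_exp_mul_abs l
  have hcont : ∀ z : BoundedContinuousFunction ℝ E,
      Continuous fun s => X (Real.exp (l * |s|) • z s) := fun z =>
    hX.continuous.comp (hexp.smul z.continuous)
  have hprim : ∀ z : BoundedContinuousFunction ℝ E,
      Continuous fun t => ∫ s in (0 : ℝ)..t, X (Real.exp (l * |s|) • z s) := fun z =>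
    intervalIntegral.continuous_primitive (fun a b => (hcont z).intervalIntegrable a b) 0
  have hee : ∀ t, Real.exp (-(l * |t|)) * Real.exp (l * |t|) = 1 := fun t => by
    rw [← Real.exp_add, neg_add_cancel, Real.exp_zero]
  have hest : ∀ (h : ℝ → E) (c : ℝ), (∀ s, ‖h s‖ ≤ c * Real.exp (l * |s|)) → 0 ≤ c → ∀ t,
      ‖Real.exp (-(l * |t|)) • ∫ s in (0 : ℝ)..t, h s‖ ≤ c / l := by
    intro h c hc hc0 t
    have h1 : ‖∫ s in (0 : ℝ)..t, h s‖ ≤ |∫ s in (0 : ℝ)..t, c * Real.exp (l * |s|)| :=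
      intervalIntegral.norm_integral_le_abs_of_norm_le (Eventually.of_forall fun s => hc s)
        ((continuous_const.mul hexp).intervalIntegrable _ _)
    rw [intervalIntegral.integral_const_mul, abs_mul, abs_of_nonneg hc0] at h1
    rw [norm_smul, Real.norm_of_nonneg (Real.exp_pos _).le]
    calc Real.exp (-(l * |t|)) * ‖∫ s in (0 : ℝ)..t, h s‖
        ≤ Real.exp (-(l * |t|)) * (c * (Real.exp (l * |t|) / l)) := by
          gcongr
          exact h1.trans (mul_le_mul_of_nonneg_left (abs_integral_exp_mul_abs_le hl0 t) hc0)
      _ = c / l * (Real.exp (-(l * |t|)) * Real.exp (l * |t|)) := by ring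
      _ = c / l := by rw [hee, mul_one]
  -- The Picard map in the unknown `z t = exp (-l |t|) x t`. In this weighted norm the solution is
  -- global at once, without continuation of local solutions.
  let G : BoundedContinuousFunction ℝ E → BoundedContinuousFunction ℝ E := fun z =>
    BoundedContinuousFunction.ofNormedAddCommGroup
      (fun t => Real.exp (-(l * |t|)) • (x₀ + ∫ s in (0 : ℝ)..t, X (Real.exp (l * |s|) • z s)))
      ((Continuous.smul (by fun_prop) (continuous_const.add (hprim z))))
      (‖x₀‖ + (‖X 0‖ + K * ‖z‖) / l) (fun t => by
        rw [smul_add]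
        refine (norm_add_le _ _).trans (add_le_add ?_ (hest _ _ (fun s => ?_) (by positivity) t))
        · rw [norm_smul, Real.norm_of_nonneg (Real.exp_pos _).le]
          have : Real.exp (-(l * |t|)) ≤ 1 := Real.exp_le_one_iff.2 (by
            have := abs_nonneg t
            nlinarith)
          exact mul_le_of_le_one_left (norm_nonneg _) this
        · have h1 := z.norm_coe_le_norm s
          have h2 : 1 ≤ Real.exp (l * |s|) := Real.one_le_exp (by positivity)
          refine (hlin _).trans ?_
          rw [norm_smul, Real.norm_of_nonneg (Real.exp_pos _).le, add_mul ‖X 0‖]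
          refine add_le_add (le_mul_of_one_le_right (norm_nonneg (X 0)) h2) ?_
          calc (K : ℝ) * (Real.exp (l * |s|) * ‖z s‖) ≤ K * (Real.exp (l * |s|) * ‖z‖) := by
                gcongr
            _ = _ := by ring)
  have hG : ∀ z t, G z t
      = Real.exp (-(l * |t|)) • (x₀ + ∫ s in (0 : ℝ)..t, X (Real.exp (l * |s|) • z s)) :=
    fun _ _ => rfl
  have hcontr : ContractingWith (1 / 2) G := by
    refine ⟨by norm_num, LipschitzWith.of_dist_le_mul fun z z' => ?_⟩
    rw [BoundedContinuousFunction.dist_le (by positivity)]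
    intro t
    rw [hG, hG, dist_eq_norm, ← smul_sub, add_sub_add_left_eq_sub,
      ← intervalIntegral.integral_sub ((hcont z).intervalIntegrable _ _)
        ((hcont z').intervalIntegrable _ _)]
    refine (hest _ (K * dist z z') (fun s => ?_) (by positivity) t).trans ?_
    · rw [← dist_eq_norm]
      refine (hX.dist_le_mul _ _).trans ?_
      rw [dist_smul₀, Real.norm_of_nonneg (Real.exp_pos _).le, mul_assoc]
      have h1 := z.dist_coe_le_dist (g := z') s
      calc (K : ℝ) * (Real.exp (l * |s|) * dist (z s) (z' s))
          ≤ K * (Real.exp (l * |s|) * dist z z') := by gcongr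
        _ = _ := by ring
    · rw [div_le_iff₀ hl0]
      push_cast
      have : 0 ≤ dist z z' := dist_nonneg
      rw [hl]
      nlinarith
  obtain ⟨z, hz, -⟩ := hcontr.exists_fixedPoint 0 (edist_ne_top _ _)
  set x : ℝ → E := fun t => Real.exp (l * |t|) • z t with hx
  have hxe : ∀ t, x t = x₀ + ∫ s in (0 : ℝ)..t, X (x s) := fun t => by
    have h1 : z t = G z t := by rw [hz.eq]
    simp only [hx]
    rw [h1, hG, smul_smul, mul_comm, hee, one_smul]
  refine ⟨x, by rw [hxe]; simp, fun t => ?_⟩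
  have h2 : HasDerivAt (fun t => x₀ + ∫ s in (0 : ℝ)..t, X (x s)) (X (x t)) t :=
    (intervalIntegral.integral_hasDerivAt_right ((hcont z).intervalIntegrable _ _)
      ((hcont z).stronglyMeasurableAtFilter _ _) (hcont z).continuousAt).const_add x₀
  exact h2.congr_of_eventuallyEq (Eventually.of_forall hxe)

end ODE

/-- The Cauchy problem for `u'' = -A u` in a Hilbert space, for a Lipschitz gradient `A` of a
potential `V`, has a global solution, which conserves the energy. -/
theorem exists_wave_solution {H : Type*} [NormedAddCommGroup H] [InnerProductSpace ℝ H]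
    [CompleteSpace H] {A : H → H} {V : H → ℝ} {K : ℝ≥0} (hA : LipschitzWith K A)
    (hV : ∀ u, HasGradientAt V (A u) u) (u₀ v₀ : H) :
    ∃ u w : ℝ → H, u 0 = u₀ ∧ w 0 = v₀ ∧ (∀ t, HasDerivAt u (w t) t) ∧
      (∀ t, HasDerivAt w (-A (u t)) t) ∧
      ∀ t, ‖w t‖ ^ 2 / 2 + V (u t) = ‖v₀‖ ^ 2 / 2 + V u₀ := by
  have hX : LipschitzWith (max 1 K) fun z : H × H => (z.2, -A z.1) := by
    have h1 : LipschitzWith 1 fun z : H × H => z.2 := LipschitzWith.prod_snd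
    have h2 : LipschitzWith (K * 1) fun z : H × H => -A z.1 :=
      (hA.comp LipschitzWith.prod_fst).neg
    rw [mul_one] at h2
    exact h1.prodMk h2
  obtain ⟨x, hx0, hx⟩ := exists_global_solution hX (u₀, v₀)
  have hu : ∀ t, HasDerivAt (fun t => (x t).1) (x t).2 t := fun t =>
    (hasFDerivAt_fst (p := x t)).comp_hasDerivAt t (hx t)
  have hw : ∀ t, HasDerivAt (fun t => (x t).2) (-A (x t).1) t := fun t =>
    (hasFDerivAt_snd (p := x t)).comp_hasDerivAt t (hx t)
  -- The contributions `⟪w, -A u⟫` and `⟪A u, w⟫` of kinetic and potential energy cancel.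
  have hE : ∀ t, HasDerivAt (fun t => ‖(x t).2‖ ^ 2 / 2 + V (x t).1) 0 t := fun t => by
    have h1 := (hw t).norm_sq.div_const 2
    have h2 := (hV (x t).1).hasFDerivAt.comp_hasDerivAt t (hu t)
    refine (h1.add h2).congr_deriv ?_
    simp only [inner_neg_right, InnerProductSpace.toDual_apply_apply, real_inner_comm (x t).2]
    ring
  refine ⟨fun t => (x t).1, fun t => (x t).2, by simp [hx0], by simp [hx0], hu, hw, fun t => ?_⟩
  have h := is_const_of_deriv_eq_zero (fun t => (hE t).differentiableAt)
    (fun t => (hE t).deriv) t 0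
  simpa [hx0] using h

/-! ### Superposition operators on `L²` -/

section Superposition

variable {E : Type*} [NormedAddCommGroup E] {L : ℝ≥0}

theorem norm_superposition_le {F : E → E} (hL : LipschitzWith L F) (h0 : F 0 = 0)
    (U : E) : ‖F U‖ ≤ L * ‖U‖ := by
  simpa [h0] using hL.dist_le_mul U 0

variable [InnerProductSpace ℝ E] [CompleteSpace E]

/-- The mean value inequality for `φ - ⟪F U, ·⟫`, whose gradient `F W - F U` is at most `L ‖h‖` on
the ball of radius `‖h‖` around `U`. -/
theorem abs_sub_sub_inner_le {φ : E → ℝ} {F : E → E} (hgrad : ∀ U, HasGradientAt φ (F U) U)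
    (hL : LipschitzWith L F) (U h : E) :
    |φ (U + h) - φ U - ⟪F U, h⟫_ℝ| ≤ L * ‖h‖ ^ 2 := by
  have h1 : ∀ W ∈ closedBall U ‖h‖, HasFDerivWithinAt (fun W => φ W - ⟪F U, W⟫_ℝ)
      (InnerProductSpace.toDual ℝ E (F W) - innerSL ℝ (F U)) (closedBall U ‖h‖) W := fun W _ =>
    ((hgrad W).hasFDerivAt.sub (innerSL ℝ (F U)).hasFDerivAt).hasFDerivWithinAt
  have h2 : ∀ W ∈ closedBall U ‖h‖,
      ‖InnerProductSpace.toDual ℝ E (F W) - innerSL ℝ (F U)‖ ≤ L * ‖h‖ := fun W hW => by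
    have h3 : InnerProductSpace.toDual ℝ E (F W) - innerSL ℝ (F U)
        = InnerProductSpace.toDual ℝ E (F W - F U) := by
      ext V; simp
    rw [h3, LinearIsometryEquiv.norm_map, ← dist_eq_norm]
    refine (hL.dist_le_mul W U).trans ?_
    gcongr
    exact hW
  have h4 := (convex_closedBall U ‖h‖).norm_image_sub_le_of_norm_hasFDerivWithin_le h1 h2
    (mem_closedBall_self (norm_nonneg h)) (y := U + h) (by simp)
  rw [Real.norm_eq_abs] at h4
  calc |φ (U + h) - φ U - ⟪F U, h⟫_ℝ|
      = |φ (U + h) - ⟪F U, U + h⟫_ℝ - (φ U - ⟪F U, U⟫_ℝ)| := by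
        rw [inner_add_right]; congr 1; ring
    _ ≤ _ := h4.trans (le_of_eq (by rw [add_sub_cancel_left]; ring))

theorem abs_potential_le {φ : E → ℝ} {F : E → E} (hgrad : ∀ U, HasGradientAt φ (F U) U)
    (hL : LipschitzWith L F) (h0 : F 0 = 0) (hφ0 : φ 0 = 0) (U : E) : |φ U| ≤ L * ‖U‖ ^ 2 := by
  simpa [h0, hφ0] using abs_sub_sub_inner_le hgrad hL 0 U

variable {Z : Type*} [MeasurableSpace Z] {μ : Measure Z} [MeasurableSpace E] [BorelSpace E]
  [SecondCountableTopology E] {F : Z → E → E} {φ : Z → E → ℝ}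

omit [InnerProductSpace ℝ E] [CompleteSpace E] in
theorem memLp_superposition (hF : Measurable fun q : Z × E => F q.1 q.2)
    (hL : ∀ z, LipschitzWith L (F z)) (h0 : ∀ z, F z 0 = 0) {U : Z → E} (hU : MemLp U 2 μ) :
    MemLp (fun z => F z (U z)) 2 μ := by
  refine MemLp.of_le_mul hU (c := L) ?_
    (Eventually.of_forall fun z => norm_superposition_le (hL z) (h0 z) (U z))
  exact (hF.comp_aemeasurable
    (aemeasurable_id.prodMk hU.1.aemeasurable)).aestronglyMeasurable

omit [SecondCountableTopology E] in
theorem integrable_potential (hL : ∀ z, LipschitzWith L (F z)) (h0 : ∀ z, F z 0 = 0)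
    (hφ : Measurable fun q : Z × E => φ q.1 q.2)
    (hgrad : ∀ z U, HasGradientAt (φ z) (F z U) U) (hφ0 : ∀ z, φ z 0 = 0) (U : Lp E 2 μ) :
    Integrable (fun z => φ z (U z)) μ := by
  have h1 : Integrable (fun z => (L : ℝ) * ‖U z‖ ^ 2) μ :=
    ((Lp.memLp U).integrable_norm_pow (by norm_num)).const_mul _
  refine h1.mono' ?_ (Eventually.of_forall fun z =>
    abs_potential_le (hgrad z) (hL z) (h0 z) (hφ0 z) (U z))
  exact (hφ.comp_aemeasurable
    (aemeasurable_id.prodMk (Lp.memLp U).1.aemeasurable)).aestronglyMeasurable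

variable (hF : Measurable fun q : Z × E => F q.1 q.2) (hL : ∀ z, LipschitzWith L (F z))
  (h0 : ∀ z, F z 0 = 0)

/-- The superposition operator `U ↦ F(·, U(·))` on `L²`. -/
noncomputable def superposition (U : Lp E 2 μ) : Lp E 2 μ :=
  (memLp_superposition hF hL h0 (Lp.memLp U)).toLp _

omit [InnerProductSpace ℝ E] [CompleteSpace E] in
theorem coeFn_superposition (U : Lp E 2 μ) :
    superposition hF hL h0 U =ᵐ[μ] fun z => F z (U z) := MemLp.coeFn_toLp _

omit [InnerProductSpace ℝ E] [CompleteSpace E] in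
theorem lipschitzWith_superposition : LipschitzWith L (superposition (μ := μ) hF hL h0) := by
  refine LipschitzWith.of_dist_le_mul fun U V => ?_
  rw [dist_eq_norm, dist_eq_norm]
  refine Lp.norm_le_mul_norm_of_ae_le_mul ?_
  filter_upwards [Lp.coeFn_sub (superposition hF hL h0 U) (superposition hF hL h0 V),
    Lp.coeFn_sub U V, coeFn_superposition hF hL h0 U, coeFn_superposition hF hL h0 V]
    with z h1 h2 h3 h4
  rw [h1, h2, Pi.sub_apply, Pi.sub_apply, h3, h4, ← dist_eq_norm, ← dist_eq_norm]
  exact (hL z).dist_le_mul _ _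

/-- The pointwise Taylor remainder `L ‖h z‖ ^ 2` integrates to `L ‖h‖ ^ 2`. Only a Lipschitz
gradient enters, so no differentiability of the superposition operator on `L²` is needed. -/
theorem hasGradientAt_integral_potential (hφ : Measurable fun q : Z × E => φ q.1 q.2)
    (hgrad : ∀ z U, HasGradientAt (φ z) (F z U) U) (hφ0 : ∀ z, φ z 0 = 0) (U : Lp E 2 μ) :
    HasGradientAt (fun U : Lp E 2 μ => ∫ z, φ z (U z) ∂μ) (superposition hF hL h0 U) U := by
  have hint := integrable_potential hL h0 hφ hgrad hφ0 (μ := μ)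
  have hd : ∀ h : Lp E 2 μ,
      Integrable (fun z => φ z ((U + h : Lp E 2 μ) z) - φ z (U z)) μ := fun h =>
    (hint _).sub (hint _)
  rw [hasGradientAt_iff_isLittleO_nhds_zero]
  have key : ∀ h : Lp E 2 μ, ‖∫ z, φ z ((U + h : Lp E 2 μ) z) ∂μ - ∫ z, φ z (U z) ∂μ
      - ⟪superposition hF hL h0 U, h⟫_ℝ‖ ≤ L * ‖h‖ ^ 2 := by
    intro h
    have hi : Integrable (fun z => ⟪superposition hF hL h0 U z, h z⟫_ℝ) μ :=
      L2.integrable_inner _ _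
    have hn : ‖h‖ ^ 2 = ∫ z, ‖h z‖ ^ 2 ∂μ := by
      rw [← real_inner_self_eq_norm_sq, L2.inner_def]
      simp only [real_inner_self_eq_norm_sq]
    rw [L2.inner_def, ← integral_sub (hint _) (hint _),
      ← integral_sub (hd h) hi, hn, ← integral_const_mul]
    refine norm_integral_le_of_norm_le
      (((Lp.memLp h).integrable_norm_pow (by norm_num)).const_mul _) ?_
    filter_upwards [Lp.coeFn_add U h, coeFn_superposition hF hL h0 U] with z h1 h2
    rw [h1, h2, Pi.add_apply, Real.norm_eq_abs]
    exact abs_sub_sub_inner_le (hgrad z) (hL z) (U z) (h z)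
  have hO : (fun h : Lp E 2 μ => ∫ z, φ z ((U + h : Lp E 2 μ) z) ∂μ - ∫ z, φ z (U z) ∂μ
      - ⟪superposition hF hL h0 U, h⟫_ℝ) =O[𝓝 0] fun h => ‖h‖ ^ 2 := by
    refine Asymptotics.IsBigO.of_bound L (Eventually.of_forall fun h => ?_)
    rw [norm_pow, norm_norm]
    exact key h
  refine hO.trans_isLittleO ((Asymptotics.isLittleO_norm_right).1 ?_)
  have e : (fun h : Lp E 2 μ => ‖h‖ ^ 2) = fun h => ‖h‖ * ‖h‖ := by ext; ring
  rw [e]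
  have h1 : (fun h : Lp E 2 μ => ‖h‖) =o[𝓝 0] fun _ => (1 : ℝ) := by
    rw [Asymptotics.isLittleO_one_iff]
    simpa using (continuous_norm (E := Lp E 2 μ)).tendsto 0
  simpa using h1.mul_isBigO (Asymptotics.isBigO_refl (fun h : Lp E 2 μ => ‖h‖) (𝓝 0))

end Superposition

/-! ### The difference operator on `L²` -/

section Diff

variable {N : ℕ} {δ : ℝ}

/-- The space `L²(ℝ^N; ℝ^N)`. -/
abbrev LTwo (N : ℕ) : Type := Lp (Vec N) 2 (volume : Measure (Vec N))

/-- The measure `dx dy` on `ℝ^N × B_δ(0)`. -/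
noncomputable abbrev pairMeasure (N : ℕ) (δ : ℝ) : Measure (Vec N × Vec N) :=
  (volume : Measure (Vec N)).prod (volume.restrict (ball 0 δ))

instance : IsFiniteMeasure ((volume : Measure (Vec N)).restrict (ball 0 δ)) :=
  ⟨by simpa using measure_ball_lt_top⟩

theorem map_fst_pairMeasure :
    (pairMeasure N δ).map Prod.fst = volume (ball (0 : Vec N) δ) • volume := by
  simp [pairMeasure]

/-- For each fixed bond `y` this is a translation in `x`. -/
theorem measurePreserving_shear :
    MeasurePreserving (fun z : Vec N × Vec N => (z.1 - z.2, z.2))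
      (pairMeasure N δ) (pairMeasure N δ) := by
  have hskew : MeasurePreserving (fun z : Vec N × Vec N => (z.1, z.2 - z.1))
      ((volume.restrict (ball 0 δ)).prod (volume : Measure (Vec N)))
      ((volume.restrict (ball 0 δ)).prod (volume : Measure (Vec N))) :=
    (MeasurePreserving.id _).skew_product (g := fun y x => x - y) (by fun_prop)
      (Eventually.of_forall fun y => (measurePreserving_sub_right volume y).map_eq)
  exact (Measure.measurePreserving_swap.comp hskew).comp Measure.measurePreserving_swap

theorem map_sub_pairMeasure :
    (pairMeasure N δ).map (fun z => z.1 - z.2) = volume (ball (0 : Vec N) δ) • volume := by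
  rw [← map_fst_pairMeasure (δ := δ), ← (measurePreserving_shear (N := N) (δ := δ)).map_eq,
    Measure.map_map measurable_fst (measurePreserving_shear (δ := δ)).measurable,
    measurePreserving_shear.map_eq]
  rfl

/-- Null sets pull back to null sets, so `u (x - y)` makes sense for a class `u` of functions modulo
null sets. -/
theorem quasiMeasurePreserving_sub :
    Measure.QuasiMeasurePreserving (fun z : Vec N × Vec N => z.1 - z.2)
      (pairMeasure N δ) volume :=
  ⟨by fun_prop, by rw [map_sub_pairMeasure]; exact Measure.smul_absolutelyContinuous⟩

theorem ae_fst_sub {P : Vec N → Prop} (h : ∀ᵐ x, P x) :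
    ∀ᵐ z ∂(pairMeasure N δ), P z.1 ∧ P (z.1 - z.2) :=
  (Measure.quasiMeasurePreserving_fst.ae h).and (quasiMeasurePreserving_sub.ae h)

theorem memLp_diff {u : Vec N → Vec N} (hu : MemLp u 2 volume) :
    MemLp (fun z : Vec N × Vec N => u z.1 - u (z.1 - z.2)) 2 (pairMeasure N δ) :=
  (hu.comp_fst _).sub ((hu.comp_fst _).comp_measurePreserving measurePreserving_shear)

theorem eLpNorm_diff_le {u : Vec N → Vec N} (hu : MemLp u 2 volume) :
    eLpNorm (fun z : Vec N × Vec N => u z.1 - u (z.1 - z.2)) 2 (pairMeasure N δ)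
      ≤ (2 * volume (ball (0 : Vec N) δ) ^ (1 / 2 : ℝ)) * eLpNorm u 2 volume := by
  have h1 : eLpNorm (fun z : Vec N × Vec N => u z.1) 2 (pairMeasure N δ)
      = volume (ball (0 : Vec N) δ) ^ (1 / 2 : ℝ) * eLpNorm u 2 volume := by
    have := eLpNorm_map_measure (p := 2) (μ := pairMeasure N δ) (f := Prod.fst) (g := u)
      (by rw [map_fst_pairMeasure]; exact hu.1.smul_measure _) (by fun_prop)
    rw [map_fst_pairMeasure, eLpNorm_smul_measure_of_ne_top (by norm_num)] at this
    simpa [Function.comp_def] using this.symm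
  have h2 : eLpNorm (fun z : Vec N × Vec N => u (z.1 - z.2)) 2 (pairMeasure N δ)
      = volume (ball (0 : Vec N) δ) ^ (1 / 2 : ℝ) * eLpNorm u 2 volume := by
    rw [← h1]
    have h3 : AEStronglyMeasurable (fun z : Vec N × Vec N => u z.1) (pairMeasure N δ) :=
      (hu.comp_fst _).1
    have h4 := eLpNorm_comp_measurePreserving (p := 2) h3 measurePreserving_shear
    simpa only [Function.comp_def] using h4
  have h3 : AEStronglyMeasurable (fun z : Vec N × Vec N => u z.1) (pairMeasure N δ) :=
    (hu.comp_fst _).1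
  have h4 : AEStronglyMeasurable (fun z : Vec N × Vec N => u (z.1 - z.2)) (pairMeasure N δ) :=
    h3.comp_measurePreserving measurePreserving_shear
  refine (eLpNorm_sub_le h3 h4 (by norm_num)).trans (le_of_eq ?_)
  rw [h1, h2]; ring

theorem diff_ae_congr {u v : Vec N → Vec N} (h : u =ᵐ[volume] v) :
    (fun z : Vec N × Vec N => u z.1 - u (z.1 - z.2)) =ᵐ[pairMeasure N δ]
      fun z => v z.1 - v (z.1 - z.2) := by
  filter_upwards [ae_fst_sub h] with z hz
  rw [hz.1, hz.2]

/-- The operator `(D u)(x, y) = u(x) - u(x - y)`, bounded from `L²(ℝ^N)` to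
`L²(ℝ^N × B_δ(0))`. -/
noncomputable def bondDiff (N : ℕ) (δ : ℝ) :
    LTwo N →L[ℝ] Lp (Vec N) 2 (pairMeasure N δ) :=
  LinearMap.mkContinuous
    { toFun := fun u => (memLp_diff (Lp.memLp u)).toLp _
      map_add' := fun u v => by
        rw [← MemLp.toLp_add]
        refine MemLp.toLp_congr _ _ ((diff_ae_congr (Lp.coeFn_add u v)).trans
          (Eventually.of_forall fun z => ?_))
        simp only [Pi.add_apply]
        abel
      map_smul' := fun c u => by
        rw [RingHom.id_apply, ← MemLp.toLp_const_smul]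
        refine MemLp.toLp_congr _ _ ((diff_ae_congr (Lp.coeFn_smul c u)).trans
          (Eventually.of_forall fun z => ?_))
        simp only [Pi.smul_apply, smul_sub] }
    (2 * volume (ball (0 : Vec N) δ) ^ (1 / 2 : ℝ)).toReal fun u => by
      rw [LinearMap.coe_mk, AddHom.coe_mk, Lp.norm_toLp, Lp.norm_def, ← ENNReal.toReal_mul]
      refine ENNReal.toReal_mono ?_ (eLpNorm_diff_le (Lp.memLp u))
      refine ENNReal.mul_ne_top (ENNReal.mul_ne_top (by norm_num) ?_) (Lp.eLpNorm_ne_top u)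
      exact ENNReal.rpow_ne_top_of_nonneg (by norm_num) measure_ball_lt_top.ne

theorem coeFn_bondDiff (u : LTwo N) :
    bondDiff N δ u =ᵐ[pairMeasure N δ] fun z => u z.1 - u (z.1 - z.2) :=
  MemLp.coeFn_toLp (memLp_diff (Lp.memLp u))

end Diff

/-! ### The regularized problem -/

section Regularized

variable {N : ℕ} {δ κ p α : ℝ} {f : Vec N → Vec N → Vec N} {Φ : Vec N → Vec N → ℝ}
  {g : Vec N → ℝ} {S : ℕ → Set (Vec N)} {F : ℕ → Vec N → Vec N → Vec N}
  {φ : ℕ → Vec N → Vec N → ℝ}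

/-- Half the integral of the potential. -/
noncomputable def potentialEnergy (δ : ℝ) (φ : Vec N → Vec N → ℝ) (u : Vec N → Vec N) : ℝ :=
  1 / 2 * ∫ z, φ z.2 (u z.1 - u (z.1 - z.2)) ∂(pairMeasure N δ)

theorem IsRegularization.integrable_potential (h : IsRegularization δ κ p α f Φ g S F φ) (n : ℕ)
    (u : LTwo N) :
    Integrable (fun z => φ n z.2 (u z.1 - u (z.1 - z.2))) (pairMeasure N δ) := by
  obtain ⟨L, hL⟩ := h.lip n
  have h1 := Peridynamics.integrable_potential (μ := pairMeasure N δ) (Z := Vec N × Vec N)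
    (F := fun z => F n z.2) (φ := fun z => φ n z.2) (fun z => hL z.2) (fun z => h.F_zero n z.2)
    ((h.φ_meas n).comp (by fun_prop : Measurable fun q : (Vec N × Vec N) × Vec N => (q.1.2, q.2)))
    (fun z => h.grad n z.2) (fun z => h.φ_zero n z.2) (bondDiff N δ u)
  refine h1.congr ?_
  filter_upwards [coeFn_bondDiff (δ := δ) u] with z hz
  rw [hz]

theorem IsRegularization.exists_superposition (h : IsRegularization δ κ p α f Φ g S F φ) (n : ℕ)
    (μ : Measure (Vec N × Vec N)) :
    ∃ P : Lp (Vec N) 2 μ → Lp (Vec N) 2 μ, (∃ L, LipschitzWith L P) ∧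
      (∀ U, P U =ᵐ[μ] fun z => F n z.2 (U z)) ∧
      ∀ U, HasGradientAt (fun U : Lp (Vec N) 2 μ => ∫ z, φ n z.2 (U z) ∂μ) (P U) U := by
  obtain ⟨L, hL⟩ := h.lip n
  have hF : Measurable fun q : (Vec N × Vec N) × Vec N => F n q.1.2 q.2 :=
    (h.F_meas n).comp (by fun_prop : Measurable fun q : (Vec N × Vec N) × Vec N => (q.1.2, q.2))
  have hφ : Measurable fun q : (Vec N × Vec N) × Vec N => φ n q.1.2 q.2 :=
    (h.φ_meas n).comp (by fun_prop : Measurable fun q : (Vec N × Vec N) × Vec N => (q.1.2, q.2))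
  have hL' : ∀ z : Vec N × Vec N, LipschitzWith L ((fun z => F n z.2) z) := fun z => hL z.2
  have h0 : ∀ z : Vec N × Vec N, (fun z : Vec N × Vec N => F n z.2) z 0 = 0 :=
    fun z => h.F_zero n z.2
  refine ⟨superposition (Z := Vec N × Vec N) (μ := μ) (F := fun z => F n z.2) hF hL' h0, ?_, ?_, ?_⟩
  · exact ⟨L, lipschitzWith_superposition hF hL' h0⟩
  · exact coeFn_superposition hF hL' h0
  · exact hasGradientAt_integral_potential (Z := Vec N × Vec N) (μ := μ) (F := fun z => F n z.2)
      (φ := fun z => φ n z.2) hF hL' h0 hφ (fun z => h.grad n z.2) (fun z => h.φ_zero n z.2)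

/-- The operator is `A = (1/2) D* P D`, with `D` the bond difference and `P` the superposition with
`F n`. It is Lipschitz as a composition, a gradient by the chain rule, and `⟪A u, v⟫ = (1/2) ⟪P D u,
D v⟫` is the negative of the pairing for `F n`. -/
theorem IsRegularization.exists_force (h : IsRegularization δ κ p α f Φ g S F φ) (n : ℕ) :
    ∃ A : LTwo N → LTwo N, (∃ K, LipschitzWith K A) ∧
      (∀ u, HasGradientAt (fun u : LTwo N => potentialEnergy δ (φ n) u) (A u) u) ∧
      ∀ u v : LTwo N, Integrable (formIntegrand (F n) u v) (pairMeasure N δ) ∧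
        ⟪A u, v⟫_ℝ = 1 / 2 * ∫ z, formIntegrand (F n) u v z ∂(pairMeasure N δ) := by
  obtain ⟨P, ⟨L, hPL⟩, hPe, hgrad⟩ := h.exists_superposition n (pairMeasure N δ)
  set D := bondDiff N δ with hD
  have hDe : ∀ u : LTwo N, potentialEnergy δ (φ n) u
      = 1 / 2 * ∫ z, φ n z.2 (D u z) ∂(pairMeasure N δ) := fun u => by
    rw [potentialEnergy]
    congr 1
    refine integral_congr_ae ?_
    filter_upwards [coeFn_bondDiff (δ := δ) u] with z hz
    rw [hD, hz]
  have hform : ∀ u v : LTwo N, (fun z => ⟪P (D u) z, D v z⟫_ℝ) =ᵐ[pairMeasure N δ]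
      formIntegrand (F n) u v := fun u v => by
    filter_upwards [coeFn_bondDiff (δ := δ) u, coeFn_bondDiff (δ := δ) v,
      hPe (D u)] with z h1 h2 h3
    rw [h3, hD, h1, h2, formIntegrand]
  set B : Lp (Vec N) 2 (pairMeasure N δ) →L[ℝ] LTwo N := (1 / 2 : ℝ) • D.adjoint with hB
  have hA : ∀ u v : LTwo N, ⟪B (P (D u)), v⟫_ℝ = 1 / 2 * ⟪P (D u), D v⟫_ℝ := fun u v => by
    rw [hB, _root_.smul_apply, inner_smul_left, ContinuousLinearMap.adjoint_inner_left]; simp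
  refine ⟨fun u => B (P (D u)), ⟨_, B.lipschitz.comp (hPL.comp D.lipschitz)⟩, fun u => ?_,
    fun u v => ⟨?_, ?_⟩⟩
  · rw [hasGradientAt_iff_hasFDerivAt]
    have h1 := ((hgrad (D u)).hasFDerivAt.comp u D.hasFDerivAt).const_mul (1 / 2 : ℝ)
    refine (h1.congr_fderiv ?_).congr_of_eventuallyEq (Eventually.of_forall hDe)
    ext v
    rw [InnerProductSpace.toDual_apply_apply, hA]
    rfl
  · exact (L2.integrable_inner _ _).congr (hform u v)
  · rw [hA, L2.inner_def, integral_congr_ae (hform u v)]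

end Regularized

/-! ### Weak limits of curves in a Hilbert space -/

section Weak

theorem cauchySeq_of_approx {a : ℕ → ℝ}
    (h : ∀ ε > 0, ∃ b : ℕ → ℝ, CauchySeq b ∧ ∀ n, |a n - b n| ≤ ε) : CauchySeq a := by
  rw [Metric.cauchySeq_iff']
  intro ε hε
  obtain ⟨b, hb, hab⟩ := h (ε / 4) (by positivity)
  obtain ⟨n₀, hn₀⟩ := Metric.cauchySeq_iff'.1 hb (ε / 4) (by positivity)
  refine ⟨n₀, fun n hn => ?_⟩
  have h1 := hab n
  have h2 := hab n₀
  have h3 := hn₀ n hn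
  rw [Real.dist_eq] at h3 ⊢
  rw [abs_le] at h1 h2
  rw [abs_lt] at h3 ⊢
  constructor <;> linarith

variable {H : Type*} [NormedAddCommGroup H] [InnerProductSpace ℝ H]

theorem cauchySeq_inner_of_dense {x : ℕ → H} {C : ℝ} (hC : ∀ n, ‖x n‖ ≤ C) {S : Set H}
    (hS : Dense S) (h : ∀ η ∈ S, CauchySeq fun n => ⟪η, x n⟫_ℝ) (η : H) :
    CauchySeq fun n => ⟪η, x n⟫_ℝ := by
  refine cauchySeq_of_approx fun ε hε => ?_
  have hC0 : 0 ≤ C := (norm_nonneg _).trans (hC 0)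
  obtain ⟨η', hη', hd⟩ := hS.exists_dist_lt η (show 0 < ε / (C + 1) by positivity)
  refine ⟨_, h η' hη', fun n => ?_⟩
  rw [← inner_sub_left]
  refine (abs_real_inner_le_norm _ _).trans ?_
  rw [← dist_eq_norm]
  calc dist η η' * ‖x n‖ ≤ ε / (C + 1) * (C + 1) := by
        gcongr
        linarith [hC n]
    _ = ε := by field_simp

variable [CompleteSpace H]

/-- The limits of the inner products form a bounded linear functional of `η`, which the Riesz
theorem represents by a vector. -/
theorem exists_weak_limit {x : ℕ → H} {C : ℝ} (hC : ∀ n, ‖x n‖ ≤ C)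
    (h : ∀ η : H, CauchySeq fun n => ⟪η, x n⟫_ℝ) :
    ∃ y, ∀ η, Tendsto (fun n => ⟪η, x n⟫_ℝ) atTop (𝓝 ⟪η, y⟫_ℝ) := by
  choose l hl using fun η => cauchySeq_tendsto_of_complete (h η)
  have hb : ∀ η, ‖l η‖ ≤ C * ‖η‖ := fun η => by
    refine le_of_tendsto (hl η).norm (Eventually.of_forall fun n => ?_)
    refine (norm_inner_le_norm _ _).trans ?_
    rw [mul_comm]
    gcongr
    exact hC n
  let L : H →L[ℝ] ℝ := LinearMap.mkContinuous
    { toFun := l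
      map_add' := fun a b => tendsto_nhds_unique (hl (a + b)) (by
        simpa only [inner_add_left] using (hl a).add (hl b))
      map_smul' := fun c a => tendsto_nhds_unique (hl (c • a)) (by
        simpa [inner_smul_left] using (hl a).const_mul c) } C hb
  refine ⟨(InnerProductSpace.toDual ℝ H).symm L, fun η => ?_⟩
  rw [real_inner_comm, InnerProductSpace.toDual_symm_apply]
  exact hl η

/-- A sequence of curves in a separable Hilbert space which is bounded at each time, and
equi-Lipschitz when tested with the elements of a dense set, has a subsequence that converges
weakly at every time. -/
theorem exists_subseq_weak_limit [SecondCountableTopology H] {x : ℕ → ℝ → H} {C : ℝ → ℝ}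
    (hC : ∀ n t, ‖x n t‖ ≤ C t) {S : Set H} (hS : Dense S)
    (hL : ∀ η ∈ S, ∃ L : ℝ≥0, ∀ n, LipschitzWith L fun t => ⟪η, x n t⟫_ℝ) :
    ∃ ns : ℕ → ℕ, StrictMono ns ∧ ∃ y : ℝ → H, ∀ t η,
      Tendsto (fun k => ⟪η, x (ns k) t⟫_ℝ) atTop (𝓝 ⟪η, y t⟫_ℝ) := by
  set d := TopologicalSpace.denseSeq H with hd
  set q := TopologicalSpace.denseSeq ℝ with hq
  -- The inner products with countably many vectors at countably many times lie in a compact product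
  -- of intervals. Sequential compactness of this product replaces a diagonal argument.
  have hcomp : IsCompact (univ.pi fun ij : ℕ × ℕ =>
      Icc (-(‖d ij.1‖ * C (q ij.2))) (‖d ij.1‖ * C (q ij.2))) :=
    isCompact_univ_pi fun _ => isCompact_Icc
  obtain ⟨a, -, ns, hns, hlim⟩ := hcomp.tendsto_subseq
    (x := fun n (ij : ℕ × ℕ) => ⟪d ij.1, x n (q ij.2)⟫_ℝ) fun n ij _ => by
      refine abs_le.1 ((abs_real_inner_le_norm _ _).trans ?_)
      gcongr
      exact hC _ _
  rw [tendsto_pi_nhds] at hlim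
  have h1 : ∀ j (η : H), CauchySeq fun k => ⟪η, x (ns k) (q j)⟫_ℝ := fun j =>
    cauchySeq_inner_of_dense (fun k => hC _ _) (TopologicalSpace.denseRange_denseSeq H) (by
      rintro _ ⟨i, rfl⟩
      exact (hlim (i, j)).cauchySeq)
  -- At the dense times convergence is known for all `η`. The equi-Lipschitz bound carries it to all
  -- times for `η ∈ S`, and the density of `S` then to all `η`.
  have h2 : ∀ t, ∀ η ∈ S, CauchySeq fun k => ⟪η, x (ns k) t⟫_ℝ := by
    intro t η hη
    obtain ⟨L, hL⟩ := hL η hη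
    refine cauchySeq_of_approx fun ε hε => ?_
    obtain ⟨j, hj⟩ := (TopologicalSpace.denseRange_denseSeq ℝ).exists_dist_lt t
      (show 0 < ε / (L + 1) by positivity)
    refine ⟨_, h1 j η, fun k => ?_⟩
    rw [← Real.dist_eq]
    refine ((hL (ns k)).dist_le_mul _ _).trans ?_
    calc (L : ℝ) * dist t (q j) ≤ (L + 1) * (ε / (L + 1)) := by
          gcongr
          linarith
      _ = ε := by field_simp
  choose y hy using fun t => exists_weak_limit (fun k => hC (ns k) t)
    (cauchySeq_inner_of_dense (fun k => hC (ns k) t) hS (h2 t))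
  exact ⟨ns, hns, y, fun t η => hy t η⟩

-- A distance exceeds `r ≥ 0` exactly if some vector `η` satisfies `r ‖η‖ < ⟪η, y t - z⟫`. This is
-- an open condition on `η`, so a countable dense set of vectors decides it.
omit [CompleteSpace H] in
theorem measurable_dist_of_weak {T : Type*} [MeasurableSpace T] [SecondCountableTopology H]
    {y : T → H} (hm : ∀ η, Measurable fun t => ⟪η, y t⟫_ℝ) (z : H) :
    Measurable fun t => dist (y t) z := by
  set d := TopologicalSpace.denseSeq H with hd
  refine measurable_of_Ioi fun r => ?_
  rcases lt_or_ge r 0 with hr | hr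
  · convert MeasurableSet.univ
    ext t
    simpa using hr.trans_le dist_nonneg
  have key : (fun t => dist (y t) z) ⁻¹' Ioi r
      = ⋃ i, {t | r * ‖d i‖ < ⟪d i, y t⟫_ℝ - ⟪d i, z⟫_ℝ} := by
    ext t
    simp only [mem_preimage, mem_Ioi, mem_iUnion, mem_ofPred_eq, ← inner_sub_right, dist_eq_norm]
    constructor
    · intro h
      have hopen : IsOpen {η : H | r * ‖η‖ < ⟪η, y t - z⟫_ℝ} :=
        isOpen_lt (by fun_prop) (by fun_prop)
      have hne : {η : H | r * ‖η‖ < ⟪η, y t - z⟫_ℝ}.Nonempty :=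
        ⟨y t - z, by
          rw [mem_ofPred_eq, real_inner_self_eq_norm_mul_norm]
          exact mul_lt_mul_of_pos_right h (hr.trans_lt h)⟩
      exact (TopologicalSpace.denseRange_denseSeq H).exists_mem_open hopen hne
    · rintro ⟨i, hi⟩
      by_contra hle
      have h1 := real_inner_le_norm (d i) (y t - z)
      have h2 : ‖d i‖ * ‖y t - z‖ ≤ ‖d i‖ * r := by
        gcongr
        exact not_lt.1 hle
      linarith
  rw [key]
  exact MeasurableSet.iUnion fun i =>
    measurableSet_lt measurable_const ((hm _).sub measurable_const)

end Weak

/-- A measurable curve in `L^q` is represented by a jointly measurable function. -/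
theorem exists_jointly_measurable {T X E : Type*} [MeasurableSpace T] [MeasurableSpace X]
    {ν : Measure X} [NormedAddCommGroup E] [CompleteSpace E] [MeasurableSpace E]
    [BorelSpace E] [SecondCountableTopology E] {q : ℝ≥0∞} [Fact (1 ≤ q)]
    [SecondCountableTopology (Lp E q ν)] {y : T → Lp E q ν}
    (hy : ∀ z, Measurable fun t => dist (y t) z) :
    ∃ U : T → X → E, StronglyMeasurable (fun z : T × X => U z.1 z.2) ∧ ∀ t, U t =ᵐ[ν] y t := by
  classical
  set d := TopologicalSpace.denseSeq (Lp E q ν) with hd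
  have hex : ∀ j : ℕ, ∀ t, ∃ i, dist (y t) (d i) < (1 / 2 : ℝ) ^ j := fun j t =>
    (TopologicalSpace.denseRange_denseSeq (Lp E q ν)).exists_dist_lt (y t) (by positivity)
  -- A measurable choice of an element of the dense sequence within `2⁻ʲ` of `y t`. Only countably
  -- many functions of `x` occur, which makes the approximations jointly measurable.
  set idx : ℕ → T → ℕ := fun j t => Nat.find (hex j t) with hidx
  have hidxm : ∀ j, Measurable (idx j) := fun j =>
    measurable_find (hex j) fun i => measurableSet_lt (hy (d i)) measurable_const
  have hdist : ∀ j t, dist (y t) (d (idx j t)) < (1 / 2 : ℝ) ^ j := fun j t => Nat.find_spec (hex j t)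
  set W : ℕ → T × X → E := fun j z => d (idx j z.1) z.2 with hW
  have hWm : ∀ j, StronglyMeasurable (W j) := fun j => by
    have h1 : StronglyMeasurable fun z : ℕ × X => d z.1 z.2 :=
      (measurable_from_prod_countable_right fun i =>
        (Lp.stronglyMeasurable (d i)).measurable).stronglyMeasurable
    exact h1.comp_measurable (((hidxm j).comp measurable_fst).prodMk measurable_snd)
  have hne : Nonempty E := ⟨0⟩
  refine ⟨fun t x => limUnder atTop fun j => W j (t, x), StronglyMeasurable.limUnder hWm,
    fun t => ?_⟩
  have hto : Tendsto (fun j => d (idx j t)) atTop (𝓝 (y t)) := by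
    rw [tendsto_iff_dist_tendsto_zero]
    refine squeeze_zero (fun _ => dist_nonneg) (fun j => ?_)
      (tendsto_pow_atTop_nhds_zero_of_lt_one (r := (1 / 2 : ℝ)) (by norm_num) (by norm_num))
    rw [dist_comm]
    exact (hdist j t).le
  -- The errors are summable, so the whole sequence converges almost everywhere in `x`, for each
  -- `t`. A subsequence chosen separately for each `t` would not give joint measurability of the
  -- limit.
  have hcau : ∀ᵐ x ∂ν, ∃ l : E, Tendsto (fun j => d (idx j t) x) atTop (𝓝 l) := by
    refine Lp.ae_tendsto_of_cauchy_eLpNorm (p := q) (fun j => Lp.aestronglyMeasurable _) Fact.out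
      (B := fun N => ENNReal.ofReal (2 * (1 / 2 : ℝ) ^ N)) ?_ fun N n m hn hm => ?_
    · exact ((summable_geometric_of_lt_one (by norm_num) (by norm_num)).mul_left 2).tsum_ofReal_ne_top
    · rw [← Lp.edist_def, edist_dist, ENNReal.ofReal_lt_ofReal_iff (by positivity)]
      have h1 := hdist n t
      have h2 := hdist m t
      have h3 : (1 / 2 : ℝ) ^ n ≤ (1 / 2) ^ N := pow_le_pow_of_le_one (by norm_num) (by norm_num) hn
      have h4 : (1 / 2 : ℝ) ^ m ≤ (1 / 2) ^ N := pow_le_pow_of_le_one (by norm_num) (by norm_num) hm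
      have h5 := dist_triangle_left (d (idx n t)) (d (idx m t)) (y t)
      linarith
  obtain ⟨ns, hns, hae⟩ := (tendstoInMeasure_of_tendsto_Lp hto).exists_seq_tendsto_ae
  filter_upwards [hcau, hae] with x ⟨l, hl⟩ hx
  have h1 : l = y t x := tendsto_nhds_unique (hl.comp hns.tendsto_atTop) hx
  rw [← h1]
  exact hl.limUnder_eq

/-! ### Compactness from bounded energy -/

section Averages

variable {N : ℕ}

/-- The average of `u` over `x - T`. -/
noncomputable def average (T : Set (Vec N)) (u : Vec N → Vec N) (x : Vec N) : Vec N :=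
  (volume.real T)⁻¹ • ∫ y in T, u (x - y)

variable {T : Set (Vec N)}

theorem setIntegral_sub_left (hT : MeasurableSet T) (u : Vec N → Vec N) (x : Vec N) :
    ∫ y in T, u (x - y) = ∫ z in (fun z => x - z) ⁻¹' T, u z := by
  have hmp := (Measure.measurePreserving_sub_left (volume : Measure (Vec N)) x).restrict_preimage hT
  have hemb : MeasurableEmbedding (fun y : Vec N => x - y) :=
    (Homeomorph.subLeft x).measurableEmbedding
  rw [← hmp.integral_comp hemb]
  simp

/-- An averaged value is an inner product with a multiple of the indicator of `x - T`. Hence weak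
convergence in `L²` gives pointwise convergence of averages, and the norm of this function gives a
bound independent of `x`. -/
theorem inner_average (hT : MeasurableSet T) (hTf : volume T ≠ ⊤) (x e : Vec N) :
    ∃ η : LTwo N, ‖η‖ = (volume.real T)⁻¹ * (‖e‖ * volume.real T ^ (1 / 2 : ℝ)) ∧
      ∀ u : LTwo N, ⟪e, average T u x⟫_ℝ = ⟪η, u⟫_ℝ := by
  have hmp := Measure.measurePreserving_sub_left (volume : Measure (Vec N)) x
  have hs : MeasurableSet ((fun z => x - z) ⁻¹' T) := hmp.measurable hT
  have hv : volume ((fun z => x - z) ⁻¹' T) = volume T := hmp.measure_preimage hT.nullMeasurableSet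
  have hvf : volume ((fun z => x - z) ⁻¹' T) ≠ ⊤ := by rwa [hv]
  refine ⟨(volume.real T)⁻¹ • indicatorConstLp 2 hs hvf e, ?_, fun u => ?_⟩
  · rw [norm_smul, norm_indicatorConstLp (by norm_num) (by norm_num), Real.norm_of_nonneg
      (by positivity), measureReal_def volume (_ ⁻¹' T), hv]
    simp [measureReal_def]
  · rw [average, setIntegral_sub_left hT, inner_smul_right, inner_smul_left,
      L2.inner_indicatorConstLp_eq_inner_setIntegral]
    simp

theorem norm_average_le (hT : MeasurableSet T) (hTf : volume T ≠ ⊤) (u : LTwo N) (x : Vec N) :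
    ‖average T u x‖ ≤ (volume.real T)⁻¹ * volume.real T ^ (1 / 2 : ℝ) * ‖u‖ := by
  obtain ⟨η, hη, h⟩ := inner_average hT hTf x (average T u x)
  have h1 := h u
  rw [real_inner_self_eq_norm_sq] at h1
  have h2 := real_inner_le_norm η u
  rw [← h1, hη] at h2
  rcases (norm_nonneg (average T u x)).eq_or_lt with h0 | h0
  · rw [← h0]; positivity
  · refine le_of_mul_le_mul_left ?_ h0
    calc _ = ‖average T u x‖ ^ 2 := by ring
      _ ≤ _ := h2.trans (le_of_eq (by ring))

theorem tendsto_average (hT : MeasurableSet T) (hTf : volume T ≠ ⊤) {u : ℕ → LTwo N}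
    {v : LTwo N} (h : ∀ η, Tendsto (fun k => ⟪η, u k⟫_ℝ) atTop (𝓝 ⟪η, v⟫_ℝ)) (x : Vec N) :
    Tendsto (fun k => average T (u k) x) atTop (𝓝 (average T v x)) := by
  have h1 : ∀ i, Tendsto (fun k => average T (u k) x i) atTop (𝓝 (average T v x i)) := fun i => by
    obtain ⟨η, -, hη⟩ := inner_average hT hTf x (EuclideanSpace.single i (1 : ℝ))
    have h2 := h η
    simp only [← hη] at h2
    simpa [EuclideanSpace.inner_single_left] using h2
  have h2 : Tendsto (fun k => (EuclideanSpace.equiv (Fin N) ℝ) (average T (u k) x)) atTop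
      (𝓝 ((EuclideanSpace.equiv (Fin N) ℝ) (average T v x))) := tendsto_pi_nhds.2 h1
  exact ((EuclideanSpace.equiv (Fin N) ℝ).symm.continuous.tendsto _).comp h2

theorem stronglyMeasurable_average (u : LTwo N) : StronglyMeasurable (average T u) := by
  have h1 : StronglyMeasurable fun z : Vec N × Vec N => u (z.1 - z.2) :=
    (Lp.stronglyMeasurable u).comp_measurable (by fun_prop)
  exact (h1.integral_prod_right' (ν := volume.restrict T)).const_smul ((volume.real T)⁻¹)

end Averages

section Compactness

variable {N : ℕ} {δ κ p α : ℝ} {f : Vec N → Vec N → Vec N} {Φ : Vec N → Vec N → ℝ}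
  {g : Vec N → ℝ} {S : ℕ → Set (Vec N)} {F : ℕ → Vec N → Vec N → Vec N}
  {φ : ℕ → Vec N → Vec N → ℝ} {m : Measure (Vec N)} [IsFiniteMeasure m]

omit [IsFiniteMeasure m] in
theorem memLp_of_le_volume (hm : m ≤ volume) (u : LTwo N) : MemLp u 2 m :=
  (Lp.memLp u).mono_measure hm

theorem integrable_of_le_volume (hm : m ≤ volume) (u : LTwo N) : Integrable u m :=
  (memLp_of_le_volume hm u).integrable (by norm_num)

theorem integrable_average {T : Set (Vec N)} (hT : MeasurableSet T) (hTf : volume T ≠ ⊤)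
    (u : LTwo N) : Integrable (average T u) m :=
  Integrable.of_bound (stronglyMeasurable_average u).aestronglyMeasurable _
    (Eventually.of_forall fun x => norm_average_le hT hTf u x)

/-- The oscillation of `u` at the bonds in `T` is controlled by its energy. -/
theorem IsRegularization.integral_sub_average_le (h : IsRegularization δ κ p α f Φ g S F φ)
    (hκ : 0 < κ) (hs : 0 ≤ (N : ℝ) + α * p) (hm : m ≤ volume) {n : ℕ} {T : Set (Vec N)} {ε l : ℝ}
    (hT : MeasurableSet T) (hTS : T ⊆ S n) (hTε : T ⊆ ball 0 ε) (hεδ : ε ≤ δ)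
    (hT0 : 0 < volume.real T) (hl : 0 < l) (hln : l ≤ n) (u : LTwo N) :
    ∫ x, ‖u x - average T u x‖ ∂m ≤ l * m.real univ +
      ε ^ ((N : ℝ) + α * p) / (κ * l ^ (p - 1) * volume.real T) *
        ∫ z, φ n z.2 (u z.1 - u (z.1 - z.2)) ∂(pairMeasure N δ) := by
  set s := (N : ℝ) + α * p with hsdef
  have hTδ : T ⊆ ball 0 δ := hTε.trans (ball_subset_ball hεδ)
  have hρ : m.prod (volume.restrict T) ≤ pairMeasure N δ :=
    Measure.prod_mono hm (Measure.restrict_mono hTδ le_rfl)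
  have hTf : volume T ≠ ⊤ := ((measure_mono hTδ).trans_lt measure_ball_lt_top).ne
  have : IsFiniteMeasure ((volume : Measure (Vec N)).restrict T) := ⟨by simpa using hTf.lt_top⟩
  set ρ := m.prod ((volume : Measure (Vec N)).restrict T) with hρdef
  have hD : Integrable (fun z : Vec N × Vec N => u z.1 - u (z.1 - z.2)) ρ :=
    ((memLp_diff (Lp.memLp u)).mono_measure hρ).integrable (by norm_num)
  have hφ := h.integrable_potential n u
  -- averaging
  have h1 : ∫ x, ‖u x - average T u x‖ ∂m
      ≤ (volume.real T)⁻¹ * ∫ z, ‖u z.1 - u (z.1 - z.2)‖ ∂ρ := by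
    rw [integral_prod _ hD.norm, ← integral_const_mul]
    refine integral_mono_ae
      ((integrable_of_le_volume hm u).sub (integrable_average hT hTf u)).norm
      (hD.norm.integral_prod_left.const_mul _) ?_
    filter_upwards [hD.prod_right_ae] with x hx
    have hc : Integrable (fun _ : Vec N => u x) (volume.restrict T) := integrable_const _
    have hx2 : Integrable (fun y => u (x - y)) (volume.restrict T) := by
      refine (hc.sub hx).congr (Eventually.of_forall fun y => ?_)
      simp
    have e : u x - average T u x = (volume.real T)⁻¹ • ∫ y in T, (u x - u (x - y)) := by
      rw [integral_sub hc hx2, setIntegral_const, smul_sub, smul_smul, inv_mul_cancel₀ hT0.ne',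
        one_smul, average]
    rw [e, norm_smul, norm_inv, Real.norm_of_nonneg hT0.le]
    gcongr
    exact norm_integral_le_integral_norm _
  -- coercivity
  have h2 : ∫ z, ‖u z.1 - u (z.1 - z.2)‖ ∂ρ ≤ l * (m.real univ * volume.real T) +
      ε ^ s / (κ * l ^ (p - 1)) * ∫ z, φ n z.2 (u z.1 - u (z.1 - z.2)) ∂(pairMeasure N δ) := by
    have hφρ := hφ.mono_measure hρ
    have hmono : ∫ z, φ n z.2 (u z.1 - u (z.1 - z.2)) ∂ρ
        ≤ ∫ z, φ n z.2 (u z.1 - u (z.1 - z.2)) ∂(pairMeasure N δ) :=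
      integral_mono_measure hρ (Eventually.of_forall fun z => h.φ_nonneg n _ _) hφ
    have hb : ∀ᵐ z ∂ρ, ‖u z.1 - u (z.1 - z.2)‖
        ≤ l + ε ^ s / (κ * l ^ (p - 1)) * φ n z.2 (u z.1 - u (z.1 - z.2)) := by
      have hz : ∀ᵐ z ∂ρ, z.2 ∈ T :=
        Measure.quasiMeasurePreserving_snd.ae (ae_restrict_mem hT)
      filter_upwards [hz] with z hz
      have h3 := h.coercive l n z.2 (u z.1 - u (z.1 - z.2)) hl.le hln (hTS hz)
      have h4 : ‖z.2‖ ^ s ≤ ε ^ s :=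
        Real.rpow_le_rpow (norm_nonneg _) (mem_ball_zero_iff.1 (hTε hz)).le hs
      have h5 := h.φ_nonneg n z.2 (u z.1 - u (z.1 - z.2))
      have h6 : 0 < κ * l ^ (p - 1) := by positivity
      have h7 : ‖z.2‖ ^ s * φ n z.2 (u z.1 - u (z.1 - z.2))
          ≤ ε ^ s * φ n z.2 (u z.1 - u (z.1 - z.2)) := by gcongr
      rw [div_mul_eq_mul_div, ← sub_le_iff_le_add', le_div_iff₀ h6]
      rw [← hsdef] at h3
      linarith
    have hi : Integrable (fun z => l + ε ^ s / (κ * l ^ (p - 1)) *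
        φ n z.2 (u z.1 - u (z.1 - z.2))) ρ := (integrable_const l).add (hφρ.const_mul _)
    refine (integral_mono_ae hD.norm hi hb).trans ?_
    rw [integral_add (integrable_const l) (hφρ.const_mul _), integral_const, integral_const_mul]
    have h8 : ρ.real univ = m.real univ * volume.real T := by
      rw [hρdef, ← univ_prod_univ, measureReal_prod_prod]
      simp [measureReal_def]
    rw [h8, smul_eq_mul, mul_comm l]
    have hε0 : 0 ≤ ε := by
      by_contra hneg
      have : T = ∅ := by
        rw [ball_eq_empty.2 (not_le.1 hneg).le] at hTε
        exact subset_empty_iff.1 hTε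
      simp [this] at hT0
    gcongr
  refine h1.trans ((mul_le_mul_of_nonneg_left h2 (by positivity)).trans (le_of_eq ?_))
  field_simp

/-- Averages over small balls approximate, uniformly on states of bounded energy. -/
theorem IsRegularization.exists_average (h : IsRegularization δ κ p α f Φ g S F φ)
    (hδ : 0 < δ) (hκ : 0 < κ) (hαp : 0 < α * p) (hm : m ≤ volume) (M : ℝ) {τ : ℝ} (hτ : 0 < τ) :
    ∃ T : Set (Vec N), MeasurableSet T ∧ volume T ≠ ⊤ ∧ ∃ n₀, ∀ n ≥ n₀, ∀ u : LTwo N,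
      ∫ z, φ n z.2 (u z.1 - u (z.1 - z.2)) ∂(pairMeasure N δ) ≤ M →
        ∫ x, ‖u x - average T u x‖ ∂m ≤ τ := by
  -- Makes the first term `l m(ℝ^N)` of the oscillation estimate at most `τ / 2`.
  set l := τ / 2 / (m.real univ + 1) with hl
  have hl0 : 0 < l := by positivity
  set b := volume.real (ball (0 : Vec N) 1) with hb
  have hb0 : 0 < b := by
    rw [hb, measureReal_def]
    exact ENNReal.toReal_pos (measure_ball_pos _ _ one_pos).ne' measure_ball_lt_top.ne
  -- The bonds used below fill at least the volume `ε ^ N b / 2`. Dividing `ε ^ (N + α p)` by it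
  -- leaves `c ε ^ (α p)`, which is small with `ε` because `α p > 0`.
  set c := 2 * |M| / (κ * l ^ (p - 1) * b) with hc
  have hc0 : 0 ≤ c := by positivity
  -- the radius
  obtain ⟨ε, hε0, hεδ, hε⟩ : ∃ ε, 0 < ε ∧ ε ≤ δ ∧ c * ε ^ (α * p) ≤ τ / 2 := by
    have h1 : Tendsto (fun ε : ℝ => c * ε ^ (α * p)) (𝓝 0) (𝓝 0) := by
      have : Continuous fun ε : ℝ => c * ε ^ (α * p) :=
        continuous_const.mul (continuous_id.rpow_const fun _ => Or.inr hαp.le)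
      simpa [Real.zero_rpow hαp.ne'] using this.tendsto 0
    have h2 : ∀ᶠ ε in 𝓝[>] (0 : ℝ), c * ε ^ (α * p) ≤ τ / 2 :=
      (h1.mono_left nhdsWithin_le_nhds).eventually (eventually_le_nhds (by positivity))
    have h3 : ∀ᶠ ε in 𝓝[>] (0 : ℝ), ε ≤ δ :=
      nhdsWithin_le_nhds (eventually_le_nhds hδ)
    obtain ⟨ε, h4, h5, h6⟩ := (h2.and (h3.and self_mem_nhdsWithin)).exists
    exact ⟨ε, h6, h5, h4⟩
  have hvol : volume.real (ball (0 : Vec N) ε) = ε ^ N * b := by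
    rw [hb, measureReal_def, Measure.addHaar_ball_of_pos volume 0 hε0, ENNReal.toReal_mul,
      ENNReal.toReal_ofReal (by positivity)]
    simp [measureReal_def]
  -- good bonds fill half of the ball
  obtain ⟨n₁, hn₁⟩ : ∃ n₁, volume.real (ball (0 : Vec N) ε) / 2
      ≤ volume.real (S n₁ ∩ ball 0 ε) := by
    have h1 : Tendsto (fun n => volume (S n ∩ ball (0 : Vec N) ε)) atTop
        (𝓝 (volume (⋃ n, S n ∩ ball (0 : Vec N) ε))) :=
      tendsto_measure_iUnion_atTop fun i j hij => inter_subset_inter_left _ (h.S_mono hij)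
    have h2 : volume (⋃ n, S n ∩ ball (0 : Vec N) ε) = volume (ball (0 : Vec N) ε) := by
      refine measure_congr ?_
      have h3 := (ae_restrict_iff' measurableSet_ball).1 h.S_ae
      filter_upwards [h3] with y hy
      refine propext ⟨fun hy' => ?_, fun hy' => ?_⟩
      · obtain ⟨n, hn⟩ := mem_iUnion.1 hy'
        exact hn.2
      · obtain ⟨n, hn⟩ := hy (ball_subset_ball hεδ hy')
        exact mem_iUnion.2 ⟨n, hn, hy'⟩
    rw [h2] at h1
    have h4 := (ENNReal.tendsto_toReal measure_ball_lt_top.ne).comp h1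
    have h5 : volume.real (ball (0 : Vec N) ε) / 2 < (volume (ball (0 : Vec N) ε)).toReal := by
      have : 0 < volume.real (ball (0 : Vec N) ε) := by rw [hvol]; positivity
      rw [← measureReal_def]; linarith
    obtain ⟨n, hn⟩ := (h4.eventually (eventually_ge_nhds h5)).exists
    exact ⟨n, hn⟩
  rw [hvol] at hn₁
  set T := S n₁ ∩ ball (0 : Vec N) ε with hT
  have hTm : MeasurableSet T := (h.S_meas _).inter measurableSet_ball
  have hTf : volume T ≠ ⊤ := ((measure_mono inter_subset_right).trans_lt measure_ball_lt_top).ne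
  have hT0 : 0 < volume.real T := lt_of_lt_of_le (by positivity) hn₁
  obtain ⟨n₂, hn₂⟩ := exists_nat_ge l
  -- From `n₁` on, all bonds in `T` are resolved; from `n₂` on, the truncation level is at least
  -- `l`.
  refine ⟨T, hTm, hTf, max n₁ n₂, fun n hn u hu => ?_⟩
  have hln : l ≤ n := hn₂.trans (by exact_mod_cast (le_max_right _ _).trans hn)
  have hTS : T ⊆ S n := inter_subset_left.trans (h.S_mono ((le_max_left _ _).trans hn))
  refine (h.integral_sub_average_le hκ (by positivity) hm hTm hTS inter_subset_right hεδ hT0 hl0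
    hln u).trans ?_
  have h1 : l * m.real univ ≤ τ / 2 := by
    rw [hl, div_mul_eq_mul_div, div_le_iff₀ (by positivity)]
    nlinarith [measureReal_nonneg (μ := m) (s := univ)]
  have h2 : ε ^ ((N : ℝ) + α * p) / (κ * l ^ (p - 1) * volume.real T) *
      ∫ z, φ n z.2 (u z.1 - u (z.1 - z.2)) ∂(pairMeasure N δ) ≤ c * ε ^ (α * p) := by
    calc _ ≤ ε ^ ((N : ℝ) + α * p) / (κ * l ^ (p - 1) * (ε ^ N * b / 2)) * |M| := by
          gcongr
          · exact integral_nonneg fun z => h.φ_nonneg n _ _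
          · exact hu.trans (le_abs_self M)
      _ = c * ε ^ (α * p) := by
          rw [Real.rpow_add hε0, Real.rpow_natCast, hc]
          field_simp
  linarith

/-- The finite measure with density `(1 + |x|) ^ -(N + 1)`. -/
noncomputable def tameMeasure (N : ℕ) : Measure (Vec N) :=
  volume.withDensity fun x => ENNReal.ofReal ((1 + ‖x‖) ^ (-((N : ℝ) + 1)))

theorem tame_integrable : Integrable fun x : Vec N => (1 + ‖x‖) ^ (-((N : ℝ) + 1)) :=
  integrable_one_add_norm (by simp)

theorem tame_pos (x : Vec N) : 0 < (1 + ‖x‖) ^ (-((N : ℝ) + 1)) := by positivity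

theorem tame_le_one (x : Vec N) : (1 + ‖x‖) ^ (-((N : ℝ) + 1)) ≤ 1 :=
  Real.rpow_le_one_of_one_le_of_nonpos (by linarith [norm_nonneg x])
    (by have : (0 : ℝ) ≤ N := N.cast_nonneg
        linarith)

instance : IsFiniteMeasure (tameMeasure N) :=
  isFiniteMeasure_withDensity_ofReal tame_integrable.2

theorem tameMeasure_le : tameMeasure N ≤ volume := by
  conv_rhs => rw [← withDensity_one (μ := (volume : Measure (Vec N)))]
  exact withDensity_mono (Eventually.of_forall fun x => by
    simpa using tame_le_one x)

/-- The finite measure lies below Lebesgue measure, so that `L²` functions are integrable for it,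
and has no further null sets, so that almost everywhere convergence carries back. -/
theorem volume_ac_tameMeasure : (volume : Measure (Vec N)) ≪ tameMeasure N :=
  withDensity_absolutelyContinuous' (by fun_prop) (Eventually.of_forall fun x => by
    simpa using tame_pos x)

/-- Pairing with a bounded function with respect to the finite measure is weakly continuous. -/
theorem tendsto_integral_inner_tame {u : ℕ → LTwo N} {v : LTwo N}
    (h : ∀ η, Tendsto (fun k => ⟪η, u k⟫_ℝ) atTop (𝓝 ⟪η, v⟫_ℝ)) {σ : Vec N → Vec N}
    (hσ : StronglyMeasurable σ) (hσ1 : ∀ x, ‖σ x‖ ≤ 1) :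
    Tendsto (fun k => ∫ x, ⟪σ x, u k x⟫_ℝ ∂(tameMeasure N)) atTop
      (𝓝 (∫ x, ⟪σ x, v x⟫_ℝ ∂(tameMeasure N))) := by
  set ρ : Vec N → ℝ := fun x => (1 + ‖x‖) ^ (-((N : ℝ) + 1)) with hρ
  have hρm : Measurable ρ := by rw [hρ]; fun_prop
  have hmem : MemLp (fun x => ρ x • σ x) 2 volume := by
    have hm : AEStronglyMeasurable (fun x => ρ x • σ x) volume :=
      (hρm.stronglyMeasurable.smul hσ).aestronglyMeasurable
    rw [memLp_two_iff_integrable_sq_norm hm]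
    refine tame_integrable.mono' (hm.norm.pow 2) (Eventually.of_forall fun x => ?_)
    have h1 : ‖ρ x • σ x‖ ≤ ρ x := by
      rw [norm_smul, Real.norm_of_nonneg (tame_pos x).le]
      exact mul_le_of_le_one_right (tame_pos x).le (hσ1 x)
    rw [Real.norm_of_nonneg (by positivity)]
    calc ‖ρ x • σ x‖ ^ 2 ≤ ρ x ^ 2 := by gcongr
      _ ≤ ρ x := by
        have := tame_le_one x
        have := tame_pos x
        simp only [hρ] at *
        nlinarith
  have hpair : ∀ w : LTwo N, ∫ x, ⟪σ x, w x⟫_ℝ ∂(tameMeasure N) = ⟪hmem.toLp _, w⟫_ℝ := fun w => by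
    rw [tameMeasure, integral_withDensity_eq_integral_toReal_smul (by fun_prop)
      (Eventually.of_forall fun x => ENNReal.ofReal_lt_top), L2.inner_def]
    refine integral_congr_ae ?_
    filter_upwards [hmem.coeFn_toLp] with x hx
    rw [hx, inner_smul_left, ENNReal.toReal_ofReal (tame_pos x).le]
    simp [hρ]
  simp only [hpair]
  exact h _

/-- States of bounded energy that converge weakly converge almost everywhere along a
subsequence. -/
theorem IsRegularization.exists_subseq_ae (h : IsRegularization δ κ p α f Φ g S F φ)
    (hδ : 0 < δ) (hκ : 0 < κ) (hαp : 0 < α * p) {ns : ℕ → ℕ} (hns : Tendsto ns atTop atTop)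
    {u : ℕ → LTwo N} {v : LTwo N} {M C : ℝ} (hC : ∀ k, ‖u k‖ ≤ C)
    (hM : ∀ k, ∫ z, φ (ns k) z.2 (u k z.1 - u k (z.1 - z.2)) ∂(pairMeasure N δ) ≤ M)
    (hv : ∀ η, Tendsto (fun k => ⟪η, u k⟫_ℝ) atTop (𝓝 ⟪η, v⟫_ℝ)) :
    ∃ js : ℕ → ℕ, StrictMono js ∧ ∀ᵐ x, Tendsto (fun k => u (js k) x) atTop (𝓝 (v x)) := by
  set m := tameMeasure N with hmdef
  have hm : m ≤ volume := tameMeasure_le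
  have hint : ∀ w : LTwo N, Integrable w m := integrable_of_le_volume hm
  -- Split `u k - v` into the oscillation of `u k`, the difference of the averages, and the
  -- oscillation of `v`.
  have hL1 : Tendsto (fun k => ∫ x, ‖u k x - v x‖ ∂m) atTop (𝓝 0) := by
    rw [tendsto_order]
    refine ⟨fun a ha => Eventually.of_forall fun k =>
      ha.trans_le (integral_nonneg fun x => norm_nonneg _), fun a ha => ?_⟩
    obtain ⟨T, hT, hTf, n₀, hn₀⟩ := h.exists_average hδ hκ hαp hm M (show 0 < a / 4 by positivity)
    have hosc : ∀ᶠ k in atTop, ∫ x, ‖u k x - average T (u k) x‖ ∂m ≤ a / 4 := by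
      filter_upwards [hns.eventually_ge_atTop n₀] with k hk
      exact hn₀ (ns k) hk (u k) (hM k)
    have hA : ∀ w : LTwo N, Integrable (average T w) m := integrable_average hT hTf
    set B := (volume.real T)⁻¹ * volume.real T ^ (1 / 2 : ℝ) * C with hB
    have hAB : ∀ k x, ‖average T (u k) x‖ ≤ B := fun k x =>
      (norm_average_le hT hTf (u k) x).trans (by rw [hB]; gcongr; exact hC k)
    have havg : Tendsto (fun k => ∫ x, ‖average T (u k) x - average T v x‖ ∂m) atTop (𝓝 0) := by
      have h1 : ∀ x, Tendsto (fun k => ‖average T (u k) x - average T v x‖) atTop (𝓝 0) :=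
        fun x => tendsto_iff_norm_sub_tendsto_zero.1 (tendsto_average hT hTf hv x)
      have h2 := tendsto_integral_of_dominated_convergence (μ := m)
        (F := fun k x => ‖average T (u k) x - average T v x‖) (f := fun _ => 0)
        (fun x => B + ‖average T v x‖)
        (fun k => ((hA _).sub (hA _)).norm.1) ((integrable_const B).add (hA v).norm)
        (fun k => Eventually.of_forall fun x => by
          rw [norm_norm]
          exact (norm_sub_le _ _).trans (by gcongr; exact hAB k x))
        (Eventually.of_forall h1)
      simpa using h2
    -- No energy bound for `v` is at hand. Its oscillation is controlled by weak lower
    -- semicontinuity of the `L¹` norm, testing with the direction field `σ = V / ‖V‖`.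
    have hlim : ∫ x, ‖v x - average T v x‖ ∂m ≤ a / 4 := by
      set V : Vec N → Vec N := fun x => v x - average T v x with hV
      have hVm : StronglyMeasurable V := (Lp.stronglyMeasurable v).sub (stronglyMeasurable_average v)
      set σ : Vec N → Vec N := fun x => ‖V x‖⁻¹ • V x with hσ
      have hσm : StronglyMeasurable σ := hVm.norm.measurable.inv.stronglyMeasurable.smul hVm
      have hσ1 : ∀ x, ‖σ x‖ ≤ 1 := fun x => by
        rw [hσ, norm_smul, norm_inv, norm_norm]
        exact inv_mul_le_one
      have hσV : ∀ x, ⟪σ x, V x⟫_ℝ = ‖V x‖ := fun x => by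
        rw [hσ, inner_smul_left, real_inner_self_eq_norm_sq]
        rcases eq_or_ne ‖V x‖ 0 with h0 | h0
        · simp [h0]
        · simp; field_simp
      have hσi : ∀ w : Vec N → Vec N, Integrable w m → Integrable (fun x => ⟪σ x, w x⟫_ℝ) m :=
        fun w hw => hw.norm.mono' (hσm.aestronglyMeasurable.inner hw.1)
          (Eventually.of_forall fun x => (norm_inner_le_norm _ _).trans
            (mul_le_of_le_one_left (norm_nonneg _) (hσ1 x)))
      have h1 := tendsto_integral_inner_tame hv hσm hσ1
      have h2 : Tendsto (fun k => ∫ x, ⟪σ x, average T (u k) x⟫_ℝ ∂m) atTop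
          (𝓝 (∫ x, ⟪σ x, average T v x⟫_ℝ ∂m)) := by
        refine tendsto_integral_of_dominated_convergence (fun _ => B)
          (fun k => (hσi _ (hA _)).1) (integrable_const B)
          (fun k => Eventually.of_forall fun x => ?_) (Eventually.of_forall fun x => ?_)
        · refine (norm_inner_le_norm _ _).trans ?_
          exact (mul_le_of_le_one_left (norm_nonneg _) (hσ1 x)).trans (hAB k x)
        · exact tendsto_const_nhds.inner (tendsto_average hT hTf hv x)
      have h3 := h1.sub h2
      have h4 : ∀ w : LTwo N, ∫ x, ⟪σ x, w x⟫_ℝ ∂m - ∫ x, ⟪σ x, average T w x⟫_ℝ ∂m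
          = ∫ x, ⟪σ x, w x - average T w x⟫_ℝ ∂m := fun w => by
        rw [← integral_sub (hσi _ (hint w)) (hσi _ (hA w))]
        simp only [inner_sub_right]
      rw [← hmdef] at h3
      simp only [h4] at h3
      have h5 : ∫ x, ⟪σ x, v x - average T v x⟫_ℝ ∂m = ∫ x, ‖V x‖ ∂m :=
        integral_congr_ae (Eventually.of_forall hσV)
      rw [h5] at h3
      refine le_of_tendsto h3 ?_
      filter_upwards [hosc] with k hk
      refine le_trans (integral_mono (hσi _ ((hint _).sub (hA _)))
        ((hint _).sub (hA _)).norm fun x => ?_) hk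
      exact (real_inner_le_norm _ _).trans (mul_le_of_le_one_left (norm_nonneg _) (hσ1 x))
    filter_upwards [hosc, havg.eventually (eventually_lt_nhds (show 0 < a / 4 by positivity))]
      with k hk1 hk2
    have i1 : Integrable (fun x => ‖u k x - average T (u k) x‖) m := ((hint _).sub (hA _)).norm
    have i2 : Integrable (fun x => ‖average T (u k) x - average T v x‖) m :=
      ((hA _).sub (hA _)).norm
    have i3 : Integrable (fun x => ‖v x - average T v x‖) m := ((hint _).sub (hA _)).norm
    have h1 : ∫ x, ‖u k x - v x‖ ∂m ≤ ∫ x, (‖u k x - average T (u k) x‖ +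
        ‖average T (u k) x - average T v x‖ + ‖v x - average T v x‖) ∂m := by
      refine integral_mono ((hint _).sub (hint _)).norm ((i1.add i2).add i3) fun x => ?_
      have e : u k x - v x = (u k x - average T (u k) x) +
          (average T (u k) x - average T v x) - (v x - average T v x) := by abel
      simp only
      rw [e]
      exact (norm_sub_le _ _).trans (add_le_add (norm_add_le _ _) le_rfl)
    rw [integral_add (i1.fun_add i2) i3, integral_add i1 i2] at h1
    linarith
  have hmeas : TendstoInMeasure m (fun k => (u k : Vec N → Vec N)) atTop v := by
    refine tendstoInMeasure_of_tendsto_eLpNorm (p := 1) one_ne_zero (fun k => (hint _).1)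
      (hint v).1 ?_
    have h1 : ∀ k, eLpNorm ((u k : Vec N → Vec N) - (v : Vec N → Vec N)) 1 m
        = ENNReal.ofReal (∫ x, ‖u k x - v x‖ ∂m) := fun k => by
      rw [eLpNorm_one_eq_lintegral_enorm]
      exact (ofReal_integral_norm_eq_lintegral_enorm ((hint (u k)).sub (hint v))).symm
    simp only [h1]
    have h2 := (ENNReal.continuous_ofReal.tendsto 0).comp hL1
    rw [ENNReal.ofReal_zero] at h2
    exact h2
  obtain ⟨js, hjs, hae⟩ := hmeas.exists_seq_tendsto_ae
  exact ⟨js, hjs, volume_ac_tameMeasure.ae_le hae⟩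

end Compactness

/-! ### Passage to the limit in the force and in the energy -/

/-- Convergence of integrals of functions that are dominated up to a small multiple of functions
bounded in `L¹`. -/
theorem tendsto_integral_of_almost_dominated {Z : Type*} [MeasurableSpace Z] {μ : Measure Z}
    {G : ℕ → Z → ℝ} {G' : Z → ℝ} {q : ℕ → Z → ℝ} {M : ℝ}
    (hGm : ∀ n, AEStronglyMeasurable (G n) μ)
    (hlim : ∀ᵐ z ∂μ, Tendsto (fun n => G n z) atTop (𝓝 (G' z)))
    (hq : ∀ n, Integrable (q n) μ) (hq0 : ∀ n z, 0 ≤ q n z) (hqM : ∀ n, ∫ z, q n z ∂μ ≤ M)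
    (hdom : ∀ ε > 0, ∃ b : Z → ℝ, Integrable b μ ∧ ∀ n, ∀ᵐ z ∂μ, |G n z| ≤ ε * q n z + b z) :
    Integrable G' μ ∧ Tendsto (fun n => ∫ z, G n z ∂μ) atTop (𝓝 (∫ z, G' z ∂μ)) := by
  have hGi : ∀ n, Integrable (G n) μ := fun n => by
    obtain ⟨b, hb, hGb⟩ := hdom 1 one_pos
    exact (((hq n).const_mul 1).add hb).mono' (hGm n) (hGb n)
  have hG' : Integrable G' μ := by
    refine ⟨aestronglyMeasurable_of_tendsto_ae atTop hGm hlim, ?_⟩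
    -- Fatou's lemma, with the domination for `ε = 1`, bounds the integral of `|G'|` by `M + ∫ b`.
    obtain ⟨b, hb, hGb⟩ := hdom 1 one_pos
    have h1 : ∫⁻ z, ‖G' z‖ₑ ∂μ ≤ liminf (fun n => ∫⁻ z, ‖G n z‖ₑ ∂μ) atTop := by
      have h2 := lintegral_liminf_le' (u := atTop) fun n => (hGm n).enorm
      refine le_trans (le_of_eq (lintegral_congr_ae ?_)) h2
      filter_upwards [hlim] with z hz
      exact hz.enorm.liminf_eq.symm
    refine h1.trans_lt (lt_of_le_of_lt ?_ (ENNReal.ofReal_lt_top (r := M + ∫ z, b z ∂μ)))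
    refine liminf_le_of_le (by isBoundedDefault) fun c hc => ?_
    obtain ⟨n, hn⟩ := hc.exists
    refine hn.trans ?_
    rw [← ofReal_integral_norm_eq_lintegral_enorm (hGi n)]
    refine ENNReal.ofReal_le_ofReal ?_
    refine (integral_mono_ae (hGi n).norm ((hq n).add hb) ?_).trans ?_
    · filter_upwards [hGb n] with z hz
      simpa using hz
    · have := integral_add (hq n) hb
      simp only [Pi.add_apply] at this ⊢
      rw [this]
      linarith [hqM n]
  refine ⟨hG', ?_⟩
  rw [Metric.tendsto_atTop]
  intro η hη
  set ε := η / 2 / (|M| + 1) with hε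
  have hε0 : 0 < ε := by positivity
  obtain ⟨b, hb, hGb⟩ := hdom ε hε0
  -- The excess of `|G n - G'|` over `ε q n` tends to zero pointwise and is dominated by `|b| +
  -- |G'|`. The part below `ε q n` integrates to at most `η / 2`.
  set r : ℕ → Z → ℝ := fun n z => max (|G n z - G' z| - ε * q n z) 0 with hr
  have hrm : ∀ n, AEStronglyMeasurable (r n) μ := fun n =>
    ((((hGi n).sub hG').abs.sub ((hq n).const_mul ε)).pos_part).1
  have hrlim : Tendsto (fun n => ∫ z, r n z ∂μ) atTop (𝓝 0) := by
    have h1 := tendsto_integral_of_dominated_convergence (F := r) (f := fun _ => 0)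
      (fun z => |b z| + |G' z|) hrm (hb.abs.add hG'.abs) (fun n => ?_) ?_
    · simpa using h1
    · filter_upwards [hGb n] with z hz
      rw [Real.norm_of_nonneg (le_max_right _ _)]
      refine max_le ?_ (by positivity)
      linarith [abs_sub (G n z) (G' z), le_abs_self (b z)]
    · filter_upwards [hlim] with z hz
      refine squeeze_zero (fun n => le_max_right _ _) (fun n => ?_)
        (tendsto_iff_norm_sub_tendsto_zero.1 hz)
      rw [Real.norm_eq_abs]
      exact max_le (by linarith [mul_nonneg hε0.le (hq0 n z)]) (abs_nonneg _)
  obtain ⟨n₀, hn₀⟩ := (hrlim.eventually (eventually_lt_nhds (show 0 < η / 2 by positivity))).exists_forall_of_atTop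
  refine ⟨n₀, fun n hn => ?_⟩
  rw [Real.dist_eq, ← integral_sub (hGi n) hG']
  have hri : Integrable (r n) μ := (((hGi n).sub hG').abs.sub ((hq n).const_mul ε)).pos_part
  have h1 : |∫ z, (G n z - G' z) ∂μ| ≤ ∫ z, (r n z + ε * q n z) ∂μ := by
    refine (abs_integral_le_integral_abs).trans
      (integral_mono ((hGi n).sub hG').abs (hri.add ((hq n).const_mul ε)) fun z => ?_)
    have := le_max_left (|G n z - G' z| - ε * q n z) 0
    simp only [hr]
    linarith
  rw [integral_add hri ((hq n).const_mul ε), integral_const_mul] at h1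
  have h2 : ε * ∫ z, q n z ∂μ ≤ η / 2 := by
    calc ε * ∫ z, q n z ∂μ ≤ ε * (|M| + 1) := by
          gcongr
          linarith [hqM n, le_abs_self M]
      _ = η / 2 := by rw [hε]; field_simp
  linarith [hn₀ n hn]

/-! ### Lipschitz functions of bounded support. -/

section Bump

variable {N : ℕ} {δ : ℝ}

/-- Lipschitz functions supported in a ball. -/
structure IsBump (M : ℝ≥0) (R : ℝ) (η : Vec N → Vec N) : Prop where
  lip : LipschitzWith M η
  supp : ∀ x, R ≤ ‖x‖ → η x = 0

/-- A bond is shorter than `δ`, so outside the ball of radius `R + δ` both of its ends lie where `η`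
vanishes. -/
theorem IsBump.norm_diff_le {M : ℝ≥0} {R : ℝ} {η : Vec N → Vec N} (hη : IsBump M R η)
    (x : Vec N) {y : Vec N} (hy : y ∈ ball (0 : Vec N) δ) :
    ‖η x - η (x - y)‖ ≤ (ball (0 : Vec N) (R + δ)).indicator 1 x * (M * ‖y‖) := by
  have hy' : ‖y‖ < δ := by simpa using hy
  by_cases hx : x ∈ ball (0 : Vec N) (R + δ)
  · rw [indicator_of_mem hx, Pi.one_apply, one_mul]
    simpa [dist_eq_norm] using hη.lip.dist_le_mul x (x - y)
  · have hx' : R + δ ≤ ‖x‖ := by simpa using hx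
    have h1 : ‖x‖ ≤ ‖x - y‖ + ‖y‖ := by simpa using norm_add_le (x - y) y
    rw [hη.supp x (by linarith [norm_nonneg y]), hη.supp (x - y) (by linarith)]
    simp [hx]

theorem IsBump.continuous {M : ℝ≥0} {R : ℝ} {η : Vec N → Vec N} (hη : IsBump M R η) :
    Continuous η := hη.lip.continuous

theorem IsBump.hasCompactSupport {M : ℝ≥0} {R : ℝ} {η : Vec N → Vec N} (hη : IsBump M R η) :
    HasCompactSupport η :=
  HasCompactSupport.of_support_subset_isCompact (isCompact_closedBall (0 : Vec N) R) fun x hx => by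
    by_contra h
    exact hx (hη.supp x (by simpa using (not_le.1 (by simpa using h)).le))

theorem IsBump.memLp {M : ℝ≥0} {R : ℝ} {η : Vec N → Vec N} (hη : IsBump M R η) :
    MemLp η 2 volume :=
  hη.continuous.memLp_of_hasCompactSupport hη.hasCompactSupport

end Bump

/-! ### Convergence of the energetic form, lower semicontinuity of the energy. -/

section Limit

variable {N : ℕ} {δ κ p α : ℝ} {f : Vec N → Vec N → Vec N} {Φ Ψ : Vec N → Vec N → ℝ}
  {g : Vec N → ℝ} {S : ℕ → Set (Vec N)} {F : ℕ → Vec N → Vec N → Vec N}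
  {φ : ℕ → Vec N → Vec N → ℝ}

/-- In polar coordinates the integrand is `r ^ (p (1 - α) - 1)`, integrable at the origin because `α
< 1`. -/
theorem integrableOn_rpow_mul_kernel (hN : 1 ≤ N) (hp : 0 < p) (hα : α < 1) :
    IntegrableOn (fun y : Vec N => ‖y‖ ^ p * kernel N p α y) (ball 0 δ) := by
  have : Nonempty (Fin N) := ⟨⟨0, hN⟩⟩
  rcases le_or_gt δ 0 with hδ | hδ
  · rw [ball_eq_empty.2 hδ]; exact integrableOn_empty
  unfold kernel
  rw [integrableOn_fun_norm_addHaar volume (f := fun r : ℝ => r ^ p * (r ^ ((N : ℝ) + α * p))⁻¹)]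
  have h1 := (intervalIntegral.integrableOn_Ioo_rpow_iff (s := p * (1 - α) - 1) hδ).2
    (by nlinarith)
  refine h1.congr_fun (fun r hr => ?_) measurableSet_Ioo
  have hr0 : 0 < r := hr.1
  simp only [finrank_euclideanSpace, Fintype.card_fin, smul_eq_mul]
  rw [← Real.rpow_natCast, ← Real.rpow_neg hr0.le, ← Real.rpow_add hr0, ← Real.rpow_add hr0,
    Nat.cast_sub hN]
  congr 1
  push_cast
  ring

/-- A dominating function for the energetic form tested with bumps. -/
noncomputable def bumpBound (N : ℕ) (δ p α : ℝ) (g : Vec N → ℝ) (C M R : ℝ) (z : Vec N × Vec N) :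
    ℝ :=
  (ball (0 : Vec N) (R + δ)).indicator 1 z.1 *
    (C * M ^ p * (‖z.2‖ ^ p * kernel N p α z.2) + M * (‖z.2‖ * g z.2))

theorem integrable_bumpBound (hN : 1 ≤ N) (hp : 0 < p) (hα : α < 1)
    (hg : IntegrableOn g (ball 0 δ)) (C M R : ℝ) :
    Integrable (bumpBound N δ p α g C M R) (pairMeasure N δ) := by
  refine Integrable.mul_prod (f := (ball (0 : Vec N) (R + δ)).indicator 1)
    (g := fun y => C * M ^ p * (‖y‖ ^ p * kernel N p α y) + M * (‖y‖ * g y)) ?_ ?_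
  · exact (integrable_indicator_iff measurableSet_ball).2
      (integrableOn_const measure_ball_lt_top.ne)
  · refine ((integrableOn_rpow_mul_kernel hN hp hα).const_mul _).add (Integrable.const_mul ?_ _)
    refine Integrable.bdd_mul (c := δ) hg (by fun_prop) ?_
    filter_upwards [ae_restrict_mem measurableSet_ball] with y hy
    rw [norm_norm]
    simpa using (mem_ball_zero_iff.1 hy).le

theorem ae_bond_ne_zero (hN : 1 ≤ N) : ∀ᵐ z ∂(pairMeasure N δ), z.2 ≠ 0 := by
  have : Nonempty (Fin N) := ⟨⟨0, hN⟩⟩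
  have hne : ∀ᵐ y : Vec N, y ≠ 0 := by simp [ae_iff]
  exact Measure.quasiMeasurePreserving_snd.ae (ae_restrict_of_ae hne)

theorem ae_bond_mem_ball : ∀ᵐ z ∂(pairMeasure N δ), z.2 ∈ ball (0 : Vec N) δ :=
  Measure.quasiMeasurePreserving_snd.ae (ae_restrict_mem measurableSet_ball)

/-- Young's inequality for the energetic form. -/
theorem IsRegularization.exists_bumpBound (h : IsRegularization δ κ p α f Φ g S F φ)
    (hp : 0 < p) (hg0 : ∀ y, 0 ≤ g y) {ε : ℝ} (hε : 0 < ε) :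
    ∃ C, 0 ≤ C ∧ ∀ (M : ℝ≥0) (R : ℝ) (η : Vec N → Vec N), IsBump M R η →
      ∀ n (u : Vec N → Vec N) (z : Vec N × Vec N), z.2 ≠ 0 → z.2 ∈ ball (0 : Vec N) δ →
        |formIntegrand (F n) u η z|
          ≤ ε * φ n z.2 (u z.1 - u (z.1 - z.2)) + bumpBound N δ p α g C M R z := by
  obtain ⟨C, hC0, hC⟩ := h.young ε hε
  refine ⟨C, hC0, fun M R η hη n u z hz hzδ => (hC n z.2 _ _ hz).trans ?_⟩
  have h1 := hη.norm_diff_le z.1 hzδ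
  have hk := kernel_nonneg (p := p) (α := α) z.2
  have hgz := hg0 z.2
  refine add_le_add le_rfl ?_
  rw [bumpBound]
  by_cases hx : z.1 ∈ ball (0 : Vec N) (R + δ)
  · rw [indicator_of_mem hx, Pi.one_apply, one_mul] at h1 ⊢
    have h2 : ‖η z.1 - η (z.1 - z.2)‖ ^ p ≤ M ^ p * ‖z.2‖ ^ p := by
      rw [← Real.mul_rpow M.coe_nonneg (norm_nonneg _)]
      exact Real.rpow_le_rpow (norm_nonneg _) h1 hp.le
    calc _ ≤ C * (M ^ p * ‖z.2‖ ^ p * kernel N p α z.2) + g z.2 * (M * ‖z.2‖) := by gcongr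
      _ = _ := by ring
  · rw [indicator_of_notMem hx, zero_mul] at h1 ⊢
    have h2 : ‖η z.1 - η (z.1 - z.2)‖ = 0 := le_antisymm h1 (norm_nonneg _)
    rw [h2, Real.zero_rpow hp.ne']
    simp

/-- The regularized forces and potentials of an almost everywhere convergent sequence converge. -/
theorem IsRegularization.ae_tendsto (h : IsRegularization δ κ p α f Φ g S F φ) (hN : 1 ≤ N)
    (hf : IsHyperelastic κ p α f Φ Ψ) {ns : ℕ → ℕ} (hns : Tendsto ns atTop atTop)
    {u : ℕ → Vec N → Vec N} {v : Vec N → Vec N}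
    (huv : ∀ᵐ x, Tendsto (fun k => u k x) atTop (𝓝 (v x))) :
    ∀ᵐ z ∂(pairMeasure N δ),
      Tendsto (fun k => F (ns k) z.2 (u k z.1 - u k (z.1 - z.2))) atTop
        (𝓝 (f z.2 (v z.1 - v (z.1 - z.2)))) ∧
      Tendsto (fun k => φ (ns k) z.2 (u k z.1 - u k (z.1 - z.2))) atTop
        (𝓝 (Φ z.2 (v z.1 - v (z.1 - z.2)))) := by
  filter_upwards [ae_bond_ne_zero hN, ae_fst_sub huv,
    Measure.quasiMeasurePreserving_snd.ae h.eventually_eq] with z hz0 ⟨hz1, hz2⟩ hz3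
  have hD := hz1.sub hz2
  set V := v z.1 - v (z.1 - z.2) with hV
  -- The displacements converge to `V`, so eventually they have norm at most `‖V‖ + 1`, where the
  -- approximation is exact for large `n`.
  have hev : ∀ᶠ k in atTop,
      F (ns k) z.2 (u k z.1 - u k (z.1 - z.2)) = f z.2 (u k z.1 - u k (z.1 - z.2)) ∧
      φ (ns k) z.2 (u k z.1 - u k (z.1 - z.2)) = Φ z.2 (u k z.1 - u k (z.1 - z.2)) := by
    filter_upwards [hns.eventually (hz3 (‖V‖ + 1)),
      hD.norm.eventually (eventually_le_nhds (lt_add_one ‖V‖))] with k hk1 hk2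
    exact hk1 _ hk2
  have hfc := ((hf.differentiable_f hz0).continuous.tendsto V).comp hD
  have hΦc := ((hf.f_eq_gradient z.2 V hz0).differentiableAt.continuousAt.tendsto).comp hD
  exact ⟨hfc.congr' (hev.mono fun k hk => hk.1.symm), hΦc.congr' (hev.mono fun k hk => hk.2.symm)⟩

/-- The values of `f` and `Φ` at `y = 0` are arbitrary, so measurability holds only after a change
on the null set of degenerate bonds. -/
theorem aestronglyMeasurable_comp_bond {X E : Type*} [MeasurableSpace X] {μ : Measure X}
    [NormedAddCommGroup E] [MeasurableSpace E] [BorelSpace E] [SecondCountableTopology E]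
    {G : Vec N × Vec N → E} (hG : ContinuousOn G (forceDomain N)) {k : X → Vec N × Vec N}
    (hk : AEMeasurable k μ) (hk0 : ∀ᵐ x ∂μ, (k x).1 ≠ 0) :
    AEStronglyMeasurable (fun x => G (k x)) μ := by
  classical
  have h1 := hG.measurable_piecewise (g := fun _ => 0) continuousOn_const
    isOpen_forceDomain.measurableSet
  refine (h1.comp_aemeasurable hk).aestronglyMeasurable.congr ?_
  filter_upwards [hk0] with x hx
  have : k x ∈ forceDomain N := ⟨hx, trivial⟩
  simp [piecewise, this]

theorem aemeasurable_bond_diff {u : Vec N → Vec N} (hu : AEStronglyMeasurable u volume) :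
    AEMeasurable (fun z : Vec N × Vec N => (z.2, u z.1 - u (z.1 - z.2))) (pairMeasure N δ) :=
  measurable_snd.aemeasurable.prodMk
    ((hu.aemeasurable.comp_quasiMeasurePreserving Measure.quasiMeasurePreserving_fst).sub
      (hu.aemeasurable.comp_quasiMeasurePreserving quasiMeasurePreserving_sub))

theorem IsHyperelastic.aemeasurable_Φ (hf : IsHyperelastic κ p α f Φ Ψ) (hN : 1 ≤ N)
    {u : Vec N → Vec N} (hu : AEStronglyMeasurable u volume) :
    AEMeasurable (fun z : Vec N × Vec N => Φ z.2 (u z.1 - u (z.1 - z.2))) (pairMeasure N δ) :=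
  (aestronglyMeasurable_comp_bond (G := fun z => Φ z.1 z.2) hf.Φ_contDiff.continuousOn
    (aemeasurable_bond_diff hu) (ae_bond_ne_zero hN)).aemeasurable

theorem IsHyperelastic.lintegral_Φ_eq (hf : IsHyperelastic κ p α f Φ Ψ) (hN : 1 ≤ N)
    {u : Vec N → Vec N} (hu : AEStronglyMeasurable u volume) :
    ∫⁻ x, ∫⁻ y in ball (0 : Vec N) δ, ENNReal.ofReal (Φ y (u x - u (x - y)))
      = ∫⁻ z, ENNReal.ofReal (Φ z.2 (u z.1 - u (z.1 - z.2))) ∂(pairMeasure N δ) :=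
  (lintegral_prod _ (hf.aemeasurable_Φ hN hu).ennreal_ofReal).symm

theorem IsRegularization.aestronglyMeasurable_form (h : IsRegularization δ κ p α f Φ g S F φ)
    (n : ℕ) {u η : Vec N → Vec N} (hu : AEStronglyMeasurable u volume)
    (hη : AEStronglyMeasurable η volume) :
    AEStronglyMeasurable (formIntegrand (F n) u η) (pairMeasure N δ) := by
  have h1 : AEMeasurable (fun z : Vec N × Vec N => F n z.2 (u z.1 - u (z.1 - z.2)))
      (pairMeasure N δ) := (h.F_meas n).comp_aemeasurable (aemeasurable_bond_diff hu)
  exact h1.aestronglyMeasurable.inner (aemeasurable_bond_diff hη).snd.aestronglyMeasurable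

/-- Weak convergence with bounded energy implies convergence of the energetic form. -/
theorem IsRegularization.tendsto_form (h : IsRegularization δ κ p α f Φ g S F φ) (hN : 1 ≤ N)
    (hδ : 0 < δ) (hf : IsHyperelastic κ p α f Φ Ψ) (hg0 : ∀ y, 0 ≤ g y)
    (hg : IntegrableOn g (ball 0 δ)) {ns : ℕ → ℕ} (hns : Tendsto ns atTop atTop)
    {u : ℕ → LTwo N} {v : LTwo N} {M C : ℝ} (hC : ∀ k, ‖u k‖ ≤ C)
    (hM : ∀ k, ∫ z, φ (ns k) z.2 (u k z.1 - u k (z.1 - z.2)) ∂(pairMeasure N δ) ≤ M)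
    (hv : ∀ η, Tendsto (fun k => ⟪η, u k⟫_ℝ) atTop (𝓝 ⟪η, v⟫_ℝ))
    {L : ℝ≥0} {R : ℝ} {η : Vec N → Vec N} (hη : IsBump L R η) :
    Integrable (formIntegrand f v η) (pairMeasure N δ) ∧
      Tendsto (fun k => ∫ z, formIntegrand (F (ns k)) (u k) η z ∂(pairMeasure N δ)) atTop
        (𝓝 (∫ z, formIntegrand f v η z ∂(pairMeasure N δ))) := by
  have hp : 0 < p := by linarith [hf.two_le_p]
  -- Almost everywhere convergence holds along subsequences only. As the limit is always the same,
  -- every subsequence has a further one with this limit, and the whole sequence converges.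
  have key : ∀ ks : ℕ → ℕ, Tendsto ks atTop atTop → ∃ js : ℕ → ℕ,
      Integrable (formIntegrand f v η) (pairMeasure N δ) ∧
      Tendsto (fun k => ∫ z, formIntegrand (F (ns (ks (js k)))) (u (ks (js k))) η z
        ∂(pairMeasure N δ)) atTop (𝓝 (∫ z, formIntegrand f v η z ∂(pairMeasure N δ))) := by
    intro ks hks
    obtain ⟨js, hjs, hae⟩ := h.exists_subseq_ae hδ hf.κ_pos (mul_pos hf.α_pos hp)
      (hns.comp hks) (fun k => hC (ks k)) (fun k => hM (ks k)) (fun η => (hv η).comp hks)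
    refine ⟨js, tendsto_integral_of_almost_dominated
      (q := fun k z => φ (ns (ks (js k))) z.2
        (u (ks (js k)) z.1 - u (ks (js k)) (z.1 - z.2)))
      (fun k => h.aestronglyMeasurable_form _ (Lp.aestronglyMeasurable _)
        hη.continuous.aestronglyMeasurable) ?_
      (fun k => h.integrable_potential _ _) (fun k z => h.φ_nonneg _ _ _) (fun k => hM _) fun ε hε => ?_⟩
    · filter_upwards [h.ae_tendsto hN hf ((hns.comp hks).comp hjs.tendsto_atTop) hae] with z hz
      exact hz.1.inner tendsto_const_nhds
    · obtain ⟨C', -, hC'⟩ := h.exists_bumpBound hp hg0 hε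
      refine ⟨_, integrable_bumpBound hN hp hf.α_lt_one hg C' L R, fun k => ?_⟩
      filter_upwards [ae_bond_ne_zero hN, ae_bond_mem_ball] with z hz1 hz2
      exact hC' L R η hη _ _ z hz1 hz2
  obtain ⟨_, hi, -⟩ := key id tendsto_id
  exact ⟨hi, tendsto_of_subseq_tendsto fun ks hks => by
    obtain ⟨js, -, hjs⟩ := key ks hks
    exact ⟨js, hjs⟩⟩

/-- The energetic form is bounded by the energy. -/
theorem IsRegularization.exists_form_bound (h : IsRegularization δ κ p α f Φ g S F φ) (hN : 1 ≤ N)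
    (hf : IsHyperelastic κ p α f Φ Ψ) (hg0 : ∀ y, 0 ≤ g y)
    (hg : IntegrableOn g (ball 0 δ)) (M : ℝ) (L : ℝ≥0) (R : ℝ) :
    ∃ B, ∀ n (u : LTwo N) (η : Vec N → Vec N), IsBump L R η →
      ∫ z, φ n z.2 (u z.1 - u (z.1 - z.2)) ∂(pairMeasure N δ) ≤ M →
        |∫ z, formIntegrand (F n) u η z ∂(pairMeasure N δ)| ≤ B := by
  have hp : 0 < p := by linarith [hf.two_le_p]
  obtain ⟨C, -, hC⟩ := h.exists_bumpBound hp hg0 one_pos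
  have hb := integrable_bumpBound hN hp hf.α_lt_one hg C L R
  refine ⟨M + ∫ z, bumpBound N δ p α g C L R z ∂(pairMeasure N δ), fun n u η hη hu => ?_⟩
  have hi := h.integrable_potential n u
  have h1 := norm_integral_le_of_norm_le (f := formIntegrand (F n) u η) (hi.fun_add hb) (by
    filter_upwards [ae_bond_ne_zero hN, ae_bond_mem_ball] with z hz1 hz2
    simpa using hC L R η hη n u z hz1 hz2)
  rw [integral_add hi hb] at h1
  exact h1.trans (by linarith)

/-- Lower semicontinuity of the energy. -/
theorem IsRegularization.lintegral_Φ_le (h : IsRegularization δ κ p α f Φ g S F φ) (hN : 1 ≤ N)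
    (hδ : 0 < δ) (hf : IsHyperelastic κ p α f Φ Ψ) {ns : ℕ → ℕ} (hns : Tendsto ns atTop atTop)
    {u : ℕ → LTwo N} {v : LTwo N} {M C : ℝ} (hC : ∀ k, ‖u k‖ ≤ C)
    (hM : ∀ k, ∫ z, φ (ns k) z.2 (u k z.1 - u k (z.1 - z.2)) ∂(pairMeasure N δ) ≤ M)
    (hv : ∀ η, Tendsto (fun k => ⟪η, u k⟫_ℝ) atTop (𝓝 ⟪η, v⟫_ℝ)) {c : ℕ → ℝ} {c' : ℝ}
    (hc : Tendsto c atTop (𝓝 c'))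
    (huc : ∀ k, ∫ z, φ (ns k) z.2 (u k z.1 - u k (z.1 - z.2)) ∂(pairMeasure N δ) ≤ c k) :
    ∫⁻ z, ENNReal.ofReal (Φ z.2 (v z.1 - v (z.1 - z.2))) ∂(pairMeasure N δ)
      ≤ ENNReal.ofReal c' := by
  have hp : 0 < p := by linarith [hf.two_le_p]
  obtain ⟨js, hjs, hae⟩ := h.exists_subseq_ae hδ hf.κ_pos (mul_pos hf.α_pos hp) hns hC hM hv
  have h1 := h.ae_tendsto hN hf (hns.comp hjs.tendsto_atTop) hae
  set G : ℕ → Vec N × Vec N → ℝ := fun k z =>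
    φ (ns (js k)) z.2 (u (js k) z.1 - u (js k) (z.1 - z.2)) with hG
  have hGi : ∀ k, Integrable (G k) (pairMeasure N δ) := fun k => h.integrable_potential _ _
  have h2 := lintegral_liminf_le' (u := atTop) (μ := pairMeasure N δ)
    (f := fun k z => ENNReal.ofReal (G k z)) fun k => (hGi k).1.aemeasurable.ennreal_ofReal
  calc _ = ∫⁻ z, liminf (fun k => ENNReal.ofReal (G k z)) atTop ∂(pairMeasure N δ) := by
        refine lintegral_congr_ae ?_
        filter_upwards [h1] with z hz
        exact ((ENNReal.continuous_ofReal.tendsto _).comp hz.2).liminf_eq.symm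
    _ ≤ _ := h2
    _ ≤ liminf (fun k => ENNReal.ofReal (c (js k))) atTop := by
        refine liminf_le_liminf (Eventually.of_forall fun k => ?_)
        rw [← ofReal_integral_eq_lintegral_ofReal (hGi k)
          (Eventually.of_forall fun z => h.φ_nonneg _ _ _)]
        exact ENNReal.ofReal_le_ofReal (huc _)
    _ = _ := ((ENNReal.continuous_ofReal.tendsto _).comp
        (hc.comp hjs.tendsto_atTop)).liminf_eq

end Limit

/-! ### Test functions as curves in `L²` -/

section Test

variable {N : ℕ} {v : ℝ → Vec N → Vec N}

/-- The time derivative of a test function. -/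
noncomputable def timeDeriv (v : ℝ → Vec N → Vec N) (t : ℝ) (x : Vec N) : Vec N :=
  deriv (fun s => v s x) t

namespace IsTestFunction

theorem hasDerivAt (hv : IsTestFunction v) (t : ℝ) (x : Vec N) :
    HasDerivAt (fun s => v s x)
      (fderiv ℝ (fun q : ℝ × Vec N => v q.1 q.2) (t, x) ((1 : ℝ), (0 : Vec N))) t := by
  have h1 : HasFDerivAt (fun q : ℝ × Vec N => v q.1 q.2)
      (fderiv ℝ (fun q : ℝ × Vec N => v q.1 q.2) (t, x)) (t, x) :=
    (hv.smooth.differentiable (by simp) _).hasFDerivAt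
  have h2 : HasDerivAt (fun s : ℝ => (s, x)) ((1 : ℝ), (0 : Vec N)) t :=
    (hasDerivAt_id t).prodMk (hasDerivAt_const t x)
  exact h1.comp_hasDerivAt t h2

theorem hasDerivAt_timeDeriv (hv : IsTestFunction v) (t : ℝ) (x : Vec N) :
    HasDerivAt (fun s => v s x) (timeDeriv v t x) t := by
  rw [timeDeriv, (hv.hasDerivAt t x).deriv]
  exact hv.hasDerivAt t x

theorem timeDeriv (hv : IsTestFunction v) : IsTestFunction (timeDeriv v) := by
  have e : (fun q : ℝ × Vec N => Peridynamics.timeDeriv v q.1 q.2)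
      = fun q => fderiv ℝ (fun q : ℝ × Vec N => v q.1 q.2) q ((1 : ℝ), (0 : Vec N)) :=
    funext fun q => (hv.hasDerivAt q.1 q.2).deriv
  refine ⟨?_, ?_⟩
  · rw [e]
    exact (hv.smooth.fderiv_right (m := ∞) (by simp)).clm_apply contDiff_const
  · rw [e]
    exact hv.compact.fderiv_apply ℝ _

theorem exists_radius (hv : IsTestFunction v) :
    ∃ R, 0 < R ∧ (∀ t x, R ≤ |t| → v t x = 0) ∧ ∀ t x, R ≤ ‖x‖ → v t x = 0 := by
  obtain ⟨R, hR⟩ := hv.compact.isCompact.isBounded.subset_closedBall (0 : ℝ × Vec N)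
  have key : ∀ t x, |R| + 1 ≤ max |t| ‖x‖ → v t x = 0 := fun t x h => by
    by_contra hne
    have h1 : (t, x) ∈ tsupport fun q : ℝ × Vec N => v q.1 q.2 := subset_tsupport _ hne
    have h2 := hR h1
    rw [mem_closedBall_zero_iff, Prod.norm_def, Real.norm_eq_abs] at h2
    linarith [le_abs_self R]
  exact ⟨|R| + 1, by positivity, fun t x h => key t x (h.trans (le_max_left _ _)),
    fun t x h => key t x (h.trans (le_max_right _ _))⟩

theorem exists_lipschitz (hv : IsTestFunction v) :
    ∃ L, LipschitzWith L fun q : ℝ × Vec N => v q.1 q.2 :=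
  hv.smooth.lipschitzWith_of_hasCompactSupport hv.compact (by simp)

/-- The slices of a test function are uniformly Lipschitz with bounded support, and vanish for
large times. -/
theorem exists_isBump (hv : IsTestFunction v) :
    ∃ (L : ℝ≥0) (R : ℝ), 0 < R ∧ (∀ t, IsBump L R (v t)) ∧ ∀ t x, R ≤ |t| → v t x = 0 := by
  obtain ⟨R, hR, h1, h2⟩ := hv.exists_radius
  obtain ⟨L, hL⟩ := hv.exists_lipschitz
  refine ⟨L, R, hR, fun t => ⟨LipschitzWith.of_dist_le_mul fun x y => ?_, fun x => h2 t x⟩, h1⟩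
  have := hL.dist_le_mul (t, x) (t, y)
  simpa [Prod.dist_eq] using this

theorem memLp (hv : IsTestFunction v) (t : ℝ) : MemLp (v t) 2 volume := by
  obtain ⟨L, R, -, h, -⟩ := hv.exists_isBump
  exact (h t).memLp

/-- A test function as a curve in `L²`. -/
noncomputable def curve (hv : IsTestFunction v) (t : ℝ) : LTwo N := (hv.memLp t).toLp _

theorem coeFn_curve (hv : IsTestFunction v) (t : ℝ) : hv.curve t =ᵐ[volume] v t :=
  MemLp.coeFn_toLp _

theorem inner_curve (hv : IsTestFunction v) (t : ℝ) (u : LTwo N) :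
    ⟪u, hv.curve t⟫_ℝ = ∫ x, ⟪u x, v t x⟫_ℝ := by
  rw [L2.inner_def]
  refine integral_congr_ae ?_
  filter_upwards [hv.coeFn_curve t] with x hx
  rw [hx]

theorem norm_taylor_le (hv : IsTestFunction v) {L : ℝ≥0}
    (hL : LipschitzWith L fun q : ℝ × Vec N => Peridynamics.timeDeriv v q.1 q.2)
    (t h : ℝ) (x : Vec N) :
    ‖v (t + h) x - v t x - h • Peridynamics.timeDeriv v t x‖ ≤ L * |h| ^ 2 := by
  have h1 : ∀ s ∈ closedBall t |h|, HasDerivWithinAt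
      (fun s => v s x - s • Peridynamics.timeDeriv v t x)
      (Peridynamics.timeDeriv v s x - Peridynamics.timeDeriv v t x) (closedBall t |h|) s :=
    fun s _ => by
      have := (hv.hasDerivAt_timeDeriv s x).sub
        ((hasDerivAt_id s).smul_const (Peridynamics.timeDeriv v t x))
      exact (this.congr_deriv (by simp)).hasDerivWithinAt
  have h2 : ∀ s ∈ closedBall t |h|,
      ‖Peridynamics.timeDeriv v s x - Peridynamics.timeDeriv v t x‖ ≤ L * |h| := fun s hs => by
    have h3 := hL.dist_le_mul (s, x) (t, x)
    rw [Prod.dist_eq, dist_self, max_eq_left dist_nonneg, dist_eq_norm] at h3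
    refine h3.trans ?_
    gcongr
    exact hs
  have h4 := (convex_closedBall t |h|).norm_image_sub_le_of_norm_hasDerivWithin_le h1 h2
    (mem_closedBall_self (abs_nonneg h)) (y := t + h) (by simp)
  have e : v (t + h) x - v t x - h • Peridynamics.timeDeriv v t x
      = v (t + h) x - (t + h) • Peridynamics.timeDeriv v t x
        - (v t x - t • Peridynamics.timeDeriv v t x) := by
    rw [add_smul]; abel
  rw [e]
  refine h4.trans (le_of_eq ?_)
  rw [add_sub_cancel_left, Real.norm_eq_abs]
  ring

/-- The Taylor remainder in time is at most `L h ^ 2` uniformly in `x` and vanishes outside a fixed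
ball, so its `L²` norm is `O(h ^ 2)`. -/
theorem hasDerivAt_curve (hv : IsTestFunction v) (t : ℝ) :
    HasDerivAt hv.curve (hv.timeDeriv.curve t) t := by
  obtain ⟨R, hR, -, hR2⟩ := hv.exists_radius
  obtain ⟨R', hR', -, hR2'⟩ := hv.timeDeriv.exists_radius
  obtain ⟨L, hL⟩ := hv.timeDeriv.exists_lipschitz
  set r := max R R' with hr
  have hfin : volume (ball (0 : Vec N) r) ≠ ⊤ := measure_ball_lt_top.ne
  set c := volume.real (ball (0 : Vec N) r) ^ (1 / 2 : ℝ) with hc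
  have key : ∀ h : ℝ, ‖hv.curve (t + h) - hv.curve t - h • hv.timeDeriv.curve t‖
      ≤ L * c * ‖h‖ ^ 2 := by
    intro h
    have h1 : ‖indicatorConstLp 2 (measurableSet_ball (x := (0 : Vec N)) (ε := r)) hfin
        ((L : ℝ) * |h| ^ 2)‖ = L * c * ‖h‖ ^ 2 := by
      rw [norm_indicatorConstLp (by norm_num) (by norm_num), Real.norm_of_nonneg (by positivity),
        hc, Real.norm_eq_abs]
      simp
      ring
    rw [← h1]
    refine Lp.norm_le_norm_of_ae_le ?_
    filter_upwards [Lp.coeFn_sub (hv.curve (t + h) - hv.curve t) (h • hv.timeDeriv.curve t),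
      Lp.coeFn_sub (hv.curve (t + h)) (hv.curve t), Lp.coeFn_smul h (hv.timeDeriv.curve t),
      hv.coeFn_curve (t + h), hv.coeFn_curve t, hv.timeDeriv.coeFn_curve t,
      indicatorConstLp_coeFn (p := 2) (hs := measurableSet_ball (x := (0 : Vec N)) (ε := r))
        (hμs := hfin) (c := (L : ℝ) * |h| ^ 2)] with x e1 e2 e3 e4 e5 e6 e7
    rw [e1, Pi.sub_apply, e2, Pi.sub_apply, e3, Pi.smul_apply, e4, e5, e6, e7]
    by_cases hx : x ∈ ball (0 : Vec N) r
    · rw [indicator_of_mem hx, Real.norm_of_nonneg (by positivity)]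
      exact hv.norm_taylor_le hL t h x
    · have hx' : r ≤ ‖x‖ := by simpa using hx
      have h2 := (le_max_left R R').trans hx'
      have h3 := (le_max_right R R').trans hx'
      rw [hR2 _ _ h2, hR2 _ _ h2, hR2' _ _ h3]
      simp
  rw [hasDerivAt_iff_isLittleO_nhds_zero]
  have hO : (fun h : ℝ => hv.curve (t + h) - hv.curve t - h • hv.timeDeriv.curve t)
      =O[𝓝 0] fun h => h ^ 2 :=
    Asymptotics.IsBigO.of_bound _ (Eventually.of_forall fun h => by
      rw [norm_pow]; exact key h)
  exact hO.trans_isLittleO (Asymptotics.isLittleO_pow_id one_lt_two)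

theorem continuous_curve (hv : IsTestFunction v) : Continuous hv.curve :=
  continuous_iff_continuousAt.2 fun t => (hv.hasDerivAt_curve t).continuousAt

theorem curve_eq_zero (hv : IsTestFunction v) {t : ℝ} (h : ∀ x, v t x = 0) : hv.curve t = 0 := by
  refine Lp.ext ((hv.coeFn_curve t).trans ?_)
  filter_upwards [Lp.coeFn_zero (Vec N) 2 volume] with x hx
  rw [hx, h, Pi.zero_apply]

end IsTestFunction

end Test

/-! ### Integration over the half-line of functions vanishing for large times -/

theorem integrableOn_Ioi_of_eq_zero {Y : ℝ → ℝ} (hY : Continuous Y) {R : ℝ}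
    (h0 : ∀ t, R ≤ t → Y t = 0) : IntegrableOn Y (Ioi 0) := by
  have h1 : IntegrableOn Y (Ioc 0 R) :=
    (hY.integrableOn_Icc (a := 0) (b := R)).mono_set Ioc_subset_Icc_self
  have h2 : IntegrableOn Y (Ioi R) :=
    (integrableOn_zero : IntegrableOn (fun _ => (0 : ℝ)) (Ioi R) volume).congr_fun
      (fun t ht => (h0 t (le_of_lt ht)).symm) measurableSet_Ioi
  refine (h1.union h2).mono_set fun t ht => ?_
  rcases le_or_gt t R with h | h
  · exact Or.inl ⟨ht, h⟩
  · exact Or.inr h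

theorem integral_Ioi_deriv_of_eq_zero {Y Y' : ℝ → ℝ} (hY : ∀ t, HasDerivAt Y (Y' t) t)
    (hY' : Continuous Y') {R : ℝ} (h0 : ∀ t, R ≤ t → Y t = 0) (h0' : ∀ t, R ≤ t → Y' t = 0) :
    ∫ t in Ioi (0 : ℝ), Y' t = -Y 0 := by
  have h3 : Tendsto Y atTop (𝓝 0) :=
    tendsto_const_nhds.congr' ((eventually_ge_atTop R).mono fun t ht => (h0 t ht).symm)
  rw [integral_Ioi_of_hasDerivAt_of_tendsto' (fun t _ => hY t)
    (integrableOn_Ioi_of_eq_zero hY' h0') h3, zero_sub]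

theorem tendsto_integral_Ioi {a : ℕ → ℝ → ℝ} {a' : ℝ → ℝ} (ha : ∀ k, Continuous (a k))
    (hlim : ∀ t, Tendsto (fun k => a k t) atTop (𝓝 (a' t))) {R B : ℝ}
    (hB : ∀ k t, 0 < t → t < R → |a k t| ≤ B) (h0 : ∀ k t, R ≤ t → a k t = 0) :
    Tendsto (fun k => ∫ t in Ioi (0 : ℝ), a k t) atTop (𝓝 (∫ t in Ioi (0 : ℝ), a' t)) := by
  refine tendsto_integral_of_dominated_convergence ((Iio R).indicator fun _ => B)
    (fun k => (ha k).aestronglyMeasurable) ?_ (fun k => ?_) (Eventually.of_forall hlim)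
  · rw [integrable_indicator_iff measurableSet_Iio, IntegrableOn,
      Measure.restrict_restrict measurableSet_Iio]
    have : Iio R ∩ Ioi (0 : ℝ) = Ioo 0 R := by ext t; simp [and_comm]
    rw [this]
    exact integrableOn_const (by simp)
  · filter_upwards [ae_restrict_mem measurableSet_Ioi] with t ht
    rcases lt_or_ge t R with h | h
    · rw [indicator_of_mem (show t ∈ Iio R from h)]
      exact hB k t ht h
    · rw [h0 k t h, norm_zero, indicator_of_notMem (by simpa using h)]

/-! ### Weak forms of the evolution equations in `L²`. -/

section WeakForm

variable {N : ℕ} {v : ℝ → Vec N → Vec N} {A : LTwo N → LTwo N} {u w : ℝ → LTwo N}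

/-- The weak form of `u' = w`. -/
theorem integral_inner_timeDeriv (hv : IsTestFunction v) (hu : ∀ t, HasDerivAt u (w t) t)
    (hw : Continuous w) :
    ∫ t in Ioi (0 : ℝ), (⟪u t, hv.timeDeriv.curve t⟫_ℝ + ⟪w t, hv.curve t⟫_ℝ)
      = -⟪u 0, hv.curve 0⟫_ℝ := by
  have huc : Continuous u := continuous_iff_continuousAt.2 fun t => (hu t).continuousAt
  obtain ⟨L, R, hR, -, h0⟩ := hv.exists_isBump
  obtain ⟨L', R', hR', -, h0'⟩ := hv.timeDeriv.exists_isBump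
  have hz : ∀ t, max R R' ≤ t → hv.curve t = 0 := fun t ht =>
    hv.curve_eq_zero fun x => h0 t x (((le_max_left _ _).trans ht).trans (le_abs_self t))
  have hz' : ∀ t, max R R' ≤ t → hv.timeDeriv.curve t = 0 := fun t ht =>
    hv.timeDeriv.curve_eq_zero fun x =>
      h0' t x (((le_max_right _ _).trans ht).trans (le_abs_self t))
  refine integral_Ioi_deriv_of_eq_zero (Y := fun t => ⟪u t, hv.curve t⟫_ℝ) (R := max R R')
    (fun t => (hu t).inner ℝ (hv.hasDerivAt_curve t)) ?_ (fun t ht => ?_) (fun t ht => ?_)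
  · exact (huc.inner hv.timeDeriv.continuous_curve).add (hw.inner hv.continuous_curve)
  · simp only [hz t ht, inner_zero_right]
  · rw [hz t ht, hz' t ht, inner_zero_right, inner_zero_right, add_zero]

/-- The weak form of `u'' = -A u`. -/
theorem integral_inner_timeDeriv_timeDeriv (hv : IsTestFunction v)
    (hu : ∀ t, HasDerivAt u (w t) t) (hw : ∀ t, HasDerivAt w (-A (u t)) t) (hA : Continuous A) :
    ∫ t in Ioi (0 : ℝ), (⟪u t, hv.timeDeriv.timeDeriv.curve t⟫_ℝ + ⟪A (u t), hv.curve t⟫_ℝ)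
      = ⟪w 0, hv.curve 0⟫_ℝ - ⟪u 0, hv.timeDeriv.curve 0⟫_ℝ := by
  have huc : Continuous u := continuous_iff_continuousAt.2 fun t => (hu t).continuousAt
  obtain ⟨L, R, hR, -, h0⟩ := hv.exists_isBump
  obtain ⟨L', R', hR', -, h0'⟩ := hv.timeDeriv.exists_isBump
  obtain ⟨L₂, R₂, hR₂, -, h0₂⟩ := hv.timeDeriv.timeDeriv.exists_isBump
  set r := max R (max R' R₂) with hr
  have hz : ∀ t, r ≤ t → hv.curve t = 0 := fun t ht =>
    hv.curve_eq_zero fun x => h0 t x (((le_max_left _ _).trans ht).trans (le_abs_self t))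
  have hz' : ∀ t, r ≤ t → hv.timeDeriv.curve t = 0 := fun t ht =>
    hv.timeDeriv.curve_eq_zero fun x =>
      h0' t x ((((le_max_left _ _).trans (le_max_right _ _)).trans ht).trans (le_abs_self t))
  have hz₂ : ∀ t, r ≤ t → hv.timeDeriv.timeDeriv.curve t = 0 := fun t ht =>
    hv.timeDeriv.timeDeriv.curve_eq_zero fun x =>
      h0₂ t x ((((le_max_right _ _).trans (le_max_right _ _)).trans ht).trans (le_abs_self t))
  have h := integral_Ioi_deriv_of_eq_zero
    (Y := fun t => ⟪u t, hv.timeDeriv.curve t⟫_ℝ - ⟪w t, hv.curve t⟫_ℝ)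
    (Y' := fun t => ⟪u t, hv.timeDeriv.timeDeriv.curve t⟫_ℝ + ⟪A (u t), hv.curve t⟫_ℝ) (R := r)
    (fun t => ?_) ?_ (fun t ht => ?_) (fun t ht => ?_)
  · rw [h]; ring
  · refine (((hu t).inner ℝ (hv.timeDeriv.hasDerivAt_curve t)).sub
      ((hw t).inner ℝ (hv.hasDerivAt_curve t))).congr_deriv ?_
    rw [inner_neg_left]
    ring
  · exact (huc.inner hv.timeDeriv.timeDeriv.continuous_curve).add
      ((hA.comp huc).inner hv.continuous_curve)
  · simp only [hz t ht, hz' t ht, inner_zero_right, sub_zero]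
  · simp only [hz t ht, hz₂ t ht, inner_zero_right, add_zero]

end WeakForm

instance (N : ℕ) : SecondCountableTopology (LTwo N) :=
  haveI : Fact ((2 : ℝ≥0∞) ≠ ⊤) := ⟨ENNReal.ofNat_ne_top⟩
  Lp.SecondCountableTopology

/-! ### Bounds for weak limits, and passage to the limit under the time integral. -/

section Auxiliary

theorem lipschitzWith_of_hasDerivAt_le {E : Type*} [NormedAddCommGroup E] [NormedSpace ℝ E]
    {y y' : ℝ → E} (hy : ∀ t, HasDerivAt y (y' t) t) {B : ℝ} (hB : ∀ t, ‖y' t‖ ≤ B) :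
    LipschitzWith B.toNNReal y :=
  lipschitzWith_of_nnnorm_deriv_le (fun t => (hy t).differentiableAt) fun t => by
    rw [(hy t).deriv, ← norm_toNNReal]
    exact Real.toNNReal_le_toNNReal (hB t)

theorem norm_le_of_weak_limit {H : Type*} [NormedAddCommGroup H] [InnerProductSpace ℝ H]
    {x : ℕ → H} {y : H} {C : ℝ} (hC : ∀ k, ‖x k‖ ≤ C)
    (hy : Tendsto (fun k => ⟪y, x k⟫_ℝ) atTop (𝓝 ⟪y, y⟫_ℝ)) : ‖y‖ ≤ C := by
  have h1 : ‖y‖ * ‖y‖ ≤ ‖y‖ * C := by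
    rw [← real_inner_self_eq_norm_mul_norm]
    exact le_of_tendsto hy (Eventually.of_forall fun k => (real_inner_le_norm _ _).trans
      (mul_le_mul_of_nonneg_left (hC k) (norm_nonneg _)))
  rcases (norm_nonneg y).eq_or_lt with h | h
  · rw [← h]; exact (norm_nonneg _).trans (hC 0)
  · exact le_of_mul_le_mul_left h1 h

variable {N : ℕ} {δ : ℝ}

theorem formIntegrand_ae_congr (F : Vec N → Vec N → Vec N) {u u' η η' : Vec N → Vec N}
    (hu : u =ᵐ[volume] u') (hη : η =ᵐ[volume] η') :
    formIntegrand F u η =ᵐ[pairMeasure N δ] formIntegrand F u' η' := by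
  filter_upwards [diff_ae_congr hu, diff_ae_congr hη] with z h1 h2
  rw [formIntegrand, formIntegrand, h1, h2]

/-- Supplies the dense set of directions in which the velocities are equi-Lipschitz in time. -/
theorem dense_bump (N : ℕ) :
    Dense {ζ : LTwo N | ∃ (L : ℝ≥0) (R : ℝ) (η : Vec N → Vec N), IsBump L R η ∧
      ζ =ᵐ[volume] η} := by
  refine (Lp.dense_hasCompactSupport_contDiff (F := Vec N) (p := 2)
    (μ := (volume : Measure (Vec N)))    ENNReal.ofNat_ne_top).mono ?_
  rintro ζ ⟨η, hζ, hc, hη⟩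
  obtain ⟨L, hL⟩ := hη.lipschitzWith_of_hasCompactSupport hc (by simp)
  obtain ⟨R, hR⟩ := hc.isCompact.isBounded.subset_ball (0 : Vec N)
  refine ⟨L, R, η, ⟨hL, fun x hx => ?_⟩, hζ⟩
  by_contra hne
  exact absurd hx (not_le.2 (by simpa using hR (subset_tsupport _ hne)))

theorem IsTestFunction.exists_norm_curve_le {v : ℝ → Vec N → Vec N} (hv : IsTestFunction v) :
    ∃ R B, 0 < R ∧ (∀ t, ‖hv.curve t‖ ≤ B) ∧ ∀ t, R ≤ |t| → hv.curve t = 0 := by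
  obtain ⟨L, R, hR, -, h0⟩ := hv.exists_isBump
  have h1 : ∀ t, R ≤ |t| → hv.curve t = 0 := fun t ht => hv.curve_eq_zero fun x => h0 t x ht
  have hc : HasCompactSupport hv.curve :=
    HasCompactSupport.of_support_subset_isCompact (isCompact_closedBall (0 : ℝ) R) fun t ht => by
      by_contra h
      exact ht (h1 t (by simpa using (not_le.1 (by simpa using h)).le))
  obtain ⟨B, hB⟩ := hv.continuous_curve.bounded_above_of_compact_support hc
  exact ⟨R, B, hR, hB, h1⟩

theorem tendsto_integral_inner_curve {v : ℝ → Vec N → Vec N} (hv : IsTestFunction v)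
    {x : ℕ → ℝ → LTwo N} {y : ℝ → LTwo N} (hx : ∀ k, Continuous (x k)) {c₀ c₁ : ℝ} (hc₁ : 0 ≤ c₁)
    (hc : ∀ k t, ‖x k t‖ ≤ c₀ + c₁ * |t|)
    (hy : ∀ t η, Tendsto (fun k => ⟪η, x k t⟫_ℝ) atTop (𝓝 ⟪η, y t⟫_ℝ)) :
    Tendsto (fun k => ∫ t in Ioi (0 : ℝ), ⟪x k t, hv.curve t⟫_ℝ) atTop
      (𝓝 (∫ t in Ioi (0 : ℝ), ⟪y t, hv.curve t⟫_ℝ)) := by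
  obtain ⟨R, B, hR, hB, h0⟩ := hv.exists_norm_curve_le
  refine tendsto_integral_Ioi (R := R) (B := (c₀ + c₁ * R) * B)
    (fun k => (hx k).inner hv.continuous_curve) (fun t => ?_) (fun k t ht htR => ?_)
    (fun k t ht => ?_)
  · simpa only [real_inner_comm] using hy t (hv.curve t)
  · have h1 := hc k t
    rw [abs_of_pos ht] at h1
    have h2 : ‖x k t‖ ≤ c₀ + c₁ * R := h1.trans (by gcongr)
    refine (abs_real_inner_le_norm _ _).trans ?_
    exact mul_le_mul h2 (hB t) (norm_nonneg _) ((norm_nonneg _).trans h2)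
  · rw [h0 t (ht.trans (le_abs_self t)), inner_zero_right]

end Auxiliary

/-- Solutions `u k` of the wave equations with the regularized forces `F (ns k)`, of energy at
most `E`, that converge weakly to `x` together with their velocities `w k`, which converge to
`y`. -/
structure IsWaveLimit {N : ℕ} (δ : ℝ) (F : ℕ → Vec N → Vec N → Vec N)
    (φ : ℕ → Vec N → Vec N → ℝ) (E : ℝ) (a b : LTwo N) (ns : ℕ → ℕ) (A : ℕ → LTwo N → LTwo N)
    (u w : ℕ → ℝ → LTwo N) (x y : ℝ → LTwo N) : Prop where
  ns_tendsto : Tendsto ns atTop atTop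
  continuous_A : ∀ k, Continuous (A k)
  inner_A : ∀ k (c d : LTwo N), ⟪A k c, d⟫_ℝ
    = 1 / 2 * ∫ z, formIntegrand (F (ns k)) c d z ∂(pairMeasure N δ)
  u_zero : ∀ k, u k 0 = a
  w_zero : ∀ k, w k 0 = b
  hasDerivAt_u : ∀ k t, HasDerivAt (u k) (w k t) t
  hasDerivAt_w : ∀ k t, HasDerivAt (w k) (-A k (u k t)) t
  energy_le : ∀ k t, ‖w k t‖ ^ 2 / 2 + potentialEnergy δ (φ (ns k)) (u k t) ≤ E
  tendsto_u : ∀ t η, Tendsto (fun k => ⟪η, u k t⟫_ℝ) atTop (𝓝 ⟪η, x t⟫_ℝ)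
  tendsto_w : ∀ t η, Tendsto (fun k => ⟪η, w k t⟫_ℝ) atTop (𝓝 ⟪η, y t⟫_ℝ)

/-! ### Uniform bounds and compactness for the regularized solutions. -/

section Limit

variable {N : ℕ} {δ κ p α : ℝ} {f : Vec N → Vec N → Vec N} {Φ Ψ : Vec N → Vec N → ℝ}
  {g : Vec N → ℝ} {S : ℕ → Set (Vec N)} {F : ℕ → Vec N → Vec N → Vec N}
  {φ : ℕ → Vec N → Vec N → ℝ} {E : ℝ} {a b : LTwo N}

theorem IsRegularization.potentialEnergy_nonneg (h : IsRegularization δ κ p α f Φ g S F φ) (n : ℕ)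
    (u : Vec N → Vec N) : 0 ≤ potentialEnergy δ (φ n) u :=
  mul_nonneg (by norm_num) (integral_nonneg fun _ => h.φ_nonneg n _ _)

theorem IsRegularization.norm_velocity_le (h : IsRegularization δ κ p α f Φ g S F φ) {n : ℕ}
    {u : Vec N → Vec N} {w : LTwo N}
    (hE : ‖w‖ ^ 2 / 2 + potentialEnergy δ (φ n) u ≤ E) : ‖w‖ ≤ √(2 * E) :=
  Real.le_sqrt_of_sq_le (by linarith [h.potentialEnergy_nonneg n u])

theorem norm_le_of_norm_deriv_le {H : Type*} [NormedAddCommGroup H] [NormedSpace ℝ H]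
    {u w : ℝ → H} (hu : ∀ t, HasDerivAt u (w t) t) {W : ℝ} (hW : ∀ t, ‖w t‖ ≤ W) (t : ℝ) :
    ‖u t‖ ≤ ‖u 0‖ + W * |t| := by
  have h1 := (lipschitzWith_of_hasDerivAt_le hu hW).dist_le_mul t 0
  rw [Real.coe_toNNReal _ ((norm_nonneg _).trans (hW 0)), dist_eq_norm, Real.dist_eq,
    sub_zero] at h1
  linarith [norm_le_norm_add_norm_sub' (u t) (u 0)]

/-- Since `φ n ≤ Φ` off the null set `y = 0`, the initial energies of all regularized problems have
a common bound. -/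
theorem IsRegularization.potentialEnergy_le (h : IsRegularization δ κ p α f Φ g S F φ)
    (hN : 1 ≤ N) (n : ℕ) (a : LTwo N)
    (ha : ∫⁻ z, ENNReal.ofReal (Φ z.2 (a z.1 - a (z.1 - z.2))) ∂(pairMeasure N δ) ≠ ⊤) :
    potentialEnergy δ (φ n) a ≤ 1 / 2 *
      (∫⁻ z, ENNReal.ofReal (Φ z.2 (a z.1 - a (z.1 - z.2))) ∂(pairMeasure N δ)).toReal := by
  refine mul_le_mul_of_nonneg_left ?_ (by norm_num)
  rw [integral_eq_lintegral_of_nonneg_ae (Eventually.of_forall fun z => h.φ_nonneg n _ _)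
    (h.integrable_potential n a).1]
  refine ENNReal.toReal_mono ha (lintegral_mono_ae ?_)
  filter_upwards [ae_bond_ne_zero hN] with z hz
  exact ENNReal.ofReal_le_ofReal (h.φ_le n _ _ hz)

/-- Compactness of the solutions of the regularized equations. -/
theorem IsRegularization.exists_isWaveLimit (h : IsRegularization δ κ p α f Φ g S F φ)
    (hN : 1 ≤ N) (hf : IsHyperelastic κ p α f Φ Ψ) (hg0 : ∀ y, 0 ≤ g y)
    (hg : IntegrableOn g (ball 0 δ)) (a b : LTwo N)
    (hE : ∀ n, ‖b‖ ^ 2 / 2 + potentialEnergy δ (φ n) a ≤ E) :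
    ∃ ns A u w x y, IsWaveLimit δ F φ E a b ns A u w x y := by
  choose A hLip hgrad hA using h.exists_force
  choose K hK using hLip
  choose u w hu0 hw0 hu hw hen using fun n => exists_wave_solution (hK n) (hgrad n) a b
  have hen' : ∀ n t, ‖w n t‖ ^ 2 / 2 + potentialEnergy δ (φ n) (u n t) ≤ E := fun n t =>
    (hen n t).le.trans (hE n)
  have hW : ∀ n t, ‖w n t‖ ≤ √(2 * E) := fun n t => h.norm_velocity_le (hen' n t)
  have hU : ∀ n t, ‖u n t‖ ≤ ‖a‖ + √(2 * E) * |t| := fun n t => by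
    rw [← hu0 n]
    exact norm_le_of_norm_deriv_le (hu n) (hW n) t
  have hφ : ∀ n t, ∫ z, φ n z.2 (u n t z.1 - u n t (z.1 - z.2)) ∂(pairMeasure N δ) ≤ 2 * E :=
    fun n t => by
      have := hen' n t
      rw [potentialEnergy] at this
      nlinarith [sq_nonneg ‖w n t‖]
  -- Displacements are equi-Lipschitz in norm by the velocity bound, so here every direction may be
  -- tested.
  obtain ⟨n₁, hn₁, x, hx⟩ := exists_subseq_weak_limit hU dense_univ fun η _ =>
    ⟨(‖η‖ * √(2 * E)).toNNReal, fun n => lipschitzWith_of_hasDerivAt_le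
      (fun t => (hasDerivAt_const t η).inner ℝ (hu n t)) fun t => by
        rw [inner_zero_left, add_zero]
        exact (norm_inner_le_norm _ _).trans (mul_le_mul_of_nonneg_left (hW n t) (norm_nonneg _))⟩
  -- The Lipschitz constants of `A n` are not uniform in `n`, so the accelerations are bounded only
  -- when tested with Lipschitz functions of bounded support, where the form is controlled by the
  -- energy.
  obtain ⟨n₂, hn₂, y, hy⟩ := exists_subseq_weak_limit (x := fun k => w (n₁ k))
    (fun n t => hW (n₁ n) t) (dense_bump N) (by
      rintro ζ ⟨L, R, η, hη, hζ⟩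
      obtain ⟨B, hB⟩ := h.exists_form_bound hN hf hg0 hg (2 * E) L R
      refine ⟨(1 / 2 * B).toNNReal, fun n => lipschitzWith_of_hasDerivAt_le
        (fun t => (hasDerivAt_const t ζ).inner ℝ (hw (n₁ n) t)) fun t => ?_⟩
      rw [inner_zero_left, add_zero, inner_neg_right, norm_neg, real_inner_comm, (hA _ _ _).2,
        integral_congr_ae (formIntegrand_ae_congr _ (ae_eq_refl _) hζ), Real.norm_eq_abs,
        abs_mul, abs_of_pos (by norm_num : (0 : ℝ) < 1 / 2)]
      exact mul_le_mul_of_nonneg_left (hB _ _ _ hη (hφ _ t)) (by norm_num))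
  exact ⟨fun k => n₁ (n₂ k), fun k => A (n₁ (n₂ k)), fun k => u (n₁ (n₂ k)),
    fun k => w (n₁ (n₂ k)), x, y,
    { ns_tendsto := hn₁.tendsto_atTop.comp hn₂.tendsto_atTop
      continuous_A := fun k => (hK _).continuous
      inner_A := fun k c d => (hA _ c d).2
      u_zero := fun k => hu0 _
      w_zero := fun k => hw0 _
      hasDerivAt_u := fun k => hu _
      hasDerivAt_w := fun k => hw _
      energy_le := fun k => hen' _
      tendsto_u := fun t η => (hx t η).comp hn₂.tendsto_atTop
      tendsto_w := hy }⟩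

end Limit

/-! ### Properties of the limit of the regularized solutions. -/

namespace IsWaveLimit

variable {N : ℕ} {δ κ p α : ℝ} {f : Vec N → Vec N → Vec N} {Φ Ψ : Vec N → Vec N → ℝ}
  {g : Vec N → ℝ} {S : ℕ → Set (Vec N)} {F : ℕ → Vec N → Vec N → Vec N}
  {φ : ℕ → Vec N → Vec N → ℝ} {E : ℝ} {a b : LTwo N} {ns : ℕ → ℕ} {A : ℕ → LTwo N → LTwo N}
  {u w : ℕ → ℝ → LTwo N} {x y : ℝ → LTwo N}

theorem continuous_u (hw : IsWaveLimit δ F φ E a b ns A u w x y) (k : ℕ) : Continuous (u k) :=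
  continuous_iff_continuousAt.2 fun t => (hw.hasDerivAt_u k t).continuousAt

theorem continuous_w (hw : IsWaveLimit δ F φ E a b ns A u w x y) (k : ℕ) : Continuous (w k) :=
  continuous_iff_continuousAt.2 fun t => (hw.hasDerivAt_w k t).continuousAt

theorem norm_w_le (hw : IsWaveLimit δ F φ E a b ns A u w x y)
    (h : IsRegularization δ κ p α f Φ g S F φ) (k : ℕ) (t : ℝ) : ‖w k t‖ ≤ √(2 * E) :=
  h.norm_velocity_le (hw.energy_le k t)

theorem norm_u_le (hw : IsWaveLimit δ F φ E a b ns A u w x y)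
    (h : IsRegularization δ κ p α f Φ g S F φ) (k : ℕ) (t : ℝ) :
    ‖u k t‖ ≤ ‖a‖ + √(2 * E) * |t| := by
  rw [← hw.u_zero k]
  exact norm_le_of_norm_deriv_le (hw.hasDerivAt_u k) (hw.norm_w_le h k) t

theorem integral_φ_le (hw : IsWaveLimit δ F φ E a b ns A u w x y) (k : ℕ) (t : ℝ) :
    ∫ z, φ (ns k) z.2 (u k t z.1 - u k t (z.1 - z.2)) ∂(pairMeasure N δ)
      ≤ 2 * E - ‖w k t‖ ^ 2 := by
  have := hw.energy_le k t
  rw [potentialEnergy] at this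
  linarith

theorem integral_φ_le_two_mul (hw : IsWaveLimit δ F φ E a b ns A u w x y) (k : ℕ) (t : ℝ) :
    ∫ z, φ (ns k) z.2 (u k t z.1 - u k t (z.1 - z.2)) ∂(pairMeasure N δ) ≤ 2 * E :=
  (hw.integral_φ_le k t).trans (by linarith [sq_nonneg ‖w k t‖])

theorem norm_x_le (hw : IsWaveLimit δ F φ E a b ns A u w x y)
    (h : IsRegularization δ κ p α f Φ g S F φ) (t : ℝ) : ‖x t‖ ≤ ‖a‖ + √(2 * E) * |t| :=
  norm_le_of_weak_limit (fun k => hw.norm_u_le h k t) (hw.tendsto_u t _)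

theorem norm_y_le (hw : IsWaveLimit δ F φ E a b ns A u w x y)
    (h : IsRegularization δ κ p α f Φ g S F φ) (t : ℝ) : ‖y t‖ ≤ √(2 * E) :=
  norm_le_of_weak_limit (fun k => hw.norm_w_le h k t) (hw.tendsto_w t _)

theorem measurable_inner_x (hw : IsWaveLimit δ F φ E a b ns A u w x y) (η : LTwo N) :
    Measurable fun t => ⟪η, x t⟫_ℝ :=
  measurable_of_tendsto_metrizable
    (fun k => (continuous_const.inner (hw.continuous_u k)).measurable)
    (tendsto_pi_nhds.2 fun t => hw.tendsto_u t η)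

theorem measurable_inner_y (hw : IsWaveLimit δ F φ E a b ns A u w x y) (η : LTwo N) :
    Measurable fun t => ⟪η, y t⟫_ℝ :=
  measurable_of_tendsto_metrizable
    (fun k => (continuous_const.inner (hw.continuous_w k)).measurable)
    (tendsto_pi_nhds.2 fun t => hw.tendsto_w t η)

/-- The energy bounds the potential part by `2 E - ‖w k t‖ ^ 2`, and the velocities converge only
weakly. The bound `‖w‖ ^ 2 ≥ 2 ⟪y, w⟫ - ‖y‖ ^ 2`, an equality at `w = y`, replaces the square by a
weakly continuous term, and Fatou's lemma treats both energies at once. -/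
theorem lintegral_Φ_le (hw : IsWaveLimit δ F φ E a b ns A u w x y)
    (h : IsRegularization δ κ p α f Φ g S F φ) (hN : 1 ≤ N) (hδ : 0 < δ)
    (hf : IsHyperelastic κ p α f Φ Ψ) (t : ℝ) :
    ∫⁻ z, ENNReal.ofReal (Φ z.2 (x t z.1 - x t (z.1 - z.2))) ∂(pairMeasure N δ)
      ≤ ENNReal.ofReal (2 * E - ‖y t‖ ^ 2) := by
  have h1 : Tendsto (fun k => 2 * E - (2 * ⟪y t, w k t⟫_ℝ - ‖y t‖ ^ 2)) atTop
      (𝓝 (2 * E - ‖y t‖ ^ 2)) := by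
    have h2 := (((hw.tendsto_w t (y t)).const_mul 2).sub_const (‖y t‖ ^ 2)).const_sub (2 * E)
    convert h2 using 2
    rw [real_inner_self_eq_norm_sq]
    ring
  refine h.lintegral_Φ_le hN hδ hf hw.ns_tendsto (fun k => hw.norm_u_le h k t)
    (fun k => hw.integral_φ_le_two_mul k t) (hw.tendsto_u t) h1 fun k => ?_
  have h3 := norm_sub_sq_real (y t) (w k t)
  linarith [hw.integral_φ_le k t, sq_nonneg ‖y t - w k t‖]

theorem energy_limit_le (hw : IsWaveLimit δ F φ E a b ns A u w x y)
    (h : IsRegularization δ κ p α f Φ g S F φ) (hN : 1 ≤ N) (hδ : 0 < δ)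
    (hf : IsHyperelastic κ p α f Φ Ψ) (hE : 0 ≤ E) (t : ℝ) :
    ‖y t‖ₑ ^ 2 + ∫⁻ z, ENNReal.ofReal (Φ z.2 (x t z.1 - x t (z.1 - z.2))) ∂(pairMeasure N δ)
      ≤ ENNReal.ofReal (2 * E) := by
  -- `ENNReal.ofReal` truncates at zero, so the two parts add up to `2 E` only if `2 E - ‖y t‖ ^ 2`
  -- is nonnegative.
  have h1 : ‖y t‖ ^ 2 ≤ 2 * E := by
    rw [← Real.sq_sqrt (by positivity : 0 ≤ 2 * E)]
    gcongr
    exact hw.norm_y_le h t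
  calc _ ≤ ENNReal.ofReal (‖y t‖ ^ 2) + ENNReal.ofReal (2 * E - ‖y t‖ ^ 2) := by
        rw [ENNReal.ofReal_pow (norm_nonneg _), ofReal_norm]
        gcongr
        exact hw.lintegral_Φ_le h hN hδ hf t
    _ = ENNReal.ofReal (2 * E) := by
        rw [← ENNReal.ofReal_add (by positivity) (by linarith)]
        congr 1
        ring

theorem integral_inner_timeDeriv (hw : IsWaveLimit δ F φ E a b ns A u w x y)
    (h : IsRegularization δ κ p α f Φ g S F φ) {v : ℝ → Vec N → Vec N} (hv : IsTestFunction v)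
    (hv0 : ∀ x, v 0 x = 0) :
    ∫ t in Ioi (0 : ℝ), ⟪x t, hv.timeDeriv.curve t⟫_ℝ
      = -∫ t in Ioi (0 : ℝ), ⟪y t, hv.curve t⟫_ℝ := by
  have h1 := tendsto_integral_inner_curve hv.timeDeriv hw.continuous_u (Real.sqrt_nonneg _)
    (hw.norm_u_le h) hw.tendsto_u
  have h2 := tendsto_integral_inner_curve hv hw.continuous_w le_rfl
    (c₀ := √(2 * E)) (by simpa using hw.norm_w_le h) hw.tendsto_w
  refine tendsto_nhds_unique h1 (h2.neg.congr fun k => ?_)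
  obtain ⟨R, -, -, -, h0⟩ := hv.exists_norm_curve_le
  obtain ⟨R', -, -, -, h0'⟩ := hv.timeDeriv.exists_norm_curve_le
  have h3 := Peridynamics.integral_inner_timeDeriv hv (hw.hasDerivAt_u k) (hw.continuous_w k)
  rw [integral_add, hv.curve_eq_zero hv0, inner_zero_right] at h3
  · linarith
  · refine integrableOn_Ioi_of_eq_zero (R := R')
      ((hw.continuous_u k).inner hv.timeDeriv.continuous_curve) fun t ht => ?_
    rw [h0' t (ht.trans (le_abs_self t)), inner_zero_right]
  · refine integrableOn_Ioi_of_eq_zero (R := R)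
      ((hw.continuous_w k).inner hv.continuous_curve) fun t ht => ?_
    rw [h0 t (ht.trans (le_abs_self t)), inner_zero_right]

/-- At each time the form converges because the energies are bounded. The bound of the form by the
energy is uniform in time, and the test function vanishes for large times, so dominated convergence
applies to the time integral. -/
theorem integral_weak_form (hw : IsWaveLimit δ F φ E a b ns A u w x y)
    (h : IsRegularization δ κ p α f Φ g S F φ) (hN : 1 ≤ N) (hδ : 0 < δ)
    (hf : IsHyperelastic κ p α f Φ Ψ) (hg0 : ∀ y, 0 ≤ g y) (hg : IntegrableOn g (ball 0 δ))
    {v : ℝ → Vec N → Vec N} (hv : IsTestFunction v) :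
    ∫ t in Ioi (0 : ℝ), (⟪x t, hv.timeDeriv.timeDeriv.curve t⟫_ℝ - pairing δ f (x t) (v t))
      = ⟪b, hv.curve 0⟫_ℝ - ⟪a, hv.timeDeriv.curve 0⟫_ℝ := by
  obtain ⟨L, R, hR, hbump, h0⟩ := hv.exists_isBump
  obtain ⟨R₂, B₂, hR₂, hB₂, h0₂⟩ := hv.timeDeriv.timeDeriv.exists_norm_curve_le
  obtain ⟨B, hB⟩ := h.exists_form_bound hN hf hg0 hg (2 * E) L R
  have hA : ∀ k t, ⟪A k (u k t), hv.curve t⟫_ℝ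
      = 1 / 2 * ∫ z, formIntegrand (F (ns k)) (u k t) (v t) z ∂(pairMeasure N δ) := fun k t => by
    rw [hw.inner_A, integral_congr_ae
      (formIntegrand_ae_congr _ (ae_eq_refl _) (hv.coeFn_curve t))]
  have hlim := tendsto_integral_Ioi
    (a := fun k t => ⟪u k t, hv.timeDeriv.timeDeriv.curve t⟫_ℝ + ⟪A k (u k t), hv.curve t⟫_ℝ)
    (a' := fun t => ⟪x t, hv.timeDeriv.timeDeriv.curve t⟫_ℝ - pairing δ f (x t) (v t))
    (R := max R R₂) (B := (‖a‖ + √(2 * E) * max R R₂) * B₂ + 1 / 2 * B) (fun k => ?_)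
    (fun t => ?_) (fun k t ht htR => ?_) (fun k t ht => ?_)
  -- The approximate integrals do not depend on `k`: each equals the same expression in the common
  -- initial data.
  · refine tendsto_nhds_unique hlim (tendsto_const_nhds.congr fun k => ?_)
    rw [integral_inner_timeDeriv_timeDeriv hv (hw.hasDerivAt_u k) (hw.hasDerivAt_w k)
      (hw.continuous_A k), hw.u_zero, hw.w_zero]
  · exact ((hw.continuous_u k).inner hv.timeDeriv.timeDeriv.continuous_curve).add
      (((hw.continuous_A k).comp (hw.continuous_u k)).inner hv.continuous_curve)
  · have h1 := (h.tendsto_form hN hδ hf hg0 hg hw.ns_tendsto (fun k => hw.norm_u_le h k t)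
      (fun k => hw.integral_φ_le_two_mul k t) (hw.tendsto_u t) (hbump t)).2.const_mul (1 / 2)
    have h2 := hw.tendsto_u t (hv.timeDeriv.timeDeriv.curve t)
    simp only [real_inner_comm] at h2
    simp only [hA, pairing, neg_mul, sub_neg_eq_add]
    exact h2.add h1
  · refine (abs_add_le _ _).trans (add_le_add ?_ ?_)
    · have h1 := hw.norm_u_le h k t
      rw [abs_of_pos ht] at h1
      have h2 : ‖u k t‖ ≤ ‖a‖ + √(2 * E) * max R R₂ := h1.trans (by gcongr)
      exact (abs_real_inner_le_norm _ _).trans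
        (mul_le_mul h2 (hB₂ t) (norm_nonneg _) ((norm_nonneg _).trans h2))
    · rw [hA, abs_mul, abs_of_pos (by norm_num : (0 : ℝ) < 1 / 2)]
      exact mul_le_mul_of_nonneg_left (hB _ _ _ (hbump t) (hw.integral_φ_le_two_mul k t))
        (by norm_num)
  · rw [h0₂ t (((le_max_right _ _).trans ht).trans (le_abs_self t)), hv.curve_eq_zero fun x =>
      h0 t x (((le_max_left _ _).trans ht).trans (le_abs_self t)), inner_zero_right,
      inner_zero_right, add_zero]

end IsWaveLimit

/-! ### The limit is a weak solution. -/

section Solution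

variable {N : ℕ} {δ κ p α : ℝ} {f : Vec N → Vec N → Vec N} {Φ Ψ : Vec N → Vec N → ℝ}
  {g : Vec N → ℝ} {S : ℕ → Set (Vec N)} {F : ℕ → Vec N → Vec N → Vec N}
  {φ : ℕ → Vec N → Vec N → ℝ}

/-- The bound of `IsRegularization.exists_bumpBound` for the unregularized force. -/
theorem IsRegularization.exists_force_bumpBound (h : IsRegularization δ κ p α f Φ g S F φ)
    (hN : 1 ≤ N) (hp : 0 < p) (hg0 : ∀ y, 0 ≤ g y) :
    ∃ C, ∀ (M : ℝ≥0) (R : ℝ) (η : Vec N → Vec N), IsBump M R η → ∀ u : Vec N → Vec N,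
      ∀ᵐ z ∂(pairMeasure N δ), |formIntegrand f u η z|
        ≤ Φ z.2 (u z.1 - u (z.1 - z.2)) + bumpBound N δ p α g C M R z := by
  obtain ⟨C, -, hC⟩ := h.exists_bumpBound hp hg0 one_pos
  refine ⟨C, fun M R η hη u => ?_⟩
  filter_upwards [ae_bond_ne_zero hN, ae_bond_mem_ball,
    Measure.quasiMeasurePreserving_snd.ae h.eventually_eq] with z hz hzδ hev
  obtain ⟨n, hn⟩ := (hev ‖u z.1 - u (z.1 - z.2)‖).exists
  obtain ⟨h1, h2⟩ := hn _ le_rfl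
  have h3 := hC M R η hη n u z hz hzδ
  rwa [formIntegrand, h1, h2, one_mul, ← formIntegrand] at h3

theorem IsHyperelastic.seminormPow_le (hf : IsHyperelastic κ p α f Φ Ψ) (hN : 1 ≤ N)
    (u : Vec N → Vec N) :
    seminormPow δ p α u ≤ ENNReal.ofReal κ⁻¹ *
      ∫⁻ x, ∫⁻ y in ball (0 : Vec N) δ, ENNReal.ofReal (Φ y (u x - u (x - y))) := by
  have : Nonempty (Fin N) := ⟨⟨0, hN⟩⟩
  have hne : ∀ᵐ y : Vec N, y ≠ 0 := by simp [ae_iff]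
  rw [seminormPow, ← lintegral_const_mul' _ _ ENNReal.ofReal_ne_top]
  refine lintegral_mono fun x => ?_
  simp only
  rw [← lintegral_const_mul' _ _ ENNReal.ofReal_ne_top]
  refine lintegral_mono_ae ?_
  filter_upwards [ae_restrict_of_ae hne] with y hy
  rw [← ENNReal.ofReal_mul (inv_nonneg.2 hf.κ_pos.le)]
  refine ENNReal.ofReal_le_ofReal ?_
  rw [← div_eq_inv_mul, le_div_iff₀ hf.κ_pos, mul_comm]
  exact hf.κ_mul_le_Φ hy _

theorem aestronglyMeasurable_form_prod (hN : 1 ≤ N) (hf : IsHyperelastic κ p α f Φ Ψ)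
    {U : ℝ → Vec N → Vec N} (hU : StronglyMeasurable fun q : ℝ × Vec N => U q.1 q.2)
    {v : ℝ → Vec N → Vec N} (hv : IsTestFunction v) :
    AEStronglyMeasurable (fun q : ℝ × Vec N × Vec N => formIntegrand f (U q.1) (v q.1) q.2)
      ((volume.restrict (Ioi 0)).prod (pairMeasure N δ)) := by
  have h1 : Measurable fun q : ℝ × Vec N × Vec N => U q.1 q.2.1 :=
    hU.measurable.comp (measurable_fst.prodMk measurable_snd.fst)
  have h2 : Measurable fun q : ℝ × Vec N × Vec N => U q.1 (q.2.1 - q.2.2) :=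
    hU.measurable.comp (measurable_fst.prodMk (measurable_snd.fst.sub measurable_snd.snd))
  have h3 := aestronglyMeasurable_comp_bond (G := fun z : Vec N × Vec N => f z.1 z.2)
    hf.f_contDiff.continuousOn (μ := (volume.restrict (Ioi 0)).prod (pairMeasure N δ))
    (measurable_snd.snd.prodMk (h1.sub h2)).aemeasurable
    (Measure.quasiMeasurePreserving_snd.ae (ae_bond_ne_zero hN))
  have hc := hv.smooth.continuous
  have h4 : Continuous fun q : ℝ × Vec N × Vec N => v q.1 q.2.1 - v q.1 (q.2.1 - q.2.2) :=
    (hc.comp (continuous_fst.prodMk continuous_snd.fst)).sub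
      (hc.comp (continuous_fst.prodMk (continuous_snd.fst.sub continuous_snd.snd)))
  exact h3.inner h4.aestronglyMeasurable

/-- At each time the integrand is dominated by the energy density plus the fixed bound for bumps,
whose integral is at most `E + B`; for times beyond `R` it vanishes. -/
theorem IsRegularization.integrable_form_prod (h : IsRegularization δ κ p α f Φ g S F φ)
    (hN : 1 ≤ N) (hf : IsHyperelastic κ p α f Φ Ψ) (hg0 : ∀ y, 0 ≤ g y)
    (hg : IntegrableOn g (ball 0 δ)) {U : ℝ → Vec N → Vec N}
    (hU : StronglyMeasurable fun q : ℝ × Vec N => U q.1 q.2) {E : ℝ≥0∞} (hE : E ≠ ⊤)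
    (hUE : ∀ t, ∫⁻ z, ENNReal.ofReal (Φ z.2 (U t z.1 - U t (z.1 - z.2))) ∂(pairMeasure N δ) ≤ E)
    {v : ℝ → Vec N → Vec N} (hv : IsTestFunction v) :
    Integrable (fun q : ℝ × Vec N × Vec N => formIntegrand f (U q.1) (v q.1) q.2)
      ((volume.restrict (Ioi 0)).prod (pairMeasure N δ)) := by
  have hp : 0 < p := by linarith [hf.two_le_p]
  have hm := aestronglyMeasurable_form_prod (δ := δ) hN hf hU hv
  obtain ⟨L, R, hR, hbump, h0⟩ := hv.exists_isBump
  obtain ⟨C, hC⟩ := h.exists_force_bumpBound hN hp hg0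
  have hb := integrable_bumpBound hN hp hf.α_lt_one hg C L R
  set B := ∫⁻ z, ENNReal.ofReal (bumpBound N δ p α g C L R z) ∂(pairMeasure N δ) with hB
  refine ⟨hm, ?_⟩
  rw [hasFiniteIntegral_iff_enorm, lintegral_prod _ hm.enorm]
  have key : ∀ t ∈ Ioi (0 : ℝ), ∫⁻ z, ‖formIntegrand f (U t) (v t) z‖ₑ ∂(pairMeasure N δ)
      ≤ (Ioo 0 R).indicator (fun _ => E + B) t := fun t ht => by
    rcases lt_or_ge t R with htR | htR
    · rw [indicator_of_mem (show t ∈ Ioo 0 R from ⟨ht, htR⟩)]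
      calc _ ≤ ∫⁻ z, (ENNReal.ofReal (Φ z.2 (U t z.1 - U t (z.1 - z.2)))
            + ENNReal.ofReal (bumpBound N δ p α g C L R z)) ∂(pairMeasure N δ) := by
            refine lintegral_mono_ae ?_
            filter_upwards [hC L R _ (hbump t) (U t)] with z hz
            rw [← ofReal_norm, Real.norm_eq_abs]
            exact (ENNReal.ofReal_le_ofReal hz).trans ENNReal.ofReal_add_le
        _ ≤ E + B := by
            rw [lintegral_add_right' _ hb.1.aemeasurable.ennreal_ofReal]
            exact add_le_add (hUE t) le_rfl
    · have hz : ∀ x, v t x = 0 := fun x => h0 t x (htR.trans (le_abs_self t))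
      simp [formIntegrand, hz]
  refine (setLIntegral_mono' measurableSet_Ioi key).trans_lt ?_
  refine (setLIntegral_le_lintegral _ _).trans_lt ?_
  rw [lintegral_indicator measurableSet_Ioo, setLIntegral_const]
  have hBtop : B ≠ ⊤ := hb.lintegral_lt_top.ne
  exact ENNReal.mul_lt_top (ENNReal.add_lt_top.2 ⟨hE.lt_top, hBtop.lt_top⟩) (by simp)

theorem integral_inner_congr {c : LTwo N} {d η : Vec N → Vec N} (hd : d =ᵐ[volume] c) :
    ∫ x, ⟪d x, η x⟫_ℝ = ∫ x, ⟪c x, η x⟫_ℝ :=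
  integral_congr_ae (by filter_upwards [hd] with x hx; rw [hx])

theorem lintegral_Φ_congr {c d : Vec N → Vec N} (hd : d =ᵐ[volume] c) :
    ∫⁻ z, ENNReal.ofReal (Φ z.2 (d z.1 - d (z.1 - z.2))) ∂(pairMeasure N δ)
      = ∫⁻ z, ENNReal.ofReal (Φ z.2 (c z.1 - c (z.1 - z.2))) ∂(pairMeasure N δ) :=
  lintegral_congr_ae (by filter_upwards [diff_ae_congr hd] with z hz; rw [hz])

theorem eLpNorm_congr_LTwo {c : LTwo N} {d : Vec N → Vec N} (hd : d =ᵐ[volume] c) :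
    eLpNorm d 2 volume = ‖c‖ₑ := by
  rw [eLpNorm_congr_ae hd, Lp.enorm_def]

theorem pairing_congr {c d : Vec N → Vec N} (hd : d =ᵐ[volume] c) (η : Vec N → Vec N) :
    pairing δ f d η = pairing δ f c η := by
  rw [pairing, pairing, integral_congr_ae (formIntegrand_ae_congr f hd (ae_eq_refl η))]

namespace IsWaveLimit

variable {E : ℝ} {a b : LTwo N} {ns : ℕ → ℕ} {A : ℕ → LTwo N → LTwo N}
  {u w : ℕ → ℝ → LTwo N} {x y : ℝ → LTwo N}

theorem memX (hw : IsWaveLimit δ F φ E a b ns A u w x y)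
    (h : IsRegularization δ κ p α f Φ g S F φ) (hN : 1 ≤ N) (hδ : 0 < δ)
    (hf : IsHyperelastic κ p α f Φ Ψ) (hE : 0 ≤ E) {U W : ℝ → Vec N → Vec N}
    (hUm : StronglyMeasurable fun q : ℝ × Vec N => U q.1 q.2) (hU : ∀ t, U t =ᵐ[volume] x t)
    (hWm : StronglyMeasurable fun q : ℝ × Vec N => W q.1 q.2) (hW : ∀ t, W t =ᵐ[volume] y t) :
    MemX δ p α U W where
  u_meas := hUm.aestronglyMeasurable
  w_meas := hWm.aestronglyMeasurable
  u_bound T hT := by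
    set B : ℝ≥0∞ := ENNReal.ofReal (‖a‖ + √(2 * E) * T)
      + (ENNReal.ofReal κ⁻¹ * ENNReal.ofReal (2 * E)) ^ (1 / p) with hB
    have hp : 0 ≤ 1 / p := by have := hf.two_le_p; positivity
    have hBtop : B ≠ ⊤ := ENNReal.add_ne_top.2 ⟨ENNReal.ofReal_ne_top,
      ENNReal.rpow_ne_top_of_nonneg hp
        (ENNReal.mul_ne_top ENNReal.ofReal_ne_top ENNReal.ofReal_ne_top)⟩
    refine ⟨B.toNNReal, ?_⟩
    filter_upwards [ae_restrict_mem measurableSet_Ioo] with t ht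
    rw [ENNReal.coe_toNNReal hBtop, wNorm]
    refine add_le_add ?_ (ENNReal.rpow_le_rpow ?_ hp)
    · rw [eLpNorm_congr_LTwo (hU t), ← ofReal_norm]
      refine ENNReal.ofReal_le_ofReal ((hw.norm_x_le h t).trans ?_)
      rw [abs_of_pos ht.1]
      have := ht.2.le
      gcongr
    · refine (hf.seminormPow_le hN _).trans (mul_le_mul_right ?_ _)
      rw [hf.lintegral_Φ_eq hN ((Lp.aestronglyMeasurable (x t)).congr (hU t).symm),
        lintegral_Φ_congr (hU t)]
      exact le_add_self.trans (hw.energy_limit_le h hN hδ hf hE t)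
  w_bound := ⟨(√(2 * E)).toNNReal, Eventually.of_forall fun t => by
    rw [eLpNorm_congr_LTwo (hW t), ← ofReal_norm]
    exact ENNReal.ofReal_le_ofReal (hw.norm_y_le h t)⟩
  timeDeriv v hv hsupp := by
    -- Support in positive times removes the boundary term at `t = 0`.
    have hv0 : ∀ x, v 0 x = 0 := fun x => by
      by_contra hne
      exact lt_irrefl (0 : ℝ) (hsupp (subset_tsupport _ (show ((0 : ℝ), x) ∈ _ from hne))).1
    have h1 := hw.integral_inner_timeDeriv h hv hv0
    simp only [IsTestFunction.inner_curve] at h1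
    simp only [integral_inner_congr (hU _), integral_inner_congr (hW _)]
    exact h1

theorem isWeakSolution (hw : IsWaveLimit δ F φ E a b ns A u w x y)
    (h : IsRegularization δ κ p α f Φ g S F φ) (hN : 1 ≤ N) (hδ : 0 < δ)
    (hf : IsHyperelastic κ p α f Φ Ψ) (hg0 : ∀ y, 0 ≤ g y) (hg : IntegrableOn g (ball 0 δ))
    (hE : 0 ≤ E) {U W : ℝ → Vec N → Vec N}
    (hUm : StronglyMeasurable fun q : ℝ × Vec N => U q.1 q.2) (hU : ∀ t, U t =ᵐ[volume] x t)
    (hWm : StronglyMeasurable fun q : ℝ × Vec N => W q.1 q.2) (hW : ∀ t, W t =ᵐ[volume] y t)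
    {u₀ v₀ : Vec N → Vec N} (hu₀ : u₀ =ᵐ[volume] a) (hv₀ : v₀ =ᵐ[volume] b) :
    IsWeakSolution δ p α f u₀ v₀ U W where
  memX := hw.memX h hN hδ hf hE hUm hU hWm hW
  integrable v hv := h.integrable_form_prod hN hf hg0 hg hUm
    (ENNReal.ofReal_ne_top (r := 2 * E)) (fun t => by
      rw [lintegral_Φ_congr (hU t)]
      exact le_add_self.trans (hw.energy_limit_le h hN hδ hf hE t)) hv
  weak_eq v hv := by
    have h1 := hw.integral_weak_form h hN hδ hf hg0 hg hv
    simp only [IsTestFunction.inner_curve] at h1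
    simp only [integral_inner_congr (hU _), pairing_congr (hU _), integral_inner_congr hu₀,
      integral_inner_congr hv₀]
    have h2 : ∀ t x, deriv (deriv fun s => v s x) t
        = Peridynamics.timeDeriv (Peridynamics.timeDeriv v) t x := fun t x => rfl
    have h3 : ∀ x, deriv (fun s => v s x) 0 = Peridynamics.timeDeriv v 0 x := fun x => rfl
    simp only [h2, h3]
    rw [h1]
    ring

end IsWaveLimit

/-- The weak limits are curves of classes in `L²`; jointly measurable representatives turn them into
functions of `(t, x)`. Weak convergence holds at every time, and so does the energy inequality. -/
theorem IsHyperelastic.exists_weakSolution (hf : IsHyperelastic κ p α f Φ Ψ) (hN : 1 ≤ N)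
    (hδ : 0 < δ) {u₀ v₀ : Vec N → Vec N} (hu₀ : MemLp u₀ 2 volume) (hv₀ : MemLp v₀ 2 volume)
    (hE : ∫⁻ x, ∫⁻ y in ball (0 : Vec N) δ, ENNReal.ofReal (Φ y (u₀ x - u₀ (x - y))) < ⊤) :
    ∃ u w : ℝ → Vec N → Vec N, IsWeakSolution δ p α f u₀ v₀ u w ∧
      ∀ t, energy δ Φ (u t) (w t) ≤ energy δ Φ u₀ v₀ := by
  obtain ⟨g, hg0, hgL, hgb⟩ := hf.Ψ_bound
  have hgp : MemLp g 2 (volume.restrict (ball 0 δ)) :=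
    (hgL _ (isCompact_closedBall (0 : Vec N) δ)).mono_measure
      (Measure.restrict_mono ball_subset_closedBall le_rfl)
  have hg : IntegrableOn g (ball 0 δ) := hgp.integrable one_le_two
  obtain ⟨S, h⟩ := hf.isRegularization hN δ hg0 hgp.1.aemeasurable hgb
  set a : LTwo N := hu₀.toLp u₀ with ha
  set b : LTwo N := hv₀.toLp v₀ with hb
  have hua : u₀ =ᵐ[volume] a := hu₀.coeFn_toLp.symm
  have hvb : v₀ =ᵐ[volume] b := hv₀.coeFn_toLp.symm
  set I := ∫⁻ x, ∫⁻ y in ball (0 : Vec N) δ, ENNReal.ofReal (Φ y (u₀ x - u₀ (x - y))) with hI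
  have hIa : ∫⁻ z, ENNReal.ofReal (Φ z.2 (a z.1 - a (z.1 - z.2))) ∂(pairMeasure N δ) = I := by
    rw [hI, hf.lintegral_Φ_eq hN hu₀.1, lintegral_Φ_congr hua]
  set E : ℝ := ‖b‖ ^ 2 / 2 + 1 / 2 * I.toReal with hEdef
  have hE0 : 0 ≤ E := by positivity
  obtain ⟨ns, A, u, w, x, y, hw⟩ := h.exists_isWaveLimit (E := E) hN hf hg0 hg a b fun n => by
    have := h.potentialEnergy_le hN n a (by rw [hIa]; exact hE.ne)
    rw [hIa] at this
    linarith
  obtain ⟨U, hUm, hU⟩ := exists_jointly_measurable (measurable_dist_of_weak hw.measurable_inner_x)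
  obtain ⟨W, hWm, hW⟩ := exists_jointly_measurable (measurable_dist_of_weak hw.measurable_inner_y)
  refine ⟨U, W, hw.isWeakSolution h hN hδ hf hg0 hg hE0 hUm hU hWm hW hua hvb, fun t => ?_⟩
  rw [energy, energy, ← hI, eLpNorm_congr_LTwo (hW t), eLpNorm_congr_LTwo hvb,
    hf.lintegral_Φ_eq hN ((Lp.aestronglyMeasurable (x t)).congr (hU t).symm),
    lintegral_Φ_congr (hU t), ← ENNReal.add_div, ← ENNReal.add_div]
  refine ENNReal.div_le_div_right ((hw.energy_limit_le h hN hδ hf hE0 t).trans (le_of_eq ?_)) _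
  rw [← ofReal_norm, ← ENNReal.ofReal_pow (norm_nonneg _), ← ENNReal.ofReal_toReal hE.ne,
    ← ENNReal.ofReal_add (by positivity) ENNReal.toReal_nonneg]
  congr 1
  rw [hEdef]
  ring

end Solution

end Peridynamics

/-- Existence of a global weak solution of the peridynamic Cauchy problem, with energy bounded
by the energy of the initial datum, for every initial datum of finite energy. -/
theorem theorem2p3 {N : ℕ} (hN : 1 ≤ N) (δ : ℝ) (hδ : 0 < δ) (κ p α : ℝ)
    (f : Peridynamics.Vec N → Peridynamics.Vec N → Peridynamics.Vec N)
    (Φ Ψ : Peridynamics.Vec N → Peridynamics.Vec N → ℝ)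
    (hf : Peridynamics.IsHyperelastic κ p α f Φ Ψ)
    (u₀ v₀ : Peridynamics.Vec N → Peridynamics.Vec N)
    (hu₀ : MemLp u₀ 2 volume) (hv₀ : MemLp v₀ 2 volume)
    (hE : ∫⁻ x, ∫⁻ y in ball (0 : Peridynamics.Vec N) δ,
      ENNReal.ofReal (Φ y (u₀ x - u₀ (x - y))) < ⊤) :
    ∃ u w : ℝ → Peridynamics.Vec N → Peridynamics.Vec N,
      Peridynamics.IsWeakSolution δ p α f u₀ v₀ u w ∧
      ∀ᵐ t ∂(volume.restrict (Ioi (0 : ℝ))),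
        Peridynamics.energy δ Φ (u t) (w t) ≤ Peridynamics.energy δ Φ u₀ v₀ := by
  obtain ⟨u, w, h1, h2⟩ := hf.exists_weakSolution hN hδ hu₀ hv₀ hE
  exact ⟨u, w, h1, Eventually.of_forall h2⟩
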